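/- There are a deterministic algorithm and an absolute constant $C$ with the following property. Let $n\ge 1$ and $M\ge 1$ be integers and let $f:2^{[n]}\to\mathbb Z$ be a submodular function, i.e. $f(S\cup\{i\})-f(S)\ge f(T\cup\{i\})-f(T)$ for all $S\subseteq T\subseteq[n]$ and $i\in[n]\setminus T$, such that $|f(S)|\le M$ for all $S\subseteq[n]$. Given $n$, $M$ and access to an evaluation oracle for $f$, the algorithm computes a set $S\subseteq[n]$ with $f(S)=\min_{T\subseteq[n]}f(T)$ in time at most $$C\cdot n\,M^3\cdot \mathrm{EO}\cdot\log(n+1),$$ that is, in time $O(nM^3\,\mathrm{EO}\,\log n)$ for $n\ge 2$. Here $\mathrm{EO}\ge 1$ is the time of one oracle call: given a linked list in memory that stores a permutation $P=(P_1,\dots,P_n)$ of $[n]$, and a position $k\in\{0,\dots,n\}$, the oracle returns $f(\{P_1,\dots,P_k\})$ in time $\mathrm{EO}$. The algorithm is one program, independent of $n$, $M$, $f$ and $\mathrm{EO}$, for a random access machine with integer registers and integer memory cells (all $0$ initially, except for the inputs $n$ and $M$), whose only other operations are constants, memory reads and writes, addition, subtraction and comparison, each at unit cost; the output is the characteristic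 vector of $S$ in memory. -/

import Mathlib

/-!
Submodular set functions on `[n]` (modelled by `Fin n`), and a unit-cost random access machine
with an evaluation oracle for a set function.
-/

namespace SFM

/-- Submodularity, as diminishing marginal returns: `f(S ∪ {i}) - f(S) ≥ f(T ∪ {i}) - f(T)`
whenever `S ⊆ T` and `i ∉ T`. -/
def IsSubmodular {n : ℕ} (f : Finset (Fin n) → ℤ) : Prop :=
  ∀ (S T : Finset (Fin n)) (i : Fin n), S ⊆ T → i ∉ T →
    f (insert i T) - f T ≤ f (insert i S) - f S

/-- `P[k]`: the set of the first `k` elements `P 0, …, P (k-1)` of a permutation `P` of `[n]`. -/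
def permPrefix {n : ℕ} (P : Equiv.Perm (Fin n)) (k : ℕ) : Finset (Fin n) :=
  (Finset.univ.filter fun j : Fin n => (j : ℕ) < k).image P

/-! ### The machine

A program is a structured program on a random access machine. The machine has registers and an
addressable memory, all of whose cells hold integers. A single operation is one addition,
subtraction, comparison, read, write or constant, at unit cost; there is no multiplication,
division or bit operation. -/

/-- A configuration of the machine: the contents of the registers and of the memory. -/
structure State where
  reg : ℕ → ℤ
  mem : ℤ → ℤ

/-- Arithmetical expressions: integer constants, registers, memory reads, sums, differences. -/
inductive Exp where
  | lit (z : ℤ)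
  | reg (i : ℕ)
  | load (a : Exp)
  | add (a b : Exp)
  | sub (a b : Exp)

/-- The value of an expression. -/
def Exp.val (s : State) : Exp → ℤ
  | .lit z => z
  | .reg i => s.reg i
  | .load a => s.mem (a.val s)
  | .add a b => a.val s + b.val s
  | .sub a b => a.val s - b.val s

/-- The time for evaluating an expression: the number of its operations. -/
def Exp.cost : Exp → ℕ
  | .lit _ => 1
  | .reg _ => 1
  | .load a => a.cost + 1
  | .add a b => a.cost + b.cost + 1
  | .sub a b => a.cost + b.cost + 1

/-- Programs. `set i a` writes the value of `a` to register `i`; `store a b` writes the value of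
`b` to the memory cell with address `a`; `query i a k` writes to register `i` the oracle's answer
for the linked list with head address `a` and the position `k`; `ite a b p q` runs `p` if `a ≤ b`
and `q` otherwise; `loop a b p` repeats `p` as long as `a ≤ b`. -/
inductive Prog where
  | skip
  | set (i : ℕ) (a : Exp)
  | store (a b : Exp)
  | query (i : ℕ) (a k : Exp)
  | seq (p q : Prog)
  | ite (a b : Exp) (p q : Prog)
  | loop (a b : Exp) (p : Prog)

/-- The configuration after writing `z` to register `i`. -/
def State.setReg (s : State) (i : ℕ) (z : ℤ) : State :=
  { s with reg := Function.update s.reg i z }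

/-- The configuration after writing `z` to the memory cell with address `a`. -/
def State.setMem (s : State) (a z : ℤ) : State :=
  { s with mem := Function.update s.mem a z }

/-- Linked lists in memory: a node at address `a` holds its entry in cell `a` and the address of
the next node in cell `a + 1`. `s.node head j` is the address of the `j`-th node (counted from
`0`) of the list with head address `head`. -/
def State.node (s : State) (head : ℤ) : ℕ → ℤ
  | 0 => head
  | j + 1 => s.mem (s.node head j + 1)

/-- The linked list with head address `head` stores the permutation `P` of `[n]`. -/
def State.ListStores {n : ℕ} (s : State) (head : ℤ) (P : Equiv.Perm (Fin n)) : Prop :=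
  ∀ j : Fin n, s.mem (s.node head j) = ((P j : ℕ) : ℤ)

/-- `Exec f EO p s s' t`: started in the configuration `s`, the program `p` with evaluation oracle
for `f` halts in the configuration `s'` after time `t`. Given a linked list storing a permutation
`P` of `[n]` and a position `k`, the oracle returns `f(P[k])` in time `EO`; an ill-formed query
blocks the computation for ever. -/
inductive Exec {n : ℕ} (f : Finset (Fin n) → ℤ) (EO : ℕ) :
    Prog → State → State → ℕ → Prop
  | skip (s : State) : Exec f EO .skip s s 1
  | set (s : State) (i : ℕ) (a : Exp) :
      Exec f EO (.set i a) s (s.setReg i (a.val s)) (a.cost + 1)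
  | store (s : State) (a b : Exp) :
      Exec f EO (.store a b) s (s.setMem (a.val s) (b.val s)) (a.cost + b.cost + 1)
  | query (s : State) (i : ℕ) (a k : Exp) (P : Equiv.Perm (Fin n)) (m : ℕ)
      (hP : s.ListStores (a.val s) P) (hm : m ≤ n) (hk : k.val s = (m : ℤ)) :
      Exec f EO (.query i a k) s (s.setReg i (f (permPrefix P m))) (a.cost + k.cost + EO)
  | seq {p q : Prog} {s s' s'' : State} {t t' : ℕ}
      (hp : Exec f EO p s s' t) (hq : Exec f EO q s' s'' t') :
      Exec f EO (.seq p q) s s'' (t + t')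
  | ite_true {a b : Exp} {p : Prog} (q : Prog) {s s' : State} {t : ℕ}
      (h : a.val s ≤ b.val s) (hp : Exec f EO p s s' t) :
      Exec f EO (.ite a b p q) s s' (a.cost + b.cost + 1 + t)
  | ite_false {a b : Exp} (p : Prog) {q : Prog} {s s' : State} {t : ℕ}
      (h : ¬ a.val s ≤ b.val s) (hq : Exec f EO q s s' t) :
      Exec f EO (.ite a b p q) s s' (a.cost + b.cost + 1 + t)
  | loop_true {a b : Exp} {p : Prog} {s s' s'' : State} {t t' : ℕ}
      (h : a.val s ≤ b.val s) (hp : Exec f EO p s s' t)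
      (hl : Exec f EO (.loop a b p) s' s'' t') :
      Exec f EO (.loop a b p) s s'' (a.cost + b.cost + 1 + t + t')
  | loop_false {a b : Exp} (p : Prog) {s : State} (h : ¬ a.val s ≤ b.val s) :
      Exec f EO (.loop a b p) s s (a.cost + b.cost + 1)

/-- A linked list stores at most one permutation. -/
theorem State.ListStores.unique {n : ℕ} {s : State} {head : ℤ} {P Q : Equiv.Perm (Fin n)}
    (hP : s.ListStores head P) (hQ : s.ListStores head Q) : P = Q := by
  ext j
  have h := (hP j).symm.trans (hQ j)
  exact_mod_cast h

/-- The machine is deterministic: the final configuration and the time are determined by the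
program, the oracle and the initial configuration. -/
theorem Exec.deterministic {n : ℕ} {f : Finset (Fin n) → ℤ} {EO : ℕ} {p : Prog}
    {s s₁ s₂ : State} {t₁ t₂ : ℕ} (h₁ : Exec f EO p s s₁ t₁) (h₂ : Exec f EO p s s₂ t₂) :
    s₁ = s₂ ∧ t₁ = t₂ := by
  induction h₁ generalizing s₂ t₂ with
  | skip => cases h₂; exact ⟨rfl, rfl⟩
  | set => cases h₂; exact ⟨rfl, rfl⟩
  | store => cases h₂; exact ⟨rfl, rfl⟩
  | query s i a k P m hP hm hk =>
    cases h₂ with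
    | query _ _ _ _ Q m' hQ hm' hk' =>
      obtain rfl := hP.unique hQ
      obtain rfl : m = m' := by exact_mod_cast hk.symm.trans hk'
      exact ⟨rfl, rfl⟩
  | seq _ _ ihp ihq =>
    cases h₂ with
    | seq hp hq =>
      obtain ⟨rfl, rfl⟩ := ihp hp
      obtain ⟨rfl, rfl⟩ := ihq hq
      exact ⟨rfl, rfl⟩
  | ite_true _ h _ ih =>
    cases h₂ with
    | ite_true _ _ hp => obtain ⟨rfl, rfl⟩ := ih hp; exact ⟨rfl, rfl⟩
    | ite_false _ h' _ => exact absurd h h'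
  | ite_false _ h _ ih =>
    cases h₂ with
    | ite_true _ h' _ => exact absurd h' h
    | ite_false _ _ hq => obtain ⟨rfl, rfl⟩ := ih hq; exact ⟨rfl, rfl⟩
  | loop_true h _ _ ihp ihl =>
    cases h₂ with
    | loop_true _ hp hl =>
      obtain ⟨rfl, rfl⟩ := ihp hp
      obtain ⟨rfl, rfl⟩ := ihl hl
      exact ⟨rfl, rfl⟩
    | loop_false _ h' => exact absurd h h'
  | loop_false _ h =>
    cases h₂ with
    | loop_true h' _ _ => exact absurd h' h
    | loop_false _ _ => exact ⟨rfl, rfl⟩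

/-- The initial configuration on input `(n, M)`: register `0` holds `n`, register `1` holds `M`,
and all other registers and all memory cells hold `0`. -/
def inputState (n M : ℕ) : State where
  reg i := if i = 0 then (n : ℤ) else if i = 1 then (M : ℤ) else 0
  mem _ := 0

/-- The output convention: the memory cells `0, …, n-1` hold the characteristic vector of `S`. -/
def State.Outputs {n : ℕ} (s : State) (S : Finset (Fin n)) : Prop :=
  ∀ j : Fin n, s.mem ((j : ℕ) : ℤ) = if j ∈ S then 1 else 0

end SFM

/-! The algorithm is a projected subgradient method for the Lovász extension of `f`, in exact
integer arithmetic on the cube `[0, N]^n` with `N = 8 * M ^ 2`. Let `P` list the elements by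
descending `z`, and let `g` be the vector of marginals along `P` (`jump`). By submodularity `g(S) ≤
f S - f ∅` for every `S` (`sum_jump_le`), and summation by parts gives `⟨g, z⟩ ≥ N * (μ - f ∅)` if
all prefixes of `P` have value at least `μ` (`sum_jump_mul_ge`). Moreover `‖g‖₁ ≤ 4 * M`, hence
`‖g‖₂² ≤ 8 * M ^ 2 = N`. If `S` is a minimizer and no prefix attains the minimum, take `μ = f S +
1`: the step `z ↦ clip (z - g)` then lowers the squared distance from `N` times the indicator of `S`
by at least `2 * N - N = N` (`sqDist_step`). This distance starts at `n * N ^ 2` or less, so within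
`n * N + 1` steps some prefix is a minimizer.

An iteration must therefore cost only `O(M * EO * log n)`. Since `g` is integral, it has at most `4
* M` nonzero entries, and applying it in unit moves changes `P` at `O(M)` positions only: an element
changes its level by a swap with the first or last element of its level (`raise_runs`,
`lower_runs`). All changed positions, and all positions with a nonzero marginal, are marked.

The difficulty is to find the nonzero marginals of the new permutation. The unmarked elements had
marginal zero before, so by diminishing returns `f` is monotone along the sequence of the unmarked
elements alone (`RestMono.of_eq`), with total increase at most `2 * M`. On a stretch of unmarked
positions where this second sequence has constant values, the true marginals are at most zero; if
`f` also agrees on the two end prefixes of the stretch, they all vanish (`eq_of_advance`). Comparing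
end points thus certifies a whole stretch, and binary search (`advance_runs`) jumps from one stop to
the next. There are at most `6 * M` stops besides the marked positions (`card_stops_le`). The second
sequence is presented to the oracle as a linked list that bypasses the marked positions and ends
with their elements; this requires the marks in ascending order, which radix sort supplies
(`sort_runs`).

The first iteration has every position marked and costs `O(n * EO * log n)`. Saving a prefix costs
`O(n)`, but happens only when the integral best value drops, hence at most `2 * M + 1` times; this
is amortized with a potential in `improve_runs`. -/

namespace SFM

/-! ### Program logic -/

/-- `p` started in `s` halts in some configuration `s'` after some time `t` with `Q s' t`. -/
def Runs {n : ℕ} (f : Finset (Fin n) → ℤ) (EO : ℕ) (p : Prog) (s : State)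
    (Q : State → ℕ → Prop) : Prop :=
  ∃ s' t, Exec f EO p s s' t ∧ Q s' t

/-- Sequential composition of a list of programs. -/
def Prog.block : List Prog → Prog
  | [] => .skip
  | p :: ps => .seq p (Prog.block ps)

/-- The address of entry `i` of column `c`: the working memory consists of 16 interleaved
arrays ("columns") in the cells with negative addresses. -/
def addr (c : Fin 16) (i : ℤ) : ℤ := (c : ℕ) - 32 - 16 * i

/-- The residue modulo 16 determines the column. The offset `-32` makes all addresses with `i ≥ -1`
negative, so that the output cells stay apart; the entry `-1` is needed in column 3, where it holds
the head of the second list. -/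
theorem addr_inj {c c' : Fin 16} {i i' : ℤ} : addr c i = addr c' i' ↔ c = c' ∧ i = i' := by
  unfold addr
  constructor
  · intro h
    have := c.2
    have := c'.2
    have h1 : (c : ℕ) = c' := by omega
    exact ⟨Fin.ext h1, by omega⟩
  · rintro ⟨rfl, rfl⟩; rfl

/-- Column `c` of the working memory. -/
def State.get (s : State) (c : Fin 16) (i : ℤ) : ℤ := s.mem (addr c i)

/-- Write `v` to entry `i` of column `c`. -/
def State.put (s : State) (c : Fin 16) (i v : ℤ) : State := s.setMem (addr c i) v

/-- Twice an expression. -/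
def Exp.dbl (e : Exp) : Exp := .add e e

/-- The address of the entry `e` of column `c`. -/
def Exp.cell (c : Fin 16) (e : Exp) : Exp :=
  .sub (.lit ((c : ℕ) - 32)) e.dbl.dbl.dbl.dbl

/-- Read the entry `e` of column `c`. -/
def Exp.rd (c : Fin 16) (e : Exp) : Exp := .load (.cell c e)

/-- Write the value of `v` to the entry `e` of column `c`. -/
def Prog.wr (c : Fin 16) (e v : Exp) : Prog := .store (.cell c e) v

section Simp
variable (s : State)

@[simp] theorem val_lit (z : ℤ) : (Exp.lit z).val s = z := rfl
@[simp] theorem val_reg (i : ℕ) : (Exp.reg i).val s = s.reg i := rfl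
@[simp] theorem val_add (a b : Exp) : (Exp.add a b).val s = a.val s + b.val s := rfl
@[simp] theorem val_sub (a b : Exp) : (Exp.sub a b).val s = a.val s - b.val s := rfl
@[simp] theorem val_cell (c : Fin 16) (e : Exp) : (Exp.cell c e).val s = addr c (e.val s) := by
  simp [Exp.cell, Exp.dbl, addr]; ring
@[simp] theorem val_rd (c : Fin 16) (e : Exp) : (Exp.rd c e).val s = s.get c (e.val s) := by
  rw [Exp.rd, Exp.val, val_cell]; rfl

@[simp] theorem cost_lit (z : ℤ) : (Exp.lit z).cost = 1 := rfl
@[simp] theorem cost_reg (i : ℕ) : (Exp.reg i).cost = 1 := rfl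
@[simp] theorem cost_add (a b : Exp) : (Exp.add a b).cost = a.cost + b.cost + 1 := rfl
@[simp] theorem cost_sub (a b : Exp) : (Exp.sub a b).cost = a.cost + b.cost + 1 := rfl
@[simp] theorem cost_cell (c : Fin 16) (e : Exp) :
    (Exp.cell c e).cost = 16 * e.cost + 17 := by
  simp [Exp.cell, Exp.dbl]; ring
@[simp] theorem cost_rd (c : Fin 16) (e : Exp) : (Exp.rd c e).cost = 16 * e.cost + 18 := by
  rw [Exp.rd, Exp.cost, cost_cell]

@[simp] theorem reg_setReg (i : ℕ) (v : ℤ) (j : ℕ) :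
    (s.setReg i v).reg j = if j = i then v else s.reg j := by
  simp [State.setReg, Function.update_apply]
@[simp] theorem get_setReg (i : ℕ) (v : ℤ) : (s.setReg i v).get = s.get := rfl
@[simp] theorem reg_put (c : Fin 16) (i v : ℤ) : (s.put c i v).reg = s.reg := rfl
@[simp] theorem get_put (c : Fin 16) (i v : ℤ) (c' : Fin 16) :
    (s.put c i v).get c' = if c' = c then Function.update (s.get c) i v else s.get c' := by
  funext j
  split_ifs with h
  · subst h
    simp [State.get, State.put, State.setMem, Function.update_apply, addr_inj]
  · simp [State.get, State.put, State.setMem, addr_inj, h]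

end Simp

/-! ### Proof rules for programs, as equivalences by which `simp` executes straight-line code -/

section Rules
variable {n : ℕ} {f : Finset (Fin n) → ℤ} {EO : ℕ} {s : State} {Q : State → ℕ → Prop}

theorem Runs.mono {p : Prog} {Q' : State → ℕ → Prop} (h : Runs f EO p s Q)
    (hQ : ∀ s' t, Q s' t → Q' s' t) : Runs f EO p s Q' := by
  obtain ⟨s', t, he, hq⟩ := h
  exact ⟨s', t, he, hQ _ _ hq⟩

@[simp] theorem runs_skip : Runs f EO .skip s Q ↔ Q s 1 :=
  ⟨by rintro ⟨_, _, ⟨⟩, h⟩; exact h, fun h => ⟨_, _, .skip s, h⟩⟩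

@[simp] theorem runs_set {i : ℕ} {a : Exp} :
    Runs f EO (.set i a) s Q ↔ Q (s.setReg i (a.val s)) (a.cost + 1) :=
  ⟨by rintro ⟨_, _, ⟨⟩, h⟩; exact h, fun h => ⟨_, _, .set s i a, h⟩⟩

theorem runs_store {a b : Exp} :
    Runs f EO (.store a b) s Q ↔ Q (s.setMem (a.val s) (b.val s)) (a.cost + b.cost + 1) :=
  ⟨by rintro ⟨_, _, ⟨⟩, h⟩; exact h, fun h => ⟨_, _, .store s a b, h⟩⟩

@[simp] theorem runs_wr {c : Fin 16} {a b : Exp} :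
    Runs f EO (.wr c a b) s Q ↔
      Q (s.put c (a.val s) (b.val s)) (16 * a.cost + 17 + b.cost + 1) := by
  rw [Prog.wr, runs_store, val_cell, cost_cell]; rfl

@[simp] theorem runs_seq {p q : Prog} :
    Runs f EO (.seq p q) s Q ↔
      Runs f EO p s fun s' t => Runs f EO q s' fun s'' t' => Q s'' (t + t') := by
  constructor
  · rintro ⟨_, _, ⟨⟩, h⟩
    rename_i hp hq
    exact ⟨_, _, hp, _, _, hq, h⟩
  · rintro ⟨_, _, hp, _, _, hq, h⟩
    exact ⟨_, _, hp.seq hq, h⟩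

@[simp] theorem runs_block_nil : Runs f EO (.block []) s Q ↔ Q s 1 := runs_skip

@[simp] theorem runs_block_cons {p : Prog} {ps : List Prog} :
    Runs f EO (.block (p :: ps)) s Q ↔
      Runs f EO p s fun s' t => Runs f EO (.block ps) s' fun s'' t' => Q s'' (t + t') :=
  runs_seq

@[simp] theorem runs_ite {a b : Exp} {p q : Prog} :
    Runs f EO (.ite a b p q) s Q ↔
      if a.val s ≤ b.val s then Runs f EO p s fun s' t => Q s' (a.cost + b.cost + 1 + t)
      else Runs f EO q s fun s' t => Q s' (a.cost + b.cost + 1 + t) := by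
  split_ifs with h
  · constructor
    · rintro ⟨_, _, he, hQ⟩
      cases he with
      | ite_true _ _ hp => exact ⟨_, _, hp, hQ⟩
      | ite_false _ h' _ => exact absurd h h'
    · rintro ⟨_, _, hp, hQ⟩
      exact ⟨_, _, .ite_true _ h hp, hQ⟩
  · constructor
    · rintro ⟨_, _, he, hQ⟩
      cases he with
      | ite_true _ h' _ => exact absurd h' h
      | ite_false _ _ hp => exact ⟨_, _, hp, hQ⟩
    · rintro ⟨_, _, hp, hQ⟩
      exact ⟨_, _, .ite_false _ h hp, hQ⟩

theorem Runs.query {i : ℕ} {a k : Exp} {P : Equiv.Perm (Fin n)} {m : ℕ}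
    (hP : s.ListStores (a.val s) P) (hm : m ≤ n) (hk : k.val s = m)
    (h : Q (s.setReg i (f (permPrefix P m))) (a.cost + k.cost + EO)) :
    Runs f EO (.query i a k) s Q :=
  ⟨_, _, .query s i a k P m hP hm hk, h⟩

/-- Total correctness of loops with amortized time: `I τ s` says that `s` is a configuration at
the head of the loop with a time budget of `τ`. -/
theorem Runs.loop {a b : Exp} {p : Prog} (I : ℕ → State → Prop) {τ : ℕ} (h : I τ s)
    (step : ∀ τ s, I τ s → a.val s ≤ b.val s → Runs f EO p s fun s' t =>
      ∃ τ', a.cost + b.cost + 1 + t + τ' ≤ τ ∧ I τ' s') :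
    Runs f EO (.loop a b p) s fun s' t =>
      ∃ τ', t + τ' ≤ τ + (a.cost + b.cost + 1) ∧ I τ' s' ∧ ¬ a.val s' ≤ b.val s' := by
  induction τ using Nat.strong_induction_on generalizing s with
  | _ τ ih =>
    by_cases hg : a.val s ≤ b.val s
    · obtain ⟨s', t, he, τ', ht, hI⟩ := step τ s h hg
      -- Evaluating the guard alone costs time, so the budget strictly decreases and no separate
      -- termination measure is needed.
      obtain ⟨s'', t', he', τ'', ht', hI'⟩ := ih τ' (by omega) hI
      exact ⟨s'', _, .loop_true hg he he', τ'', by omega, hI'⟩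
    · exact ⟨s, _, .loop_false p hg, τ, by omega, h, hg⟩

/-- Loops that run exactly `k` times. -/
theorem Runs.for {a b : Exp} {p : Prog} (I : ℕ → State → Prop) (k c : ℕ) (h : I 0 s)
    (step : ∀ i s, i < k → I i s → a.val s ≤ b.val s ∧
      Runs f EO p s fun s' t => t + (a.cost + b.cost + 1) ≤ c ∧ I (i + 1) s')
    (done : ∀ s, I k s → ¬ a.val s ≤ b.val s) :
    Runs f EO (.loop a b p) s fun s' t => t ≤ k * c + (a.cost + b.cost + 1) ∧ I k s' := by
  refine (Runs.loop (fun τ s => ∃ i ≤ k, I i s ∧ τ = (k - i) * c) (τ := k * c)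
    ⟨0, Nat.zero_le _, h, rfl⟩ ?_).mono ?_
  · rintro τ s ⟨i, hi, hI, rfl⟩ hg
    obtain rfl | hlt := hi.eq_or_lt
    · exact absurd hg (done s hI)
    refine (step i s hlt hI).2.mono ?_
    rintro s' t ⟨ht, hI'⟩
    refine ⟨(k - (i + 1)) * c, ?_, i + 1, hlt, hI', rfl⟩
    obtain ⟨m, rfl⟩ : ∃ m, k = i + 1 + m := ⟨k - (i + 1), by omega⟩
    have e1 : i + 1 + m - (i + 1) = m := by omega
    have e2 : i + 1 + m - i = m + 1 := by omega
    rw [e1, e2, Nat.succ_mul]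
    omega
  · rintro s' t ⟨τ', ht, ⟨i, hi, hI, rfl⟩, hg⟩
    obtain rfl | hlt := hi.eq_or_lt
    · exact ⟨by omega, hI⟩
    · exact absurd (step i s' hlt hI).1 hg

end Rules

end SFM

namespace SFM

/-! ### Submodular functions along permutations -/

section Math
variable {n : ℕ} {f : Finset (Fin n) → ℤ}

/-- The marginal value of the element in position `p` of `P`. -/
def jump (f : Finset (Fin n) → ℤ) (P : Equiv.Perm (Fin n)) (p : ℕ) : ℤ :=
  f (permPrefix P (p + 1)) - f (permPrefix P p)

/-- The elements in positions before `p`, without those in positions of the list `xs`. -/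
def restPrefix (P : Equiv.Perm (Fin n)) (xs : List ℕ) (p : ℕ) : Finset (Fin n) :=
  (Finset.univ.filter fun q : Fin n => (q : ℕ) < p ∧ (q : ℕ) ∉ xs).image P

theorem mem_permPrefix {P : Equiv.Perm (Fin n)} {k : ℕ} {q : Fin n} :
    P q ∈ permPrefix P k ↔ (q : ℕ) < k := by
  simp [permPrefix]

theorem mem_restPrefix {P : Equiv.Perm (Fin n)} {xs : List ℕ} {k : ℕ} {q : Fin n} :
    P q ∈ restPrefix P xs k ↔ (q : ℕ) < k ∧ (q : ℕ) ∉ xs := by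
  simp [restPrefix]

theorem perm_ext {P : Equiv.Perm (Fin n)} {S T : Finset (Fin n)}
    (h : ∀ q, P q ∈ S ↔ P q ∈ T) : S = T := by
  ext e
  simpa using h (P.symm e)

theorem permPrefix_zero (P : Equiv.Perm (Fin n)) : permPrefix P 0 = ∅ := by
  simp [permPrefix]

theorem permPrefix_self (P : Equiv.Perm (Fin n)) : permPrefix P n = Finset.univ :=
  perm_ext (P := P) fun q => by simp [mem_permPrefix]

theorem permPrefix_succ (P : Equiv.Perm (Fin n)) (p : Fin n) :
    permPrefix P (p + 1) = insert (P p) (permPrefix P p) :=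
  perm_ext (P := P) fun q => by
    simp only [mem_permPrefix, Finset.mem_insert, EmbeddingLike.apply_eq_iff_eq, Fin.ext_iff]
    omega

theorem restPrefix_succ_of_mem (P : Equiv.Perm (Fin n)) {xs : List ℕ} {p : ℕ} (h : p ∈ xs) :
    restPrefix P xs (p + 1) = restPrefix P xs p :=
  perm_ext (P := P) fun q => by
    simp only [mem_restPrefix]
    constructor
    · rintro ⟨h1, h2⟩
      have : (q : ℕ) ≠ p := by rintro rfl; exact h2 h
      exact ⟨by omega, h2⟩
    · rintro ⟨h1, h2⟩
      exact ⟨by omega, h2⟩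

theorem restPrefix_succ (P : Equiv.Perm (Fin n)) {xs : List ℕ} {p : Fin n} (h : (p : ℕ) ∉ xs) :
    restPrefix P xs (p + 1) = insert (P p) (restPrefix P xs p) :=
  perm_ext (P := P) fun q => by
    simp only [mem_restPrefix, Finset.mem_insert, EmbeddingLike.apply_eq_iff_eq, Fin.ext_iff]
    constructor
    · rintro ⟨h1, h2⟩
      rcases Nat.lt_succ_iff_lt_or_eq.1 h1 with h3 | h3
      · exact .inr ⟨h3, h2⟩
      · exact .inl h3
    · rintro (h3 | ⟨h3, h2⟩)
      · exact ⟨by omega, by rwa [h3]⟩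
      · exact ⟨by omega, h2⟩

theorem restPrefix_subset (P : Equiv.Perm (Fin n)) (xs : List ℕ) (p : ℕ) :
    restPrefix P xs p ⊆ permPrefix P p := by
  intro e
  obtain ⟨q, rfl⟩ := P.surjective e
  simp only [mem_restPrefix, mem_permPrefix]
  exact fun h => h.1

/-- Diminishing returns: dropping elements from the prefix can only increase the marginal value of
the next element. -/
theorem jump_le_rest (hf : IsSubmodular f) (P : Equiv.Perm (Fin n)) {xs : List ℕ} {p : ℕ}
    (hp : p < n) (h : p ∉ xs) :
    jump f P p ≤ f (restPrefix P xs (p + 1)) - f (restPrefix P xs p) := by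
  have h1 := restPrefix_succ P (p := ⟨p, hp⟩) h
  have h2 := permPrefix_succ P ⟨p, hp⟩
  simp only at h1 h2
  rw [jump, h1, h2]
  refine hf _ _ _ (restPrefix_subset P xs p) ?_
  simp [mem_permPrefix]

/-- The greedy vector lies in the base polytope: if the elements of `S` are added in the order of
`P`, each contributes at least its marginal with respect to the full prefix, and the contributions
telescope. -/
theorem sum_jump_le (hf : IsSubmodular f) (P : Equiv.Perm (Fin n)) (S : Finset (Fin n)) :
    ∑ q : Fin n, (if P q ∈ S then jump f P q else 0) ≤ f S - f ∅ := by
  have key : ∀ k, k ≤ n → ∑ q ∈ Finset.range k,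
      (if h : q < n then (if P ⟨q, h⟩ ∈ S then jump f P q else 0) else 0)
        ≤ f (S ∩ permPrefix P k) - f ∅ := by
    intro k
    induction k with
    | zero => simp [permPrefix_zero]
    | succ k ih =>
      intro hk
      have hk' : k < n := hk
      have := ih (by omega)
      rw [Finset.sum_range_succ, dif_pos hk']
      have h2 := permPrefix_succ P ⟨k, hk'⟩
      simp only at h2
      split_ifs with hS
      · have h3 : S ∩ permPrefix P (k + 1) = insert (P ⟨k, hk'⟩) (S ∩ permPrefix P k) := by
          rw [h2, Finset.inter_insert_of_mem hS]
        have h4 := hf (S ∩ permPrefix P k) (permPrefix P k) (P ⟨k, hk'⟩)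
          Finset.inter_subset_right (by simp [mem_permPrefix])
        rw [h3, jump, h2]
        linarith
      · have h3 : S ∩ permPrefix P (k + 1) = S ∩ permPrefix P k := by
          rw [h2, Finset.inter_insert_of_notMem hS]
        rw [h3]; linarith
  have := key n le_rfl
  rw [permPrefix_self, Finset.inter_univ, Finset.sum_range] at this
  simpa using this

theorem sum_jump (f : Finset (Fin n) → ℤ) (P : Equiv.Perm (Fin n)) :
    ∑ q : Fin n, jump f P q = f Finset.univ - f ∅ := by
  have : ∑ q : Fin n, jump f P q = ∑ q ∈ Finset.range n, jump f P q :=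
    (Finset.sum_range _).symm
  rw [this]
  unfold jump
  rw [Finset.sum_range_sub (fun k => f (permPrefix P k)), permPrefix_self, permPrefix_zero]

/-- With `S` the set of elements of nonnegative marginal, the sum is `2 * g(S) - g([n])`, which is
at most `2 * f S - f ∅ - f [n]`. -/
theorem sum_abs_jump_le (hf : IsSubmodular f) {M : ℤ} (hM : ∀ S, |f S| ≤ M)
    (P : Equiv.Perm (Fin n)) : ∑ q : Fin n, |jump f P q| ≤ 4 * M := by
  set S : Finset (Fin n) := (Finset.univ.filter fun q : Fin n => 0 ≤ jump f P q).image P with hS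
  have h1 := sum_jump_le hf P S
  have h2 := sum_jump f P
  have h3 : ∑ q : Fin n, |jump f P q| =
      2 * ∑ q : Fin n, (if P q ∈ S then jump f P q else 0) - ∑ q : Fin n, jump f P q := by
    rw [Finset.mul_sum, ← Finset.sum_sub_distrib]
    refine Finset.sum_congr rfl fun q _ => ?_
    have : P q ∈ S ↔ 0 ≤ jump f P q := by simp [hS]
    simp only [this]
    split_ifs with h
    · rw [abs_of_nonneg h]; ring
    · rw [abs_of_neg (by omega)]; ring
  have a1 := abs_le.1 (hM S)
  have a2 := abs_le.1 (hM ∅)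
  have a3 := abs_le.1 (hM Finset.univ)
  linarith [a1.1, a1.2, a2.1, a2.2, a3.1, a3.2]

theorem abs_jump_le {M : ℤ} (hM : ∀ S, |f S| ≤ M) (P : Equiv.Perm (Fin n)) (q : ℕ) :
    |jump f P q| ≤ 2 * M := by
  have a1 := abs_le.1 (hM (permPrefix P (q + 1)))
  have a2 := abs_le.1 (hM (permPrefix P q))
  rw [jump, abs_le]
  constructor <;> linarith [a1.1, a1.2, a2.1, a2.2]

theorem sum_jump_sq_le (hf : IsSubmodular f) {M : ℤ} (hM : ∀ S, |f S| ≤ M)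
    (P : Equiv.Perm (Fin n)) : ∑ q : Fin n, jump f P q ^ 2 ≤ 8 * M ^ 2 := by
  have hM0 : 0 ≤ M := (abs_nonneg _).trans (hM ∅)
  calc ∑ q : Fin n, jump f P q ^ 2 ≤ ∑ q : Fin n, 2 * M * |jump f P q| := by
        refine Finset.sum_le_sum fun q _ => ?_
        rw [← sq_abs, sq]
        exact mul_le_mul_of_nonneg_right (abs_jump_le hM P q) (abs_nonneg _)
    _ = 2 * M * ∑ q : Fin n, |jump f P q| := by rw [Finset.mul_sum]
    _ ≤ 2 * M * (4 * M) := mul_le_mul_of_nonneg_left (sum_abs_jump_le hf hM P) (by linarith)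
    _ = 8 * M ^ 2 := by ring

/-- Summation by parts. -/
theorem sum_sub_mul_ge {F y : ℕ → ℤ} {N : ℤ} (hF : ∀ k, 0 ≤ F k) (hy : Antitone y)
    (hN : y 0 ≤ N) (hy0 : ∀ k, 0 ≤ y k) (m : ℕ) :
    -(F 0 * N) ≤ ∑ k ∈ Finset.range m, (F (k + 1) - F k) * y k := by
  have key : F m * y m - F 0 * y 0 ≤ ∑ k ∈ Finset.range m, (F (k + 1) - F k) * y k := by
    induction m with
    | zero => simp
    | succ m ih =>
      rw [Finset.sum_range_succ]
      have := mul_le_mul_of_nonneg_left (hy (Nat.le_succ m)) (hF (m + 1))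
      simp only [Nat.succ_eq_add_one] at this
      linarith
  have h1 := mul_nonneg (hF m) (hy0 m)
  have h2 := mul_le_mul_of_nonneg_left hN (hF 0)
  linarith

/-- The left factor of each term is a difference of prefix values. Replacing `f` by `f - μ` leaves
these differences unchanged and makes the prefix values nonnegative, so summation by parts against
the descending sequence `z ∘ P` loses only the boundary term at the empty prefix. -/
theorem sum_jump_mul_ge {P : Equiv.Perm (Fin n)} {z : Fin n → ℤ} {N μ : ℤ}
    (hz : ∀ p q : Fin n, p ≤ q → z (P q) ≤ z (P p)) (hz0 : ∀ e, 0 ≤ z e) (hzN : ∀ e, z e ≤ N)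
    (hN : 0 ≤ N) (hμ : ∀ k ≤ n, μ ≤ f (permPrefix P k)) :
    N * (μ - f ∅) ≤ ∑ q : Fin n, jump f P q * z (P q) := by
  have hμ' : ∀ k, μ ≤ f (permPrefix P k) := by
    intro k
    rcases le_total k n with h | h
    · exact hμ k h
    · have : permPrefix P k = permPrefix P n :=
        perm_ext (P := P) fun q => by simp only [mem_permPrefix]; omega
      rw [this]; exact hμ n le_rfl
  -- Padding with zeros beyond `n` keeps the sequence antitone, as the levels are nonnegative.
  let y : ℕ → ℤ := fun k => if h : k < n then z (P ⟨k, h⟩) else 0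
  have h := sum_sub_mul_ge (F := fun k => f (permPrefix P k) - μ) (y := y) (N := N)
    (fun k => sub_nonneg.2 (hμ' k)) ?_ ?_ ?_ n
  · rw [Finset.sum_range] at h
    simp only [permPrefix_zero] at h
    calc N * (μ - f ∅) = -((f ∅ - μ) * N) := by ring
      _ ≤ _ := h
      _ = _ := Finset.sum_congr rfl fun q _ => by simp [y, jump]
  · intro a b hab
    simp only [y]
    split_ifs with h1 h2 h2
    · exact hz _ _ hab
    · omega
    · exact hz0 _
    · exact le_rfl
  · simp only [y]; split_ifs
    · exact hzN _
    · exact hN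
  · intro k
    simp only [y]; split_ifs
    · exact hz0 _
    · exact le_rfl

/-! ### Convergence of the projected subgradient method -/

/-- The projection of `x` to the interval `[0, N]`. -/
def clip (N x : ℤ) : ℤ := max 0 (min N x)

theorem clip_sub_sq_le {N x w : ℤ} (h0 : 0 ≤ w) (hN : w ≤ N) :
    (clip N x - w) ^ 2 ≤ (x - w) ^ 2 := by
  unfold clip
  rw [sq_le_sq]
  rcases le_total N x with h | h
  · rw [min_eq_left h, max_eq_right (by omega), abs_of_nonneg (by omega), abs_of_nonneg (by omega)]
    omega
  · rw [min_eq_right h]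
    rcases le_total 0 x with h' | h'
    · rw [max_eq_right h']
    · rw [max_eq_left h', abs_of_nonpos (by omega), abs_of_nonpos (by omega)]
      omega

/-- The squared distance of `z` from `N` times the characteristic vector of `S`. -/
def sqDist (N : ℤ) (S : Finset (Fin n)) (z : Fin n → ℤ) : ℤ :=
  ∑ e, (z e - if e ∈ S then N else 0) ^ 2

/-- One step of the projected subgradient method brings `z` closer to the minimizer, as long as
no prefix of the permutation is a minimizer. -/
theorem sqDist_step (hf : IsSubmodular f) {M : ℤ} (hM : ∀ S, |f S| ≤ M)
    {P : Equiv.Perm (Fin n)} {z : Fin n → ℤ} {N : ℤ} (hNM : N = 8 * M ^ 2)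
    (hz : ∀ p q : Fin n, p ≤ q → z (P q) ≤ z (P p)) (hz0 : ∀ e, 0 ≤ z e) (hzN : ∀ e, z e ≤ N)
    (S : Finset (Fin n)) (hμ : ∀ k ≤ n, f S + 1 ≤ f (permPrefix P k)) :
    sqDist N S (fun e => clip N (z e - jump f P (P.symm e))) ≤ sqDist N S z - N := by
  have hN : 0 ≤ N := by rw [hNM]; positivity
  have h1 : sqDist N S (fun e => clip N (z e - jump f P (P.symm e))) ≤
      ∑ q : Fin n, (z (P q) - jump f P q - if P q ∈ S then N else 0) ^ 2 := by
    unfold sqDist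
    rw [← Equiv.sum_comp P]
    refine Finset.sum_le_sum fun q _ => ?_
    simp only [Equiv.symm_apply_apply]
    apply clip_sub_sq_le <;> split_ifs <;> omega
  have h2 : ∑ q : Fin n, (z (P q) - jump f P q - if P q ∈ S then N else 0) ^ 2 =
      sqDist N S z - 2 * (∑ q : Fin n, jump f P q * z (P q))
        + 2 * N * (∑ q : Fin n, (if P q ∈ S then jump f P q else 0))
        + ∑ q : Fin n, jump f P q ^ 2 := by
    have hD : sqDist N S z = ∑ q : Fin n, (z (P q) - if P q ∈ S then N else 0) ^ 2 :=
      (Equiv.sum_comp P fun e => (z e - if e ∈ S then N else 0) ^ 2).symm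
    rw [hD, Finset.mul_sum, Finset.mul_sum, ← Finset.sum_sub_distrib,
      ← Finset.sum_add_distrib, ← Finset.sum_add_distrib]
    refine Finset.sum_congr rfl fun q _ => ?_
    split_ifs <;> ring
  -- Here `μ = f S + 1`. Together with `h4` the linear terms contribute at most `-2 * N`, and by
  -- `h5` the quadratic term at most `8 * M ^ 2 = N`; this balance is the reason for the choice of
  -- `N`.
  have h3 := sum_jump_mul_ge (f := f) hz hz0 hzN hN hμ
  have h4 := mul_le_mul_of_nonneg_left (sum_jump_le hf P S) hN
  have h5 := sum_jump_sq_le hf hM P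
  nlinarith

theorem sqDist_zero_le {N : ℤ} (S : Finset (Fin n)) :
    sqDist N S (fun _ => 0) ≤ n * N ^ 2 := by
  unfold sqDist
  calc ∑ e : Fin n, ((0 : ℤ) - if e ∈ S then N else 0) ^ 2 ≤ ∑ _e : Fin n, N ^ 2 := by
        refine Finset.sum_le_sum fun e _ => ?_
        split_ifs
        · simp
        · simpa using sq_nonneg N
    _ = n * N ^ 2 := by simp

theorem sqDist_nonneg (N : ℤ) (S : Finset (Fin n)) (z : Fin n → ℤ) : 0 ≤ sqDist N S z :=
  Finset.sum_nonneg fun _ _ => sq_nonneg _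

/-! ### How many positions can obstruct the search -/

theorem card_filter_ne_zero_le {ι : Type*} (s : Finset ι) (g : ι → ℤ) :
    ((s.filter fun i => g i ≠ 0).card : ℤ) ≤ ∑ i ∈ s, |g i| := by
  rw [Finset.card_filter]
  push_cast
  refine Finset.sum_le_sum fun i _ => ?_
  split_ifs with h
  · exact Int.one_le_abs h
  · exact abs_nonneg _

/-- Along the elements outside the positions `xs`, `f` does not decrease. -/
def RestMono (f : Finset (Fin n) → ℤ) (P : Equiv.Perm (Fin n)) (xs : List ℕ) : Prop :=
  ∀ p < n, f (restPrefix P xs p) ≤ f (restPrefix P xs (p + 1))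

/-- Off `xs` the two permutations agree, so they have the same reduced prefixes. The old marginal of
an unmarked element is zero, and passing to the reduced prefix cannot make it smaller. This is how
knowledge about the old permutation is carried over to the new one. -/
theorem RestMono.of_eq (hf : IsSubmodular f) {P P' : Equiv.Perm (Fin n)} {xs : List ℕ}
    (h : ∀ p : Fin n, (p : ℕ) ∉ xs → P' p = P p ∧ jump f P p = 0) : RestMono f P' xs := by
  have hr : ∀ k, restPrefix P' xs k = restPrefix P xs k := by
    intro k
    unfold restPrefix
    refine Finset.image_congr fun q hq => ?_
    simp only [Finset.coe_filter, Finset.mem_univ, true_and, Set.mem_ofPred_eq] at hq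
    exact (h q hq.2).1
  intro p hp
  by_cases hx : p ∈ xs
  · rw [restPrefix_succ_of_mem _ hx]
  · rw [hr, hr]
    have h1 := jump_le_rest hf P hp hx
    have h2 := (h ⟨p, hp⟩ hx).2
    simp only at h2
    omega

/-- The positions at which the sweep has to stop. -/
def stops (f : Finset (Fin n) → ℤ) (P : Equiv.Perm (Fin n)) (xs : List ℕ) (a : ℕ) : Finset ℕ :=
  (Finset.range n).filter fun p => a ≤ p ∧ (p ∈ xs ∨ jump f P p ≠ 0 ∨
    f (restPrefix P xs (p + 1)) - f (restPrefix P xs p) ≠ 0)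

/-- By integrality every nonzero difference counts at least 1 towards the total variation. Along `P`
this is at most `4 * M`; along the unmarked elements the differences are nonnegative and telescope
to at most `2 * M`. -/
theorem card_stops_le (hf : IsSubmodular f) {M : ℕ} (hM : ∀ S, |f S| ≤ (M : ℤ))
    {P : Equiv.Perm (Fin n)} {xs : List ℕ} (h : RestMono f P xs) (a : ℕ) :
    (stops f P xs a).card ≤ xs.length + 6 * M := by
  set A := (Finset.range n).filter fun p => jump f P p ≠ 0 with hA
  set B := (Finset.range n).filter fun p =>
    f (restPrefix P xs (p + 1)) - f (restPrefix P xs p) ≠ 0 with hB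
  have hsub : stops f P xs a ⊆ xs.toFinset ∪ (A ∪ B) := by
    intro p hp
    simp only [stops, Finset.mem_filter] at hp
    simp only [hA, hB, Finset.mem_union, List.mem_toFinset, Finset.mem_filter]
    tauto
  have h1 := Finset.card_le_card hsub
  have h2 := Finset.card_union_le xs.toFinset (A ∪ B)
  have h3 := Finset.card_union_le A B
  have h4 := List.toFinset_card_le xs
  have hA' : (A.card : ℤ) ≤ 4 * M := by
    refine (card_filter_ne_zero_le _ _).trans ?_
    rw [Finset.sum_range]
    exact sum_abs_jump_le hf hM P
  have hB' : (B.card : ℤ) ≤ 2 * M := by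
    refine (card_filter_ne_zero_le _ _).trans ?_
    have : ∑ i ∈ Finset.range n, |f (restPrefix P xs (i + 1)) - f (restPrefix P xs i)| =
        ∑ i ∈ Finset.range n, (f (restPrefix P xs (i + 1)) - f (restPrefix P xs i)) :=
      Finset.sum_congr rfl fun i hi => abs_of_nonneg (by
        have := h i (Finset.mem_range.1 hi); omega)
    rw [this, Finset.sum_range_sub (fun k => f (restPrefix P xs k))]
    have a1 := abs_le.1 (hM (restPrefix P xs n))
    have a2 := abs_le.1 (hM (restPrefix P xs 0))
    omega
  omega

end Math
end SFM

namespace SFM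

/-! ### Arrays in the working memory -/

/-- `s'` differs from `s` at most in the columns `C` and the registers `R`. -/
structure Frame (C : List (Fin 16)) (R : List ℕ) (s s' : State) : Prop where
  col : ∀ c, c ∉ C → s'.get c = s.get c
  reg : ∀ r, r ∉ R → s'.reg r = s.reg r

theorem Frame.refl (C : List (Fin 16)) (R : List ℕ) (s : State) : Frame C R s s :=
  ⟨fun _ _ => rfl, fun _ _ => rfl⟩

theorem Frame.trans {C C' : List (Fin 16)} {R R' : List ℕ} {s s' s'' : State}
    (h : Frame C R s s') (h' : Frame C' R' s' s'') (hC : C' ⊆ C := by simp)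
    (hR : R' ⊆ R := by simp) : Frame C R s s'' :=
  ⟨fun c hc => (h'.col c fun hm => hc (hC hm)).trans (h.col c hc),
    fun r hr => (h'.reg r fun hm => hr (hR hm)).trans (h.reg r hr)⟩

theorem Frame.mono {C C' : List (Fin 16)} {R R' : List ℕ} {s s' : State}
    (h : Frame C R s s') (hC : C ⊆ C' := by simp) (hR : R ⊆ R' := by simp) : Frame C' R' s s' :=
  (Frame.refl C' R' s).trans h hC hR

theorem Frame.setReg {C : List (Fin 16)} {R : List ℕ} {s s' : State} (h : Frame C R s s') {r : ℕ}
    {v : ℤ} (hr : r ∈ R := by simp) : Frame C R s (s'.setReg r v) :=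
  h.trans (C' := []) (R' := [r]) ⟨by simp, by simp +contextual⟩ (by simp) (by simpa using hr)

theorem Frame.put {C : List (Fin 16)} {R : List ℕ} {s s' : State} (h : Frame C R s s')
    {c : Fin 16} {i v : ℤ} (hc : c ∈ C := by simp) : Frame C R s (s'.put c i v) :=
  h.trans (C' := [c]) (R' := []) ⟨by simp +contextual, by simp⟩ (by simpa using hc) (by simp)

/-- The array `g` starts with the values of `v` on the list `l`. -/
def Holds {α : Type*} (v : α → ℤ) (g : ℤ → ℤ) (l : List α) : Prop :=
  ∀ (i : ℕ) (h : i < l.length), g i = v l[i]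

section Holds
variable {α : Type*} {v : α → ℤ} {g : ℤ → ℤ} {l : List α}

theorem Holds.append (h : Holds v g l) (x : α) {i w : ℤ} (hi : i = l.length) (hw : w = v x) :
    Holds v (Function.update g i w) (l ++ [x]) := by
  subst hi hw
  intro i hi
  simp only [List.length_append, List.length_singleton] at hi
  rcases Nat.lt_succ_iff_lt_or_eq.1 hi with h1 | rfl
  · rw [Function.update_of_ne (by exact_mod_cast h1.ne), h i h1, List.getElem_append_left h1]
  · simp

theorem Holds.update (h : Holds v g l) {i w : ℤ} (hi : l.length ≤ i) :
    Holds v (Function.update g i w) l := fun j hj => by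
  rw [Function.update_of_ne (by omega), h j hj]

end Holds

/-- The array `g` holds the permutation `P`. -/
def HoldsPerm {n : ℕ} (g : ℤ → ℤ) (P : Equiv.Perm (Fin n)) : Prop :=
  ∀ p : Fin n, g (p : ℕ) = (P p : ℕ)

/-! ### The list of the unmarked positions -/

/-- The first natural number from `p` on that is not in `xs`. -/
noncomputable def nextFree (xs : List ℕ) (p : ℕ) : ℕ := Nat.nth (· ∉ xs) (Nat.count (· ∉ xs) p)

theorem nextFree_of_notMem {xs : List ℕ} {p : ℕ} (h : p ∉ xs) : nextFree xs p = p :=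
  Nat.nth_count h

theorem nextFree_of_mem {xs : List ℕ} {p : ℕ} (h : p ∈ xs) :
    nextFree xs p = nextFree xs (p + 1) := by
  rw [nextFree, nextFree, Nat.count_succ, if_neg (not_not.2 h), add_zero]

/-- Bridges the marked positions in the second list, and appends their entries to it. -/
def linkRest : Prog := .block [
  .set 8 (.reg 5),
  .loop (.lit 1) (.reg 8) (.block [
    .set 8 (.sub (.reg 8) (.lit 1)),
    .set 9 (.rd 8 (.reg 8)),
    .wr 3 (.sub (.reg 9) (.lit 1)) (.rd 3 (.reg 9)),
    .wr 2 (.add (.reg 0) (.reg 8)) (.rd 0 (.reg 9))])]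

section Link
variable {n : ℕ} {f : Finset (Fin n) → ℤ} {EO : ℕ}

/-- The marked positions are treated from right to left: the pointer to a marked node is replaced by
the outgoing pointer of that node, which already leads to the next unmarked one. The range up to `2
* n` covers the at most `n` appended nodes. -/
theorem linkRest_runs {s : State} {xs : List ℕ} (hn : s.reg 0 = n) (hk : s.reg 5 = xs.length)
    (hX : Holds Nat.cast (s.get 8) xs) (hs : xs.Pairwise (· < ·)) (hx : ∀ x ∈ xs, x < n)
    (hB : ∀ q : ℕ, q ≤ 2 * n → s.get 3 ((q : ℤ) - 1) = addr 2 q) :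
    Runs f EO linkRest s fun s' t => t ≤ 300 * (xs.length + 1) ∧ Frame [2, 3] [8, 9] s s' ∧
      (∀ q : ℕ, q ≤ 2 * n → s'.get 3 ((q : ℤ) - 1) = addr 2 (nextFree xs q)) ∧
      (∀ p : ℕ, p < n → s'.get 2 p = s.get 2 p) ∧
      (∀ (i : ℕ) (h : i < xs.length), s'.get 2 ((n : ℤ) + i) = s.get 0 xs[i]) := by
  simp only [linkRest, runs_block_cons, runs_block_nil, runs_set]
  refine (Runs.for (fun j s' => s'.reg 8 = (xs.length : ℤ) - j ∧ Frame [2, 3] [8, 9] s s' ∧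
      (∀ q : ℕ, q ≤ 2 * n → s'.get 3 ((q : ℤ) - 1) =
        if q ∈ xs.take (xs.length - j) then addr 2 q else addr 2 (nextFree xs q)) ∧
      (∀ p : ℕ, p < n → s'.get 2 p = s.get 2 p) ∧
      (∀ (i : ℕ) (h : i < xs.length), xs.length - j ≤ i →
        s'.get 2 ((n : ℤ) + i) = s.get 0 xs[i])) xs.length 250 ?_ ?_ ?_).mono ?_
  · refine ⟨by simp [hk], (Frame.refl _ _ _).setReg, ?_, by simp, ?_⟩
    · intro q hq
      simp only [get_setReg, hB q hq, tsub_zero, List.take_length]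
      split_ifs with h
      · rfl
      · rw [nextFree_of_notMem h]
    · intro i h h'; omega
  · rintro j s' hj ⟨h8, hF, h3, h2, h2'⟩
    obtain ⟨m, hm⟩ : ∃ m, xs.length = m + 1 + j := ⟨xs.length - 1 - j, by omega⟩
    have hm1 : xs.length - j = m + 1 := by omega
    have hm2 : xs.length - (j + 1) = m := by omega
    have hml : m < xs.length := by omega
    rw [hm1] at h3 h2'
    rw [hm2]
    have h8' : s'.reg 8 - 1 = m := by rw [h8, hm]; push_cast; ring
    have hxm : s'.get 8 m = (xs[m] : ℕ) := by rw [hF.col 8 (by simp)]; exact hX m hml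
    have h0 : s'.reg 0 = n := (hF.reg 0 (by simp)).trans hn
    have hc0 : s'.get 0 = s.get 0 := hF.col 0 (by simp)
    have hlt : xs[m] < n := hx _ (List.getElem_mem hml)
    have ht : xs.take (m + 1) = xs.take m ++ [xs[m]] := by simp
    have htlt : ∀ y ∈ xs.take m, y < xs[m] := by
      intro y hy
      obtain ⟨i, hi, rfl⟩ := List.mem_iff_getElem.1 hy
      simp only [List.length_take] at hi
      rw [List.getElem_take]
      exact List.pairwise_iff_getElem.1 hs i m (by omega) hml (by omega)
    refine ⟨by simp; omega, ?_⟩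
    simp only [runs_block_cons, runs_block_nil, runs_set, runs_wr]
    refine ⟨by simp, ?_, ?_, ?_, ?_, ?_⟩
    · simp; omega
    · exact hF.setReg.setReg.put.put
    · intro q hq
      simp [h8', hxm, Function.update_apply]
      have hq1 := h3 q hq
      have hq2 := h3 (xs[m] + 1) (by omega)
      rw [ht] at hq1 hq2
      simp only [List.mem_append, List.mem_singleton] at hq1 hq2
      by_cases hqm : q = xs[m]
      · subst hqm
        rw [if_pos rfl, if_neg fun h => (htlt _ h).false]
        -- The marks still untreated are smaller than `xs[m]`, so the pointer to `xs[m] + 1` is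
        -- final.
        have : ¬ (xs[m] + 1 ∈ xs.take m ∨ xs[m] + 1 = xs[m]) := by
          rintro (h | h)
          · have := htlt _ h; omega
          · omega
        rw [if_neg this] at hq2
        rw [nextFree_of_mem (List.getElem_mem hml), ← hq2]
        push_cast; congr 1; ring
      · rw [if_neg (by omega), hq1]
        simp [hqm]
    · intro p hp
      simp [h8', h0, hc0, Function.update_apply, h2 p hp]
      omega
    · intro i hi hmi
      by_cases him : i = m
      · subst him
        simp [hc0, h0, h8', hxm]
      · simp [h0, h8', him, h2' i hi (by omega)]
  · rintro s' ⟨h8, -⟩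
    simp [h8]
  · rintro s' t ⟨ht, h8, hF, h3, h2, h2'⟩
    refine ⟨?_, hF, ?_, h2, fun i h => h2' i h (by omega)⟩
    · simp at ht ⊢; omega
    · intro q hq
      rw [h3 q hq]; simp

theorem addr_add_one_zero (i : ℤ) : addr 0 i + 1 = addr 1 i := by simp [addr]; ring

theorem addr_add_one_two (i : ℤ) : addr 2 i + 1 = addr 3 i := by simp [addr]; ring

/-- The first list holds the permutation `P`. -/
theorem listStores_array {s : State} {P : Equiv.Perm (Fin n)} (hP : HoldsPerm (s.get 0) P)
    (hN : ∀ p : ℕ, p < n → s.get 1 p = addr 0 (p + 1)) : s.ListStores (addr 0 0) P := by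
  have hnode : ∀ j : ℕ, j ≤ n → s.node (addr 0 0) j = addr 0 j := by
    intro j
    induction j with
    | zero => intro _; rfl
    | succ j ih =>
      intro hj
      rw [State.node, ih (by omega), addr_add_one_zero]
      simpa [State.get] using hN j (by omega)
  intro j
  rw [hnode j j.2.le]
  exact hP j

theorem count_free {xs : List ℕ} (hs : xs.Nodup) (hx : ∀ x ∈ xs, x < n) (k : ℕ) :
    Nat.count (· ∉ xs) (n + k) = n - xs.length + k := by
  rw [Nat.count_add]
  congr 1
  · have h1 : Nat.count (· ∈ xs) n = xs.length := by
      rw [Nat.count_eq_card_filter_range, ← List.toFinset_card_of_nodup hs]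
      congr 1
      ext x
      simp only [Finset.mem_filter, Finset.mem_range, List.mem_toFinset]
      exact ⟨fun h => h.2, fun h => ⟨hx x h, h⟩⟩
    have h2 := Finset.card_filter_add_card_filter_not (s := Finset.range n) (fun x => x ∈ xs)
    rw [Nat.count_eq_card_filter_range] at h1 ⊢
    rw [Finset.card_range] at h2
    omega
  · rw [Nat.count_iff_forall.2]
    intro j hj h
    have := hx _ h
    omega

/-- The second list holds a permutation whose prefixes are the sets `restPrefix P xs p`. -/
theorem listStores_rest {s : State} {P : Equiv.Perm (Fin n)} {xs : List ℕ} (hs : xs.Nodup)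
    (hx : ∀ x ∈ xs, x < n) (hP : HoldsPerm (s.get 2) P)
    (hC : ∀ (i : ℕ) (h : i < xs.length), s.get 2 (n + i) = (P ⟨xs[i], hx _ (List.getElem_mem h)⟩ : ℕ))
    (hN : ∀ q : ℕ, q ≤ 2 * n → s.get 3 ((q : ℤ) - 1) = addr 2 (nextFree xs q)) :
    ∃ Q : Equiv.Perm (Fin n), s.ListStores (s.get 3 (-1)) Q ∧
      ∀ p ≤ n, permPrefix Q (Nat.count (· ∉ xs) p) = restPrefix P xs p := by
  set ν : ℕ → ℕ := Nat.nth (· ∉ xs) with hν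
  have hinf : {x | x ∉ xs}.Infinite := by
    refine Set.infinite_of_not_bddAbove ?_
    rintro ⟨b, hb⟩
    have := hb (show n + b + 1 ∈ {x | x ∉ xs} from fun h => by have := hx _ h; omega)
    omega
  have hlen : xs.length ≤ n := by
    have h1 : xs.toFinset ⊆ Finset.range n := fun x h => by
      simpa using hx x (List.mem_toFinset.1 h)
    have := Finset.card_le_card h1
    rwa [List.toFinset_card_of_nodup hs, Finset.card_range] at this
  have hlt : ∀ j < n, ν j < n + xs.length := by
    intro j hj
    -- Below `n + xs.length` there are exactly `n` unmarked numbers, so the first `n` nodes of the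
    -- second list end there.
    refine Nat.nth_lt_of_lt_count ?_
    rw [count_free hs hx]; omega
  have hnode : ∀ j < n, s.node (s.get 3 (-1)) j = addr 2 (ν j) := by
    intro j
    induction j with
    | zero =>
      intro _
      have := hN 0 (by omega)
      simpa [State.node, nextFree, hν] using this
    | succ j ih =>
      intro hj
      have h1 := hN (ν j + 1) (by have := hlt j (by omega); omega)
      rw [State.node, ih (by omega), addr_add_one_two]
      rw [nextFree, Nat.count_nth_succ_of_infinite hinf] at h1
      simpa [State.get] using h1
  have hfree : ∀ j, ν j ∉ xs := fun j => Nat.nth_mem_of_infinite hinf j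
  have hidx : ∀ j : Fin n, ¬ ν j < n → ν j - n < xs.length := fun j _ => by
    have := hlt j j.2
    omega
  -- The `j`-th unmarked number is either a position of `P` or an appended cell `n + i`, which
  -- stands for the marked position `xs[i]`. The two kinds cannot collide because `ν j` is never
  -- marked.
  let W : Fin n → Fin n := fun j => if h : ν j < n then ⟨ν j, h⟩ else
    ⟨xs[ν j - n]'(hidx j h), hx _ (List.getElem_mem _)⟩
  have hW : Function.Injective W := by
    intro j j' hjj
    have hval := congrArg Fin.val hjj
    simp only [W] at hval
    have hνν : ν j = ν j' := by
      split_ifs at hval with h1 h2 h2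
      · exact hval
      · replace hval : ν j = xs[ν j' - n]'(hidx j' h2) := hval
        exact absurd (hval ▸ List.getElem_mem _) (hfree j)
      · replace hval : xs[ν j - n]'(hidx j h1) = ν j' := hval
        exact absurd (hval ▸ List.getElem_mem _) (hfree j')
      · have := (List.Nodup.getElem_inj_iff hs).1 hval
        omega
    exact Fin.ext (Nat.nth_injective hinf hνν)
  refine ⟨(Equiv.ofBijective W (Finite.injective_iff_bijective.1 hW)).trans P, ?_, ?_⟩
  · intro j
    rw [hnode j j.2]
    change s.get 2 (ν j) = _
    simp only [Equiv.trans_apply, Equiv.ofBijective_apply, W]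
    split_ifs with h
    · exact hP ⟨ν j, h⟩
    · rw [← hC _ (hidx j h)]
      congr 1
      omega
  · intro p hp
    refine perm_ext (P := P) fun q => ?_
    rw [mem_restPrefix]
    simp only [permPrefix, Finset.mem_image, Finset.mem_filter, Finset.mem_univ, true_and,
      Equiv.trans_apply, Equiv.ofBijective_apply, EmbeddingLike.apply_eq_iff_eq]
    constructor
    · rintro ⟨j, hj, rfl⟩
      have h1 : ν j < p := Nat.nth_lt_of_lt_count hj
      have h2 : ν j < n := by omega
      simp only [W, dif_pos h2]
      exact ⟨h1, hfree j⟩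
    · rintro ⟨h1, h2⟩
      have h3 := Nat.count_strict_mono (p := (· ∉ xs)) h2 h1
      have h4 : Nat.count (· ∉ xs) (q : ℕ) ≤ q := Nat.count_le _
      refine ⟨⟨Nat.count (· ∉ xs) q, by omega⟩, h3, ?_⟩
      have h5 : ν (Nat.count (· ∉ xs) q) = q := Nat.nth_count h2
      simp [W, h5]
end Link
end SFM

namespace SFM

/-! ### Searching for the next change of the oracle's answers -/

/-- The two lists in memory: the first one holds `P`, the second one holds the elements outside
the positions `xs`, followed by the others. -/
structure Lists {n : ℕ} (P : Equiv.Perm (Fin n)) (xs : List ℕ) (s : State) : Prop where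
  nodup : xs.Nodup
  lt : ∀ x ∈ xs, x < n
  entry : HoldsPerm (s.get 0) P
  next : ∀ p : ℕ, p < n → s.get 1 p = addr 0 (p + 1)
  entry' : HoldsPerm (s.get 2) P
  append : ∀ (i : ℕ) (h : i < xs.length),
    s.get 2 (n + i) = (P ⟨xs[i], lt _ (List.getElem_mem h)⟩ : ℕ)
  next' : ∀ q : ℕ, q ≤ 2 * n → s.get 3 ((q : ℤ) - 1) = addr 2 (nextFree xs q)

section Search
variable {n : ℕ} {f : Finset (Fin n) → ℤ} {EO : ℕ} {P : Equiv.Perm (Fin n)} {xs : List ℕ}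

theorem Lists.congr {s s' : State} (h : Lists P xs s) (h0 : s'.get 0 = s.get 0 := by simp)
    (h1 : s'.get 1 = s.get 1 := by simp) (h2 : s'.get 2 = s.get 2 := by simp)
    (h3 : s'.get 3 = s.get 3 := by simp) : Lists P xs s' where
  nodup := h.nodup
  lt := h.lt
  entry := h0 ▸ h.entry
  next := h1 ▸ h.next
  entry' := h2 ▸ h.entry'
  append := h2 ▸ h.append
  next' := h3 ▸ h.next'

theorem Lists.frame {s s' : State} {C : List (Fin 16)} {R : List ℕ} (h : Lists P xs s)
    (hF : Frame C R s s') (h0 : 0 ∉ C := by simp) (h1 : 1 ∉ C := by simp) (h2 : 2 ∉ C := by simp)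
    (h3 : 3 ∉ C := by simp) : Lists P xs s' :=
  h.congr (hF.col 0 h0) (hF.col 1 h1) (hF.col 2 h2) (hF.col 3 h3)

/-- Query the first list. -/
def queryAll (r : ℕ) (k : Exp) : Prog := .query r (.lit (addr 0 0)) k

/-- Query the second list. -/
def queryRest (r : ℕ) (k : Exp) : Prog := .query r (.rd 3 (.lit (-1))) k

theorem Lists.queryAll {s : State} (h : Lists P xs s) {Q : State → ℕ → Prop} {r p : ℕ} {k : Exp}
    (hp : p ≤ n) (hk : k.val s = p)
    (hQ : Q (s.setReg r (f (permPrefix P p))) (1 + k.cost + EO)) :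
    Runs f EO (queryAll r k) s Q :=
  Runs.query (listStores_array h.entry h.next) hp hk hQ

theorem Lists.queryRest {s : State} (h : Lists P xs s) {Q : State → ℕ → Prop} {r p : ℕ} {k : Exp}
    (hp : p ≤ n) (hk : k.val s = Nat.count (· ∉ xs) p)
    (hQ : Q (s.setReg r (f (restPrefix P xs p))) (34 + k.cost + EO)) :
    Runs f EO (queryRest r k) s Q := by
  obtain ⟨L, hL, hpre⟩ := listStores_rest h.nodup h.lt h.entry' h.append h.next'
  refine Runs.query (P := L) (m := Nat.count (· ∉ xs) p) ?_ ((Nat.count_le _).trans hp) hk ?_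
  · simpa using hL
  · rw [hpre p hp]; simpa using hQ

/-- Advance register `14` to the last position, before the next marked one at most, with the same
answers for both lists. -/
def advance : Prog := .block [
  .set 11 (.rd 8 (.reg 8)),
  queryAll 15 (.reg 14),
  queryRest 16 (.sub (.reg 14) (.reg 8)),
  .set 13 (.reg 4),
  .loop (.lit 1) (.reg 13) (.block [
    .set 17 (.add (.reg 14) (.reg 13)),
    .ite (.reg 17) (.reg 11) (.block [
      queryRest 19 (.sub (.reg 17) (.reg 8)),
      .ite (.reg 19) (.reg 16) (.block [
        queryAll 18 (.reg 17),
        .ite (.reg 15) (.reg 18) (.set 14 (.reg 17)) .skip]) .skip]) .skip,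
    .set 13 (.rd 12 (.reg 13))])]

/-- Binary search with step widths `2 ^ L, …, 2, 1`, keeping `G a'` and the failure of `G` at `a'`
plus twice the next width. Monotonicity of `G` is not needed: some `a'` with `G a'` and not `G (a' +
1)` is enough. The position of `p` in the second list is `p - i`, as `i` marks precede it
(`hcount`). -/
theorem advance_runs {s : State} (hn : 1 ≤ n) (hL : Lists P xs s) {a b i : ℕ}
    (h4 : s.reg 4 = (2 ^ Nat.log 2 n : ℕ)) (h8 : s.reg 8 = i) (h14 : s.reg 14 = a)
    (hb : s.get 8 i = b) (hhalf : ∀ q : ℕ, q ≤ n → s.get 12 q = (q / 2 : ℕ))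
    (hab : a ≤ b) (hbn : b ≤ n)
    (hcount : ∀ p, a ≤ p → p ≤ b → Nat.count (· ∉ xs) p + i = p)
    {G : ℕ → Prop} (hG : ∀ p, G p ↔ p ≤ b ∧ f (restPrefix P xs p) ≤ f (restPrefix P xs a) ∧
      f (permPrefix P a) ≤ f (permPrefix P p)) :
    Runs f EO advance s fun s' t => t ≤ (Nat.log 2 n + 1) * (300 + 4 * EO) ∧
      Frame [] [11, 13, 14, 15, 16, 17, 18, 19] s s' ∧ s'.reg 11 = b ∧
      s'.reg 15 = f (permPrefix P a) ∧
      ∃ a', s'.reg 14 = (a' : ℕ) ∧ a ≤ a' ∧ G a' ∧ ¬ G (a' + 1) := by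
  set L := Nat.log 2 n with hLdef
  have hLn : 2 ^ L ≤ n := Nat.pow_log_le_self 2 (by omega)
  have hnL : n < 2 ^ (L + 1) := Nat.lt_pow_succ_log_self (by norm_num) n
  have hc0 : ((Nat.count (· ∉ xs) a : ℕ) : ℤ) = a - i := by have := hcount a le_rfl hab; omega
  simp only [advance, runs_block_cons, runs_block_nil, runs_set]
  refine Lists.queryAll (p := a) hL.congr (hab.trans hbn) (by simp [h14]) ?_
  refine Lists.queryRest (p := a) hL.congr (hab.trans hbn) (by simp [h14, h8, hc0]) ?_
  refine (Runs.for (fun j s' => Frame [] [11, 13, 14, 15, 16, 17, 18, 19] s s' ∧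
      s'.reg 11 = b ∧ s'.reg 15 = f (permPrefix P a) ∧ s'.reg 16 = f (restPrefix P xs a) ∧
      s'.reg 13 = (2 ^ (L + 1 - j) / 2 : ℕ) ∧
      ∃ a', s'.reg 14 = (a' : ℕ) ∧ a ≤ a' ∧ G a' ∧ ¬ G (a' + 2 ^ (L + 1 - j)))
    (L + 1) (150 + 2 * EO) ?_ ?_ ?_).mono ?_
  · refine ⟨(Frame.refl _ _ _).setReg.setReg.setReg.setReg, by simp [h8, hb], by simp, by simp,
      by simp [h4]; rw [pow_succ]; omega, a, by simp [h14], le_rfl, (hG a).2 ⟨hab, le_rfl, le_rfl⟩, ?_⟩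
    -- Initially the far end is `a + 2 ^ (L + 1)`, which exceeds `n` and hence `b`.
    rw [hG]
    rintro ⟨h, -⟩
    simp only [tsub_zero] at h
    omega
  · rintro j s' hj ⟨hF, h11, h15, h16, h13, a', h14', haa, hGa, hnG⟩
    obtain ⟨m, hm⟩ : ∃ m, L = m + j := ⟨L - j, by omega⟩
    have e1 : L + 1 - j = m + 1 := by omega
    have e2 : L + 1 - (j + 1) = m := by omega
    have e3 : 2 ^ (m + 1) / 2 = 2 ^ m := by rw [pow_succ]; omega
    rw [e1, e3] at h13
    rw [e1] at hnG
    rw [e2]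
    have hmn : 2 ^ m ≤ n := (Nat.pow_le_pow_right (by norm_num) (by omega)).trans hLn
    have hpos : 1 ≤ 2 ^ m := Nat.one_le_two_pow
    have hab' := ((hG a').1 hGa).1
    have h8' : s'.reg 8 = i := by rw [hF.reg 8 (by simp)]; exact h8
    have h12 : s'.get 12 (2 ^ m : ℕ) = (2 ^ m / 2 : ℕ) := by
      rw [hF.col 12 (by simp)]; exact hhalf _ hmn
    have hsum : a' + 2 ^ (m + 1) = a' + 2 ^ m + 2 ^ m := by rw [pow_succ]; omega
    rw [hsum] at hnG
    set w := 2 ^ m with hw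
    have hL' : Lists P xs s' := hL.frame hF
    refine ⟨by simp [h13]; omega, ?_⟩
    simp only [runs_block_cons, runs_block_nil, runs_set, runs_skip, runs_ite, val_reg, val_add, reg_setReg,
      h14', h13, h11]
    simp only [Nat.reduceEqDiff, if_true, if_false]
    split_ifs with hc1
    · have hle : a' + w ≤ b := by exact_mod_cast hc1
      have hc2 : ((Nat.count (· ∉ xs) (a' + w) : ℕ) : ℤ) = a' + w - i := by
        have := hcount (a' + w) (by omega) hle
        omega
      refine Lists.queryRest (p := a' + w) hL'.congr (hle.trans hbn) (by simp [h8', hc2]) ?_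
      simp only [reg_setReg, h16]
      simp only [Nat.reduceEqDiff, if_true, if_false]
      split_ifs with hc3
      · refine Lists.queryAll (p := a' + w) hL'.congr (hle.trans hbn) (by simp) ?_
        simp only [reg_setReg, h15]
        simp only [Nat.reduceEqDiff, if_true, if_false]
        split_ifs with hc4
        · refine ⟨by simp; omega, hF.setReg.setReg.setReg.setReg.setReg, by simp [h11],
            by simp, by simp [h16], by simp [h13, h12], a' + w, by simp, by omega,
            (hG _).2 ⟨hle, hc3, hc4⟩, hnG⟩
        · refine ⟨by simp; omega, hF.setReg.setReg.setReg.setReg, by simp [h11],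
            by simp, by simp [h16], by simp [h13, h12], a', by simp [h14'], haa, hGa,
            fun h => hc4 ((hG _).1 h).2.2⟩
      · refine ⟨by simp; omega, hF.setReg.setReg.setReg, by simp [h11],
            by simp [h15], by simp, by simp [h13, h12], a', by simp [h14'], haa, hGa,
            fun h => hc3 ((hG _).1 h).2.1⟩
    · refine ⟨by simp; omega, hF.setReg.setReg, by simp,
            by simp [h15], by simp [h16], by simp [h13, h12], a', by simp, haa, hGa,
            fun h => hc1 (by exact_mod_cast ((hG _).1 h).1)⟩
  · rintro s' ⟨-, -, -, -, h13, -⟩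
    simp [h13]
  · rintro s' t ⟨ht, hF, h11, h15, h16, h13, a', h14', haa, hGa, hnG⟩
    simp only [tsub_self, pow_zero] at hnG
    refine ⟨?_, hF, h11, h15, a', h14', haa, hGa, hnG⟩
    simp at ht ⊢
    nlinarith
end Search
end SFM

namespace SFM

/-! ### Computing the marginals along a permutation -/

/-- Save the set of the elements in positions before register `14`. -/
def save : Prog := .block [
  .set 6 (.reg 15),
  .set 13 (.lit 0),
  .loop (.reg 13) (.sub (.reg 0) (.lit 1)) (.block [
    .ite (.reg 13) (.sub (.reg 14) (.lit 1))
      (.wr 15 (.rd 0 (.reg 13)) (.lit 1)) (.wr 15 (.rd 0 (.reg 13)) (.lit 0)),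
    .set 13 (.add (.reg 13) (.lit 1))])]

/-- Save the current set if it is better than the best one so far. -/
def improve : Prog := .ite (.reg 15) (.sub (.reg 6) (.lit 1)) save .skip

/-- Register `6` holds the value of the set saved in column `15`, or `M + 1`. -/
def Best {n : ℕ} (f : Finset (Fin n) → ℤ) (M : ℕ) (s : State) : Prop :=
  s.reg 6 = M + 1 ∨ ∃ S, s.reg 6 = f S ∧ ∀ e : Fin n, s.get 15 (e : ℕ) = if e ∈ S then 1 else 0

section Sweep
variable {n : ℕ} {f : Finset (Fin n) → ℤ} {EO : ℕ} {P : Equiv.Perm (Fin n)} {xs : List ℕ}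

theorem Best.frame {M : ℕ} {s s' : State} {C : List (Fin 16)} {R : List ℕ} (h : Best f M s)
    (hF : Frame C R s s') (hC : 15 ∉ C := by simp) (hR : 6 ∉ R := by simp) : Best f M s' := by
  unfold Best
  rw [hF.col 15 hC, hF.reg 6 hR]
  exact h

theorem save_runs {s : State} {a : ℕ} (h0 : s.reg 0 = n) (hP : HoldsPerm (s.get 0) P)
    (h14 : s.reg 14 = a) :
    Runs f EO save s fun s' t => t ≤ 800 * (n + 1) ∧ Frame [15] [6, 13] s s' ∧
      s'.reg 6 = s.reg 15 ∧
      ∀ e : Fin n, s'.get 15 (e : ℕ) = if e ∈ permPrefix P a then 1 else 0 := by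
  simp only [save, runs_block_cons, runs_block_nil, runs_set]
  refine (Runs.for (fun j s' => Frame [15] [6, 13] s s' ∧ s'.reg 6 = s.reg 15 ∧ s'.reg 13 = j ∧
      ∀ p : Fin n, (p : ℕ) < j → s'.get 15 (P p : ℕ) = if (p : ℕ) < a then 1 else 0)
    n 700 ?_ ?_ ?_).mono ?_
  · exact ⟨(Frame.refl _ _ _).setReg.setReg, by simp, by simp, fun p hp => absurd hp (by omega)⟩
  · rintro j s' hj ⟨hF, h6, h13, hs⟩
    have h0' : s'.reg 0 = n := (hF.reg 0 (by simp)).trans h0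
    have h14' : s'.reg 14 = a := (hF.reg 14 (by simp)).trans h14
    have hj' : s'.get 0 j = (P ⟨j, hj⟩ : ℕ) := by rw [hF.col 0 (by simp)]; exact hP ⟨j, hj⟩
    have key : ∀ v : ℤ, (v = if j < a then 1 else 0) → ∀ p : Fin n, (p : ℕ) < j + 1 →
        Function.update (s'.get 15) (P ⟨j, hj⟩ : ℕ) v (P p : ℕ) = if (p : ℕ) < a then 1 else 0 := by
      intro v hv p hp
      by_cases hpj : (p : ℕ) = j
      · obtain rfl : p = ⟨j, hj⟩ := Fin.ext hpj
        rw [Function.update_self, hv]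
      · rw [Function.update_of_ne, hs p (by omega)]
        intro h
        have h2 : P p = P ⟨j, hj⟩ := Fin.ext (by exact_mod_cast h)
        exact hpj (congrArg Fin.val (P.injective h2))
    refine ⟨by simp [h13, h0']; omega, ?_⟩
    simp only [runs_block_cons, runs_block_nil, runs_set, runs_ite, runs_wr, val_reg, val_sub,
      val_lit, h13, h14', val_rd, hj']
    split_ifs with hc
    · refine ⟨by simp, hF.put.setReg, by simp [h6], by simp [h13], ?_⟩
      simpa using key 1 (by rw [if_pos (by omega)])
    · refine ⟨by simp, hF.put.setReg, by simp [h6], by simp [h13], ?_⟩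
      simpa using key 0 (by rw [if_neg (by omega)])
  · rintro s' ⟨hF, h6, h13, hs⟩
    have h0' : s'.reg 0 = n := (hF.reg 0 (by simp)).trans h0
    simp [h13, h0']
  · rintro s' t ⟨ht, hF, h6, h13, hs⟩
    refine ⟨by simp at ht ⊢; omega, hF, h6, fun e => ?_⟩
    have := hs (P.symm e) (P.symm e).2
    rw [Equiv.apply_symm_apply] at this
    rw [this]
    congr 1
    rw [eq_iff_iff, ← mem_permPrefix (P := P), Equiv.apply_symm_apply]

/-- Saving takes time linear in `n`, but only happens if the best value drops by at least 1, while
`f` is bounded below by `-M`. So `(best value + M) * 800 * (n + 1)` serves as a potential that pays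
for it. -/
theorem improve_runs {s : State} {M a : ℕ} (hM : ∀ S, |f S| ≤ (M : ℤ)) (h0 : s.reg 0 = n)
    (hP : HoldsPerm (s.get 0) P) (h14 : s.reg 14 = a) (h15 : s.reg 15 = f (permPrefix P a))
    (hB : Best f M s) :
    Runs f EO improve s fun s' t => Frame [15] [6, 13] s s' ∧ Best f M s' ∧
      s'.reg 6 ≤ s.reg 6 ∧ s'.reg 6 ≤ f (permPrefix P a) ∧
      t + (s'.reg 6 + M).toNat * (800 * (n + 1)) ≤ (s.reg 6 + M).toNat * (800 * (n + 1)) + 10 := by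
  simp only [improve, runs_ite, runs_skip]
  split_ifs with h
  · refine (save_runs h0 hP h14).mono ?_
    rintro s' t ⟨ht, hF, h6, hs⟩
    simp only [val_reg, val_sub, val_lit] at h
    refine ⟨hF, .inr ⟨permPrefix P a, h6.trans h15, hs⟩, by omega, by rw [h6, h15], ?_⟩
    have h1 : -(M : ℤ) ≤ s'.reg 6 := by rw [h6, h15]; exact (abs_le.1 (hM _)).1
    have h2 : (s'.reg 6 + M).toNat + 1 ≤ (s.reg 6 + M).toNat := by omega
    have h3 := Nat.mul_le_mul_right (800 * (n + 1)) h2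
    rw [Nat.add_mul, Nat.one_mul] at h3
    simp
    omega
  · simp only [val_reg, val_sub, val_lit] at h
    refine ⟨Frame.refl _ _ _, hB, le_rfl, by omega, ?_⟩
    simp
    omega

end Sweep
end SFM

/-! ### The sweep: correctness of skipping, and the recorded marginals -/

namespace SFM

/-- Append the element in position register `14` with its marginal value to the list of nonzero
marginals, unless the value is zero. -/
def record : Prog := .ite (.reg 14) (.sub (.reg 0) (.lit 1)) (.block [
  .wr 10 (.reg 7) (.rd 0 (.reg 14)),
  queryAll 20 (.add (.reg 14) (.lit 1)),
  .set 20 (.sub (.reg 20) (.reg 15)),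
  .wr 11 (.reg 7) (.reg 20),
  .ite (.reg 20) (.lit (-1)) (.set 7 (.add (.reg 7) (.lit 1))) .skip,
  .ite (.lit 1) (.reg 20) (.set 7 (.add (.reg 7) (.lit 1))) .skip]) .skip

/-- Determine all nonzero marginals, and the best prefix. -/
def sweep : Prog := .block [
  .set 8 (.lit 0),
  .set 14 (.lit 0),
  .set 7 (.lit 0),
  .loop (.reg 14) (.reg 0) (.block [
    advance,
    improve,
    record,
    .ite (.reg 11) (.reg 14) (.set 8 (.add (.reg 8) (.lit 1))) .skip,
    .set 14 (.add (.reg 14) (.lit 1))])]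

/-- The list of nonzero marginals in memory, for the positions before `a`. -/
structure Marginals {n : ℕ} (f : Finset (Fin n) → ℤ) (P : Equiv.Perm (Fin n)) (a : ℕ)
    (es : List (Fin n)) (s : State) : Prop where
  nodup : es.Nodup
  len : s.reg 7 = es.length
  elt : Holds (fun e : Fin n => ((e : ℕ) : ℤ)) (s.get 10) es
  val : Holds (fun e => jump f P (P.symm e)) (s.get 11) es
  lt : ∀ e ∈ es, (P.symm e : ℕ) < a
  ne : ∀ e ∈ es, jump f P (P.symm e) ≠ 0
  all : ∀ p : Fin n, (p : ℕ) < a → jump f P p ≠ 0 → P p ∈ es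

section Sweep
variable {n : ℕ} {f : Finset (Fin n) → ℤ} {EO : ℕ} {P : Equiv.Perm (Fin n)} {xs : List ℕ}

theorem Marginals.congr {a : ℕ} {es : List (Fin n)} {s s' : State} (h : Marginals f P a es s)
    (h7 : s'.reg 7 = s.reg 7) (h10 : s'.get 10 = s.get 10) (h11 : s'.get 11 = s.get 11) :
    Marginals f P a es s' where
  nodup := h.nodup
  len := h7.trans h.len
  elt := h10 ▸ h.elt
  val := h11 ▸ h.val
  lt := h.lt
  ne := h.ne
  all := h.all

theorem Marginals.frame {a : ℕ} {es : List (Fin n)} {s s' : State} {C : List (Fin 16)}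
    {R : List ℕ} (h : Marginals f P a es s) (hF : Frame C R s s') (hR : 7 ∉ R := by simp)
    (h10 : 10 ∉ C := by simp) (h11 : 11 ∉ C := by simp) : Marginals f P a es s' :=
  h.congr (hF.reg _ hR) (hF.col _ h10) (hF.col _ h11)

theorem Marginals.skip {a a' : ℕ} {es : List (Fin n)} {s : State} (h : Marginals f P a es s)
    (ha : a ≤ a') (h0 : ∀ p : ℕ, a ≤ p → p < a' → p < n → jump f P p = 0) :
    Marginals f P a' es s where
  nodup := h.nodup
  len := h.len
  elt := h.elt
  val := h.val
  lt e he := (h.lt e he).trans_le ha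
  ne := h.ne
  all p hp hne := h.all p (by by_contra hc; exact hne (h0 p (by omega) hp p.2)) hne

/-- The new entry is always written behind the end of the list; the length grows only if the
marginal is nonzero, which the two one-sided comparisons detect. At position `n` there is no element
and nothing is done. -/
theorem record_runs {s : State} {a : ℕ} {es : List (Fin n)} (h0 : s.reg 0 = n)
    (hL : Lists P xs s) (h14 : s.reg 14 = a) (h15 : s.reg 15 = f (permPrefix P a))
    (hE : Marginals f P a es s) :
    Runs f EO record s fun s' t => t ≤ 800 + EO ∧ Frame [10, 11] [7, 20] s s' ∧
      ∃ es', Marginals f P (a + 1) es' s' := by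
  simp only [record, runs_ite, runs_skip]
  split_ifs with h
  · simp only [val_reg, val_sub, val_lit, h0, h14] at h
    have ha : a < n := by omega
    simp only [runs_block_cons, runs_block_nil, runs_set, runs_wr]
    refine Lists.queryAll (p := a + 1) hL.congr ha (by simp [h14]) ?_
    have hE' : s.get 0 a = (P ⟨a, ha⟩ : ℕ) := hL.entry ⟨a, ha⟩
    have hj : f (permPrefix P (a + 1)) - f (permPrefix P a) = jump f P a := rfl
    have happ : jump f P a ≠ 0 → Marginals f P (a + 1) (es ++ [P ⟨a, ha⟩])
        (((((s.put 10 (es.length) (P ⟨a, ha⟩ : ℕ)).setReg 20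
          (f (permPrefix P (a + 1)))).setReg 20 (jump f P a)).put 11 es.length
          (jump f P a)).setReg 7 (es.length + 1)) := by
      intro hne
      refine ⟨?_, by simp, ?_, ?_, ?_, ?_, ?_⟩
      · rw [List.nodup_append]
        refine ⟨hE.nodup, by simp, ?_⟩
        intro e he b hb hab
        rw [List.mem_singleton] at hb
        have := hE.lt e he
        rw [hab, hb] at this
        simp at this
      · simpa using hE.elt.append (P ⟨a, ha⟩) rfl rfl
      · simpa using hE.val.append (P ⟨a, ha⟩) rfl (by simp)
      · intro e he
        rcases List.mem_append.1 he with he | he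
        · have := hE.lt e he; omega
        · rw [List.mem_singleton] at he
          subst he
          simp
      · intro e he
        rcases List.mem_append.1 he with he | he
        · exact hE.ne e he
        · rw [List.mem_singleton] at he
          subst he
          simpa using hne
      · intro p hp hne
        rw [List.mem_append, List.mem_singleton]
        rcases Nat.lt_succ_iff_lt_or_eq.1 hp with h1 | h1
        · exact .inl (hE.all p h1 hne)
        · exact .inr (congrArg P (Fin.ext h1))
    simp only [runs_ite, runs_set, runs_skip, val_reg, val_sub, val_lit, reg_setReg, reg_put,
      h14, hE.len, val_rd, hE', h15, val_add]
    simp only [Nat.reduceEqDiff, if_true, if_false, hj]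
    split_ifs with h1 h2 h2
    · exact absurd (h1.trans_lt (by norm_num)) (not_lt.2 (zero_le_one.trans h2))
    · exact ⟨by simp; omega, ((Frame.refl _ _ _).put.setReg.setReg.put.setReg), _,
        happ (by omega)⟩
    · exact ⟨by simp; omega, ((Frame.refl _ _ _).put.setReg.setReg.put.setReg), _,
        happ (by omega)⟩
    · refine ⟨by simp; omega, ((Frame.refl _ _ _).put.setReg.setReg.put), es, ?_⟩
      have hz : jump f P a = 0 := by omega
      refine Marginals.skip ⟨hE.nodup, by simp [hE.len], ?_, ?_, hE.lt, hE.ne, hE.all⟩ (Nat.le_succ a) ?_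
      · simpa using hE.elt.update le_rfl
      · simpa using hE.val.update le_rfl
      · intro p hp hp' _
        obtain rfl : p = a := by omega
        exact hz
  · simp only [val_reg, val_sub, val_lit, h0, h14] at h
    exact ⟨by simp; omega, Frame.refl _ _ _, es, hE.skip (Nat.le_succ a) fun p h1 _ h3 => by omega⟩

/-- Along the unmarked elements `f` is monotone, so `h2` forces it to be constant from `a` to `a'`.
Each true marginal in between is bounded by a marginal of that sequence, hence by zero; so the
prefix values of `P` descend, and `h1` forces them to be constant as well. -/
theorem eq_of_advance (hf : IsSubmodular f) (hR : RestMono f P xs) {a a' : ℕ} (ha : a ≤ a')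
    (han : a' ≤ n) (hfree : ∀ p, a ≤ p → p < a' → p ∉ xs)
    (h2 : f (restPrefix P xs a') ≤ f (restPrefix P xs a))
    (h1 : f (permPrefix P a) ≤ f (permPrefix P a')) :
    ∀ p, a ≤ p → p ≤ a' → f (restPrefix P xs p) = f (restPrefix P xs a) ∧
      f (permPrefix P p) = f (permPrefix P a) := by
  have hmono : ∀ d p, p + d ≤ n → f (restPrefix P xs p) ≤ f (restPrefix P xs (p + d)) := by
    intro d
    induction d with
    | zero => intro p _; exact le_rfl
    | succ d ih => intro p hp; exact (ih p (by omega)).trans (hR (p + d) (by omega))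
  have hmono' : ∀ p q, p ≤ q → q ≤ n → f (restPrefix P xs p) ≤ f (restPrefix P xs q) := by
    intro p q hpq hq
    obtain ⟨d, rfl⟩ := Nat.exists_eq_add_of_le hpq
    exact hmono d p hq
  have hrest : ∀ p, a ≤ p → p ≤ a' → f (restPrefix P xs p) = f (restPrefix P xs a) := by
    intro p hp hp'
    exact le_antisymm ((hmono' p a' hp' han).trans h2) (hmono' a p hp (hp'.trans han))
  have hanti : ∀ d p, a ≤ p → p + d ≤ a' → f (permPrefix P (p + d)) ≤ f (permPrefix P p) := by
    intro d
    induction d with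
    | zero => intro p _ _; exact le_rfl
    | succ d ih =>
      intro p hp hp'
      refine le_trans ?_ (ih p hp (by omega))
      have := jump_le_rest hf P (p := p + d) (by omega) (hfree (p + d) (by omega) (by omega))
      rw [hrest (p + d) (by omega) (by omega), hrest (p + d + 1) (by omega) (by omega), jump] at this
      rw [← Nat.add_assoc]
      omega
  intro p hp hp'
  refine ⟨hrest p hp hp', le_antisymm ?_ ?_⟩
  · obtain ⟨d, rfl⟩ := Nat.exists_eq_add_of_le hp
    exact hanti d a le_rfl hp'
  · obtain ⟨d, rfl⟩ := Nat.exists_eq_add_of_le hp'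
    exact h1.trans (hanti d p hp le_rfl)

/-- The first `i` marks are exactly those below `p`. This translates positions in `P` to positions
in the second list by one subtraction. -/
theorem count_add_of_sorted {xs : List ℕ} (hs : xs.Pairwise (· < ·)) {i p : ℕ}
    (hi : i ≤ xs.length) (h : ∀ (j : ℕ) (hj : j < xs.length), j < i ↔ xs[j] < p) :
    Nat.count (· ∉ xs) p + i = p := by
  have h1 : ((Finset.range p).filter fun x => x ∈ xs) = (xs.take i).toFinset := by
    ext x
    simp only [Finset.mem_filter, Finset.mem_range, List.mem_toFinset, List.mem_take_iff_getElem]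
    constructor
    · rintro ⟨hx, hm⟩
      obtain ⟨j, hj, rfl⟩ := List.mem_iff_getElem.1 hm
      exact ⟨j, by have := (h j hj).2 hx; omega, rfl⟩
    · rintro ⟨j, hj, rfl⟩
      exact ⟨(h j (by omega)).1 (by omega), List.getElem_mem _⟩
  have h2 : (xs.take i).toFinset.card = i := by
    rw [List.toFinset_card_of_nodup ((hs.imp fun h => h.ne).sublist (List.take_sublist _ _)),
      List.length_take, min_eq_left hi]
  have h3 := Finset.card_filter_add_card_filter_not (s := Finset.range p) (fun x => x ∈ xs)
  rw [Finset.card_range, h1, h2] at h3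
  rw [Nat.count_eq_card_filter_range]
  omega

end Sweep
end SFM

namespace SFM

section Sweep
variable {n : ℕ} {f : Finset (Fin n) → ℤ} {EO : ℕ} {P : Equiv.Perm (Fin n)} {xs : List ℕ}

/-- Every pass ends at a stop or at `n`, so the number of passes is governed by `card_stops_le`; `K`
bounds the cost of a pass without the saving of a set, which the potential of `improve_runs` covers.
-/
theorem sweep_runs (hf : IsSubmodular f) {M : ℕ} (hM : ∀ S, |f S| ≤ (M : ℤ)) {s : State}
    (hn : 1 ≤ n) (hL : Lists P xs s) (hR : RestMono f P xs) (hs : xs.Pairwise (· < ·))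
    (h0 : s.reg 0 = n) (h4 : s.reg 4 = (2 ^ Nat.log 2 n : ℕ))
    (hhalf : ∀ q : ℕ, q ≤ n → s.get 12 q = (q / 2 : ℕ))
    (hX : Holds Nat.cast (s.get 8) (xs ++ [n])) (hB : Best f M s) :
    Runs f EO sweep s fun s' t =>
      Frame [10, 11, 15] [6, 7, 8, 11, 13, 14, 15, 16, 17, 18, 19, 20] s s' ∧
      Best f M s' ∧ (∀ k ≤ n, s'.reg 6 ≤ f (permPrefix P k)) ∧ s'.reg 6 ≤ s.reg 6 ∧
      (∃ es, Marginals f P n es s') ∧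
      t + (s'.reg 6 + M).toNat * (800 * (n + 1)) ≤ (s.reg 6 + M).toNat * (800 * (n + 1)) +
        (xs.length + 6 * M + 2) * ((Nat.log 2 n + 1) * (300 + 4 * EO) + EO + 900) := by
  set K := (Nat.log 2 n + 1) * (300 + 4 * EO) + EO + 900 with hK
  simp only [sweep, runs_block_cons, runs_block_nil, runs_set]
  -- Here `a` is the next position and `i` the number of marks before it. The budget provides for
  -- each stop from `a` on, and, while `a ≤ n`, for one more pass that ends at `n` and evaluates the
  -- full set.
  refine (Runs.loop (fun τ s' => ∃ (a i : ℕ) (es : List (Fin n)),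
      Frame [10, 11, 15] [6, 7, 8, 11, 13, 14, 15, 16, 17, 18, 19, 20] s s' ∧
      Best f M s' ∧ (∀ k ≤ n, k < a → s'.reg 6 ≤ f (permPrefix P k)) ∧ s'.reg 6 ≤ s.reg 6 ∧
      Marginals f P a es s' ∧ s'.reg 14 = a ∧ s'.reg 8 = i ∧ a ≤ n + 1 ∧
      (a ≤ n → i ≤ xs.length) ∧ (∀ (j : ℕ) (hj : j < xs.length), j < i ↔ xs[j] < a) ∧
      τ = (s'.reg 6 + M).toNat * (800 * (n + 1)) +
        ((stops f P xs a).card + if a ≤ n then 1 else 0) * K)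
    ⟨0, 0, [], (Frame.refl _ _ _).setReg.setReg.setReg, ?_, ?_, ?_, ?_, ?_, ?_, ?_, ?_, ?_, rfl⟩
    ?_).mono ?_
  · exact hB.frame (C := []) (R := [8, 14, 7]) (((Frame.refl _ _ _).setReg).setReg.setReg)
  · intro k _ hk; omega
  · simp
  · exact ⟨List.nodup_nil, by simp, fun i hi => absurd hi (by simp), fun i hi => absurd hi (by simp),
      by simp, by simp, fun p hp => absurd hp (by omega)⟩
  · simp
  · simp
  · omega
  · omega
  · intro j hj; simp
  · rintro τ s1 ⟨a, i, es, hF, hB, hk, hle, hE, h14, h8, han, hi, hidx, rfl⟩ hg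
    have h0' : s1.reg 0 = n := (hF.reg 0 (by simp)).trans h0
    have ha : a ≤ n := by simp only [val_reg, h14, h0'] at hg; omega
    have hi := hi ha
    -- `b` is the next mark, or the sentinel `n` at the end of the list.
    obtain ⟨b, hb, hbn, hab, hbx⟩ : ∃ b : ℕ, s.get 8 i = b ∧ b ≤ n ∧ a ≤ b ∧
        ((∃ h : i < xs.length, b = xs[i]) ∨ (i = xs.length ∧ b = n)) := by
      rcases hi.lt_or_eq with h | h
      · refine ⟨xs[i], ?_, (hL.lt _ (List.getElem_mem h)).le, ?_, .inl ⟨h, rfl⟩⟩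
        · have := hX i (by simp; omega)
          rwa [List.getElem_append_left h] at this
        · have := hidx i h; omega
      · refine ⟨n, ?_, le_rfl, ha, .inr ⟨h, rfl⟩⟩
        have := hX i (by simp; omega)
        simpa [h] using this
    have hidx' : ∀ p, a ≤ p → p ≤ b → ∀ (j : ℕ) (hj : j < xs.length), j < i ↔ xs[j] < p := by
      intro p hp hp' j hj
      rw [hidx j hj]
      refine ⟨fun h => by omega, fun h => ?_⟩
      rw [← hidx j hj]
      rcases hbx with ⟨h', rfl⟩ | ⟨rfl, rfl⟩
      · by_contra hc
        have : xs[i] ≤ xs[j] := by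
          rcases (not_lt.1 hc).lt_or_eq with h2 | h2
          · exact (List.pairwise_iff_getElem.1 hs i j h' hj h2).le
          · subst h2; exact le_rfl
        omega
      · exact hj
    have hfree : ∀ p, a ≤ p → p < b → p ∉ xs := by
      intro p hp hp' hm
      obtain ⟨j, hj, rfl⟩ := List.mem_iff_getElem.1 hm
      have h1 := (hidx' (xs[j] + 1) (by omega) (by omega) j hj)
      have h2 := (hidx' xs[j] (by omega) (by omega) j hj)
      omega
    simp only [runs_block_cons, runs_block_nil]
    refine (advance_runs (G := fun p => p ≤ b ∧ f (restPrefix P xs p) ≤ f (restPrefix P xs a) ∧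
      f (permPrefix P a) ≤ f (permPrefix P p)) hn (hL.frame hF)
      ((hF.reg 4 (by simp)).trans h4) h8 h14 (by rw [hF.col 8 (by simp)]; exact hb)
      (by rw [hF.col 12 (by simp)]; exact hhalf) hab hbn
      (fun p hp hp' => count_add_of_sorted hs hi (hidx' p hp hp')) fun p => Iff.rfl).mono ?_
    rintro s2 t2 ⟨ht2, hF2, h11, h15, a', h14', haa, ⟨hab', hGa1, hGa2⟩, hnG⟩
    have heq := eq_of_advance hf hR haa (hab'.trans hbn) (fun p hp hp' => hfree p hp (by omega))
      hGa1 hGa2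
    have h15' : s2.reg 15 = f (permPrefix P a') := h15.trans (heq a' haa le_rfl).2.symm
    -- If `a'` is not the next mark, the search failed at `a' + 1` because one of the two sequences
    -- changes there.
    have hmem_stops : a' < n → a' ∈ stops f P xs a := by
      intro han'
      simp only [stops, Finset.mem_filter, Finset.mem_range]
      refine ⟨han', haa, ?_⟩
      by_cases hb' : a' < b
      · right
        by_contra hc
        push Not at hc
        rw [jump] at hc
        refine hnG ⟨hb', ?_, ?_⟩
        · have := (heq a' haa le_rfl).1; omega
        · have := (heq a' haa le_rfl).2; omega
      · left
        obtain rfl : a' = b := by omega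
        rcases hbx with ⟨h', h2⟩ | ⟨_, rfl⟩
        · exact h2 ▸ List.getElem_mem h'
        · omega
    refine (improve_runs hM ((hF2.reg 0 (by simp)).trans h0') (hL.frame hF |>.frame hF2).entry h14'
      h15' (hB.frame hF2)).mono ?_
    rintro s3 t3 ⟨hF3, hB3, hle3, hle3', ht3⟩
    have hF23 : Frame [15] [6, 11, 13, 14, 15, 16, 17, 18, 19] s1 s3 := hF2.mono.trans hF3
    have hE3 : Marginals f P a' es s3 := by
      refine (hE.frame hF23).skip haa fun p hp hp' _ => ?_
      rw [jump, (heq p hp hp'.le).2, (heq (p + 1) (by omega) hp').2, sub_self]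
    refine (record_runs (xs := xs) ((hF23.reg 0 (by simp)).trans h0')
      (hL.frame hF |>.frame hF23) ((hF3.reg 14 (by simp)).trans h14')
      ((hF3.reg 15 (by simp)).trans h15') hE3).mono ?_
    rintro s4 t4 ⟨ht4, hF4, es', hE4⟩
    have hF24 : Frame [10, 11, 15] [6, 7, 11, 13, 14, 15, 16, 17, 18, 19, 20] s1 s4 :=
      hF23.mono.trans hF4
    have h8' : s4.reg 8 = i := (hF24.reg 8 (by simp)).trans h8
    have h14'' : s4.reg 14 = a' := (hF4.reg 14 (by simp)).trans ((hF3.reg 14 (by simp)).trans h14')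
    have h11'' : s4.reg 11 = b := (hF4.reg 11 (by simp)).trans ((hF3.reg 11 (by simp)).trans h11)
    have h6 : s4.reg 6 = s3.reg 6 := hF4.reg 6 (by simp)
    have h6' : s2.reg 6 = s1.reg 6 := hF2.reg 6 (by simp)
    have hcard : ((stops f P xs (a' + 1)).card + if a' + 1 ≤ n then 1 else 0) + 1 ≤
        (stops f P xs a).card + 1 := by
      have hsub : stops f P xs (a' + 1) ⊆ stops f P xs a := by
        intro p
        simp only [stops, Finset.mem_filter]
        rintro ⟨h1, h2, h3⟩
        exact ⟨h1, by omega, h3⟩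
      by_cases h : a' < n
      · rw [if_pos (show a' + 1 ≤ n from h)]
        have : stops f P xs (a' + 1) ⊂ stops f P xs a := by
          refine (Finset.ssubset_iff_of_subset hsub).2 ⟨a', hmem_stops h, ?_⟩
          simp [stops]
        have := Finset.card_lt_card this
        omega
      · rw [if_neg (show ¬ a' + 1 ≤ n by omega)]
        have := Finset.card_le_card hsub
        omega
    have hcard' := Nat.mul_le_mul_right K hcard
    rw [Nat.add_mul _ 1 K, one_mul] at hcard'
    have key : ∀ (s5 : State) (t5 : ℕ) (i' : ℕ), t5 ≤ 20 →
        Frame [] [8, 14] s4 s5 → s5.reg 14 = (a' + 1 : ℕ) → s5.reg 8 = i' →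
        (a' + 1 ≤ n → i' ≤ xs.length) →
        (∀ (j : ℕ) (hj : j < xs.length), j < i' ↔ xs[j] < a' + 1) →
        ∃ τ', (Exp.reg 14).cost + (Exp.reg 0).cost + 1 + (t2 + (t3 + (t4 + t5))) + τ' ≤
          (s1.reg 6 + M).toNat * (800 * (n + 1)) +
            ((stops f P xs a).card + if a ≤ n then 1 else 0) * K ∧
        ∃ (a i : ℕ) (es : List (Fin n)),
          Frame [10, 11, 15] [6, 7, 8, 11, 13, 14, 15, 16, 17, 18, 19, 20] s s5 ∧
          Best f M s5 ∧ (∀ k ≤ n, k < a → s5.reg 6 ≤ f (permPrefix P k)) ∧ s5.reg 6 ≤ s.reg 6 ∧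
          Marginals f P a es s5 ∧ s5.reg 14 = a ∧ s5.reg 8 = i ∧ a ≤ n + 1 ∧
          (a ≤ n → i ≤ xs.length) ∧ (∀ (j : ℕ) (hj : j < xs.length), j < i ↔ xs[j] < a) ∧
          τ' = (s5.reg 6 + M).toNat * (800 * (n + 1)) +
            ((stops f P xs a).card + if a ≤ n then 1 else 0) * K := by
      intro s5 t5 i' ht5 hF5 h14 h8 hi' hidx''
      have h65 : s5.reg 6 = s3.reg 6 := (hF5.reg 6 (by simp)).trans h6
      refine ⟨_, ?_, a' + 1, i', es', ?_, (hB3.frame hF4).frame hF5, ?_, ?_,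
        hE4.frame hF5, h14, h8, by omega, hi', hidx'', rfl⟩
      · rw [h65, if_pos ha]
        rw [h6'] at ht3
        simp only [cost_reg]
        omega
      · exact hF.trans ((hF24.mono (C' := [10, 11, 15])
          (R' := [6, 7, 8, 11, 13, 14, 15, 16, 17, 18, 19, 20])).trans hF5)
      · intro k hkn hka
        rw [h65]
        rcases lt_or_ge k a with h | h
        · have := hk k hkn h; omega
        -- The skipped prefixes have the same value as the one at `a'`, with which the best value
        -- has been compared.
        · rw [(heq k h (by omega)).2, ← (heq a' haa le_rfl).2]; exact hle3'
      · rw [h65]; omega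
    have hnext : Runs f EO (.block [.ite (.reg 11) (.reg 14) (.set 8 (.add (.reg 8) (.lit 1))) .skip,
        .set 14 (.add (.reg 14) (.lit 1))]) s4 fun s5 t5 => ∃ i' : ℕ, t5 ≤ 20 ∧
          Frame [] [8, 14] s4 s5 ∧ s5.reg 14 = (a' + 1 : ℕ) ∧ s5.reg 8 = i' ∧
          (a' + 1 ≤ n → i' ≤ xs.length) ∧
          (∀ (j : ℕ) (hj : j < xs.length), j < i' ↔ xs[j] < a' + 1) := by
      simp only [runs_block_cons, runs_block_nil, runs_ite, runs_set, runs_skip, val_reg, h11'', h14'']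
      split_ifs with hc
      · obtain rfl : a' = b := by omega
        refine ⟨i + 1, by simp, (Frame.refl _ _ _).setReg.setReg, by simp [h14''],
          by simp [h8'], ?_, ?_⟩
        · intro h
          rcases hbx with ⟨h', -⟩ | ⟨-, rfl⟩
          · exact h'
          · omega
        · intro j hj
          have h1 := hidx' a' haa le_rfl j hj
          rcases hbx with ⟨h', h2⟩ | ⟨h2, h3⟩
          · rcases lt_trichotomy j i with h | h | h
            · have := h1.1 h; omega
            · subst h; omega
            · have := List.pairwise_iff_getElem.1 hs i j h' hj h
              omega
          · have := hL.lt _ (List.getElem_mem hj)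
            omega
      · have hlt : a' < b := by omega
        exact ⟨i, by simp, (Frame.refl _ _ _).setReg, by simp [h14''], by simp [h8'],
          fun _ => hi, hidx' (a' + 1) (by omega) hlt⟩
    simp only [runs_block_cons, runs_block_nil] at hnext
    refine hnext.mono fun s5 t5 h5 => h5.mono fun s6 t6 h6 => ?_
    obtain ⟨i', h7, h8, h9, h10, h11, h12⟩ := h6
    exact key _ _ i' h7 h8 h9 h10 h11 h12
  · rintro s' t ⟨τ, ht, ⟨a, i, es, hF, hB, hk, hle, hE, h14, h8, han, hi, hidx, rfl⟩, hg⟩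
    have h0' : s'.reg 0 = n := (hF.reg 0 (by simp)).trans h0
    have ha : a = n + 1 := by simp only [val_reg, h14, h0'] at hg; omega
    subst ha
    refine ⟨hF, hB, fun k hk' => hk k hk' (by omega), hle, ⟨es, ⟨hE.nodup, hE.len, hE.elt, hE.val,
      fun e _ => (P.symm e).2, hE.ne, fun p _ h => hE.all p (by omega) h⟩⟩, ?_⟩
    have h1 := card_stops_le hf hM hR 0
    have h2 := Nat.mul_le_mul_right K (show (stops f P xs 0).card + 1 + 1 ≤ xs.length + 6 * M + 2 by omega)
    rw [Nat.add_mul _ 1 K, one_mul] at h2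
    simp only [zero_le, if_true, reg_setReg, cost_reg, cost_lit] at ht ⊢
    simp only [Nat.reduceEqDiff, if_false] at ht
    omega

end Sweep
end SFM

namespace SFM

/-! ### Moving elements between the levels -/

/-- Add the position in register `11` to the list of marked positions. -/
def touch : Prog := .ite (.rd 7 (.reg 11)) (.lit 0) (.block [
  .wr 7 (.reg 11) (.lit 1),
  .wr 8 (.reg 5) (.reg 11),
  .set 5 (.add (.reg 5) (.lit 1))]) .skip

/-- Exchange the element in register `9` with the one in the position in register `11`. -/
def exchange : Prog := .block [
  .set 12 (.rd 4 (.reg 9)),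
  .set 13 (.rd 0 (.reg 11)),
  .wr 0 (.reg 11) (.reg 9),
  .wr 2 (.reg 11) (.reg 9),
  .wr 4 (.reg 9) (.reg 11),
  .wr 0 (.reg 12) (.reg 13),
  .wr 2 (.reg 12) (.reg 13),
  .wr 4 (.reg 13) (.reg 12),
  touch]

/-- Move the element in register `9` one level up, if possible. -/
def raise : Prog := .ite (.rd 5 (.reg 9)) (.sub (.reg 2) (.lit 1)) (.block [
  .set 14 (.add (.rd 5 (.reg 9)) (.lit 1)),
  .set 11 (.rd 6 (.reg 14)),
  .wr 6 (.reg 14) (.add (.reg 11) (.lit 1)),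
  .wr 5 (.reg 9) (.reg 14),
  exchange]) .skip

/-- Move the element in register `9` one level down, if possible. -/
def lower : Prog := .ite (.lit 1) (.rd 5 (.reg 9)) (.block [
  .set 14 (.rd 5 (.reg 9)),
  .set 11 (.sub (.rd 6 (.reg 14)) (.lit 1)),
  .wr 6 (.reg 14) (.reg 11),
  .wr 5 (.reg 9) (.sub (.reg 14) (.lit 1)),
  exchange]) .skip

/-- The permutation `P` in memory: both entry columns and the column of positions. -/
structure PermArrays {n : ℕ} (P : Equiv.Perm (Fin n)) (s : State) : Prop where
  entry : HoldsPerm (s.get 0) P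
  entry' : HoldsPerm (s.get 2) P
  pos : ∀ p : Fin n, s.get 4 (P p : ℕ) = (p : ℕ)

/-- The levels `z` in memory; `P` lists the elements by descending levels, and column `6` holds
the number of elements of each level or a higher one. -/
structure Levels {n : ℕ} (N : ℤ) (P : Equiv.Perm (Fin n)) (z : Fin n → ℤ) (s : State) : Prop where
  level : ∀ e : Fin n, s.get 5 (e : ℕ) = z e
  nonneg : ∀ e, 0 ≤ z e
  le : ∀ e, z e ≤ N
  count_nonneg : ∀ l, 1 ≤ l → l ≤ N → 0 ≤ s.get 6 l
  count_le : ∀ l, 1 ≤ l → l ≤ N → s.get 6 l ≤ n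
  lt_count : ∀ l, 1 ≤ l → l ≤ N → ∀ p : Fin n, ((p : ℕ) : ℤ) < s.get 6 l ↔ l ≤ z (P p)

/-- The list of marked positions in memory. -/
structure Marked (n : ℕ) (xs : List ℕ) (s : State) : Prop where
  len : s.reg 5 = xs.length
  list : Holds Nat.cast (s.get 8) xs
  nodup : xs.Nodup
  lt : ∀ x ∈ xs, x < n
  mark : ∀ p : ℕ, p < n → s.get 7 p = if p ∈ xs then 1 else 0

section Moves
variable {n : ℕ} {f : Finset (Fin n) → ℤ} {EO : ℕ} {P : Equiv.Perm (Fin n)} {xs : List ℕ}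
  {N : ℤ} {z : Fin n → ℤ} {s s' : State}

theorem PermArrays.frame {C : List (Fin 16)} {R : List ℕ} (h : PermArrays P s)
    (hF : Frame C R s s') (h0 : 0 ∉ C := by simp) (h2 : 2 ∉ C := by simp)
    (h4 : 4 ∉ C := by simp) : PermArrays P s' :=
  ⟨hF.col 0 h0 ▸ h.entry, hF.col 2 h2 ▸ h.entry', hF.col 4 h4 ▸ h.pos⟩

theorem Levels.frame {C : List (Fin 16)} {R : List ℕ} (h : Levels N P z s)
    (hF : Frame C R s s') (h5 : 5 ∉ C := by simp) (h6 : 6 ∉ C := by simp) : Levels N P z s' := by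
  have e5 := hF.col 5 h5
  have e6 := hF.col 6 h6
  exact ⟨e5 ▸ h.level, h.nonneg, h.le, e6 ▸ h.count_nonneg, e6 ▸ h.count_le, e6 ▸ h.lt_count⟩

theorem Marked.frame {C : List (Fin 16)} {R : List ℕ} (h : Marked n xs s)
    (hF : Frame C R s s') (h7 : 7 ∉ C := by simp) (h8 : 8 ∉ C := by simp)
    (h5 : 5 ∉ R := by simp) : Marked n xs s' :=
  ⟨hF.reg 5 h5 ▸ h.len, hF.col 8 h8 ▸ h.list, h.nodup, h.lt, hF.col 7 h7 ▸ h.mark⟩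

theorem touch_runs {p : ℕ} (hp : p < n) (h11 : s.reg 11 = p) (hX : Marked n xs s) :
    Runs f EO touch s fun s' t => t ≤ 120 ∧ Frame [7, 8] [5] s s' ∧
      ∃ xs', Marked n xs' s' ∧ p ∈ xs' ∧ xs ⊆ xs' ∧ xs'.length ≤ xs.length + 1 := by
  simp only [touch, runs_ite, runs_block_cons, runs_block_nil, runs_set, runs_skip, runs_wr,
    val_rd, val_reg, val_lit, h11, hX.mark p hp]
  by_cases hm : p ∈ xs
  · simp only [hm, if_true]
    exact ⟨by simp, Frame.refl _ _ _, xs, hX, hm, List.Subset.refl _, by omega⟩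
  · simp only [hm, if_false, le_refl, if_true]
    refine ⟨by simp, (Frame.refl _ _ _).put.put.setReg, xs ++ [p], ⟨?_, ?_, ?_, ?_, ?_⟩, by simp,
      by simp, by simp⟩
    · simp [hX.len]
    · simpa [h11] using hX.list.append p hX.len rfl
    · rw [List.nodup_append]
      refine ⟨hX.nodup, by simp, ?_⟩
      rintro a ha b hb rfl
      rw [List.mem_singleton] at hb
      exact hm (hb ▸ ha)
    · intro x hx
      rcases List.mem_append.1 hx with h | h
      · exact hX.lt x h
      · rw [List.mem_singleton] at h; omega
    · intro q hq
      have := hX.mark q hq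
      by_cases hqp : q = p
      · subst hqp; simp
      · simp [hqp, this]

/-- Only the new position `q` of `e` gets marked here: where this is used, the old position of `e`
is marked already. The case that `e` is in position `q` is included and leaves the permutation
unchanged. -/
theorem exchange_runs {e q : Fin n} (h9 : s.reg 9 = (e : ℕ)) (h11 : s.reg 11 = (q : ℕ))
    (hP : PermArrays P s) (hX : Marked n xs s) :
    Runs f EO exchange s fun s' t => t ≤ 700 ∧ Frame [0, 2, 4, 7, 8] [5, 12, 13] s s' ∧
      PermArrays ((Equiv.swap (P.symm e) q).trans P) s' ∧
      ∃ xs', Marked n xs' s' ∧ (q : ℕ) ∈ xs' ∧ xs ⊆ xs' ∧ xs'.length ≤ xs.length + 1 := by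
  set p := P.symm e with hp
  have hPp : P p = e := by simp [hp]
  have e1 : s.get 4 (e : ℕ) = (p : ℕ) := by rw [← hPp]; exact hP.pos p
  have e2 : s.get 0 (q : ℕ) = (P q : ℕ) := hP.entry q
  have hval : ∀ a b : Fin n, (((a : ℕ) : ℤ) = (b : ℕ)) ↔ a = b := fun a b => by
    rw [Nat.cast_inj, Fin.val_inj]
  have hent : ∀ g : ℤ → ℤ, HoldsPerm g P → HoldsPerm
      (Function.update (Function.update g (q : ℕ) (e : ℕ)) (p : ℕ) (P q : ℕ))
      ((Equiv.swap p q).trans P) := by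
    intro g hg r
    simp only [Function.update_apply, hval, Equiv.trans_apply, Equiv.swap_apply_def]
    split_ifs with h1 h2
    · rfl
    · rw [hPp]
    · exact hg r
  simp only [exchange, runs_block_cons, runs_block_nil, runs_set, runs_wr]
  set s1 : State := ((((((((s.setReg 12 (p : ℕ)).setReg 13 (P q : ℕ)).put 0 (q : ℕ) (e : ℕ)).put 2
    (q : ℕ) (e : ℕ)).put 4 (e : ℕ) (q : ℕ)).put 0 (p : ℕ) (P q : ℕ)).put 2 (p : ℕ) (P q : ℕ)).put 4
    (P q : ℕ) (p : ℕ)) with hs1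
  have hF1 : Frame [0, 2, 4] [12, 13] s s1 :=
    (Frame.refl _ _ _).setReg.setReg.put.put.put.put.put.put
  have hP1 : PermArrays ((Equiv.swap p q).trans P) s1 := by
    refine ⟨?_, ?_, ?_⟩
    · simpa [hs1] using hent _ hP.entry
    · simpa [hs1] using hent _ hP.entry'
    · intro r
      have h1 := hP.pos (Equiv.swap p q r)
      simp only [hs1, get_put, get_setReg, Equiv.trans_apply, Fin.reduceEq, if_true, if_false,
        Function.update_apply, hval, EmbeddingLike.apply_eq_iff_eq]
      split_ifs with h2 h3
      · rw [Equiv.swap_apply_eq_iff, Equiv.swap_apply_right] at h2; rw [h2]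
      · rw [← hPp, EmbeddingLike.apply_eq_iff_eq, Equiv.swap_apply_eq_iff,
          Equiv.swap_apply_left] at h3
        rw [h3]
      · rw [h1, Equiv.swap_apply_def]
        have h4 : r ≠ q := by
          rintro rfl
          exact h3 (by rw [Equiv.swap_apply_right, hPp])
        have h5 : r ≠ p := by
          rintro rfl
          exact h2 (Equiv.swap_apply_left _ _)
        rw [if_neg h5, if_neg h4]
  have := (touch_runs (f := f) (EO := EO) (s := s1) q.2 (by rw [hF1.reg 11 (by simp), h11])
    (hX.frame hF1))
  simp only [val_rd, val_reg, reg_setReg, h9, e1, get_setReg, h11, reg_put]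
  simp only [Nat.reduceEqDiff, if_true, if_false, e2]
  refine this.mono ?_
  rintro s2 t2 ⟨ht2, hF2, hX2⟩
  refine ⟨by simp; omega, hF1.mono.trans hF2, hP1.frame hF2, hX2⟩

/-- The changes from the permutation `P₀` are confined to marked positions. -/
structure Moving {n : ℕ} (N : ℤ) (P₀ P : Equiv.Perm (Fin n)) (z : Fin n → ℤ) (xs : List ℕ)
    (s : State) : Prop where
  max : s.reg 2 = N
  perm : PermArrays P s
  levels : Levels N P z s
  marked : Marked n xs s
  eq : ∀ p : Fin n, (p : ℕ) ∉ xs → P p = P₀ p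

theorem Moving.frame {P₀ : Equiv.Perm (Fin n)} {C : List (Fin 16)} {R : List ℕ}
    (h : Moving N P₀ P z xs s) (hF : Frame C R s s')
    (hC : ∀ c ∈ [0, 2, 4, 5, 6, 7, 8], c ∉ C := by simp) (h2 : 2 ∉ R := by simp)
    (h5 : 5 ∉ R := by simp) : Moving N P₀ P z xs s' where
  max := (hF.reg 2 h2).trans h.max
  perm := h.perm.frame hF (hC _ (by simp)) (hC _ (by simp)) (hC _ (by simp))
  levels := h.levels.frame hF (hC _ (by simp)) (hC _ (by simp))
  marked := h.marked.frame hF (hC _ (by simp)) (hC _ (by simp)) h5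
  eq := h.eq

theorem swap_eq {P P₀ : Equiv.Perm (Fin n)} {xs xs' : List ℕ} {p q : Fin n}
    (h : ∀ r : Fin n, (r : ℕ) ∉ xs → P r = P₀ r) (hs : xs ⊆ xs') (hp : (p : ℕ) ∈ xs')
    (hq : (q : ℕ) ∈ xs') (r : Fin n) (hr : (r : ℕ) ∉ xs') :
    ((Equiv.swap p q).trans P) r = P₀ r := by
  rw [Equiv.trans_apply, Equiv.swap_apply_of_ne_of_ne, h r fun hm => hr (hs hm)]
  · rintro rfl; exact hr hp
  · rintro rfl; exact hr hq

/-- The number of elements above the level of `e` is the first position `q` of that level. Swapping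
`e` there and increasing this count by one moves the boundary between the two levels past `e`, so
one swap keeps the list ordered by levels. -/
theorem raise_runs {P₀ : Equiv.Perm (Fin n)} {e : Fin n} (h9 : s.reg 9 = (e : ℕ))
    (h : Moving N P₀ P z xs s) (he : (P.symm e : ℕ) ∈ xs) :
    Runs f EO raise s fun s' t => t ≤ 1000 ∧
      Frame [0, 2, 4, 5, 6, 7, 8] [5, 11, 12, 13, 14] s s' ∧
      ∃ P' xs', Moving N P₀ P' (Function.update z e (clip N (z e + 1))) xs' s' ∧
        (P'.symm e : ℕ) ∈ xs' ∧ xs ⊆ xs' ∧ xs'.length ≤ xs.length + 1 := by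
  have h5 := h.levels.level e
  have hz0 := h.levels.nonneg e
  have hzN := h.levels.le e
  simp only [raise, runs_ite, runs_skip, val_rd, val_reg, val_sub, val_lit, h9, h5, h.max]
  split_ifs with hc
  · have hl0 := h.levels.count_nonneg (z e + 1) (by omega) (by omega)
    have hlc := h.levels.lt_count (z e + 1) (by omega) (by omega)
    set p := P.symm e with hp
    have hPp : P p = e := by simp [hp]
    have hqp : s.get 6 (z e + 1) ≤ (p : ℕ) := by
      rw [← not_lt, hlc p, hPp]; omega
    obtain ⟨q, hq⟩ : ∃ q : Fin n, s.get 6 (z e + 1) = (q : ℕ) :=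
      ⟨⟨(s.get 6 (z e + 1)).toNat, by have := p.2; omega⟩, by simp only; omega⟩
    have hcl : clip N (z e + 1) = z e + 1 := by unfold clip; omega
    rw [hcl]
    have hzq : z (P q) = z e := by
      by_cases hqe : P q = e
      · rw [hqe]
      have h1 := hlc q
      rw [hq] at h1
      have h2 : z (P q) < z e + 1 := by
        by_contra hcon
        exact lt_irrefl _ (h1.2 (by omega))
      -- Position `q` is not after that of `e`, so its level is at least `z e`; level 0 is separate,
      -- because only the counts of levels from 1 on are maintained.
      rcases eq_or_lt_of_le hz0 with h3 | h3
      · have := h.levels.nonneg (P q); omega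
      · have h4 := h.levels.lt_count (z e) (by omega) (by omega)
        have h5 := (h4 p).2 (by rw [hPp])
        have h6 := (h4 q).1 (by omega)
        omega
    simp only [runs_block_cons, runs_block_nil, runs_set, runs_wr]
    set s1 : State := (((s.setReg 14 (z e + 1)).setReg 11 (q : ℕ)).put 6 (z e + 1) ((q : ℕ) + 1)).put 5
      (e : ℕ) (z e + 1) with hs1
    have hF1 : Frame [5, 6] [11, 14] s s1 := (Frame.refl _ _ _).setReg.setReg.put.put
    have := exchange_runs (f := f) (EO := EO) (s := s1) (e := e) (q := q)
      (by rw [hF1.reg 9 (by simp), h9]) (by simp [hs1]) (h.perm.frame hF1)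
      (h.marked.frame hF1)
    simp only [val_rd, val_reg, val_add, val_lit, reg_setReg, h9, get_setReg, reg_put, h5]
    simp only [Nat.reduceEqDiff, if_true, if_false, hq]
    refine this.mono ?_
    rintro s2 t2 ⟨ht2, hF2, hP2, xs', hX', hqx, hsub, hlen⟩
    refine ⟨by simp; omega, hF1.mono.trans hF2, _, xs', ⟨?_, hP2, ?_, hX', ?_⟩, ?_, hsub, hlen⟩
    · rw [hF2.reg 2 (by simp), hF1.reg 2 (by simp), h.max]
    · have h51 : s2.get 5 = Function.update (s.get 5) (e : ℕ) (z e + 1) := by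
        rw [hF2.col 5 (by simp)]; simp [hs1]
      have h61 : s2.get 6 = Function.update (s.get 6) (z e + 1) ((q : ℕ) + 1) := by
        rw [hF2.col 6 (by simp)]; simp [hs1]
      refine ⟨?_, ?_, ?_, ?_, ?_, ?_⟩
      · intro e'
        rw [h51]
        have := h.levels.level e'
        simp only [Function.update_apply, Nat.cast_inj, Fin.val_inj]
        split_ifs <;> simp [this]
      · intro e'
        have := h.levels.nonneg e'
        simp only [Function.update_apply]
        split_ifs <;> omega
      · intro e'
        have := h.levels.le e'
        simp only [Function.update_apply]
        split_ifs <;> omega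
      · intro l hl1 hlN
        have := h.levels.count_nonneg l hl1 hlN
        rw [h61, Function.update_apply]
        split_ifs <;> omega
      · intro l hl1 hlN
        have := h.levels.count_le l hl1 hlN
        have := q.2
        rw [h61, Function.update_apply]
        split_ifs <;> omega
      · intro l hl1 hlN r
        have hr := h.levels.lt_count l hl1 hlN r
        have hpl := h.levels.lt_count l hl1 hlN p
        have hql := h.levels.lt_count l hl1 hlN q
        rw [hPp] at hpl
        rw [h61]
        simp only [Function.update_apply, Equiv.trans_apply, Equiv.swap_apply_def]
        by_cases hrp : r = p
        · subst hrp
          rw [if_pos rfl]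
          by_cases hqr : P q = e
          · have : q = p := P.injective (by rw [hPp, hqr])
            subst this
            rw [if_pos hqr]
            split_ifs <;> omega
          · have hne : (q : ℕ) ≠ p := fun hh => hqr (by rw [← hPp, Fin.ext hh])
            rw [if_neg hqr]
            split_ifs with h1
            · subst h1; omega
            · omega
        · rw [if_neg hrp]
          by_cases hrq : r = q
          · subst hrq
            rw [if_pos rfl, hPp, if_pos rfl]
            split_ifs <;> omega
          · have hre : P r ≠ e := fun hh => hrp (P.injective (by rw [hPp, hh]))
            have hne : (r : ℕ) ≠ q := fun hh => hrq (Fin.ext hh)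
            rw [if_neg hrq, if_neg hre]
            split_ifs with h1
            · subst h1; omega
            · exact hr
    · exact swap_eq h.eq hsub (hsub he) hqx
    · simpa [hp, Equiv.symm_trans_apply] using hqx
  · have hcl : clip N (z e + 1) = z e := by unfold clip; omega
    rw [hcl, Function.update_eq_self]
    exact ⟨by simp, Frame.refl _ _ _, P, xs, h, he, List.Subset.refl _, by omega⟩

end Moves
end SFM

namespace SFM

/-- Apply all the marginals to the levels. -/
def moves : Prog := .block [
  .set 5 (.lit 0),
  .set 8 (.lit 0),
  .loop (.reg 8) (.sub (.reg 7) (.lit 1)) (.block [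
    .set 9 (.rd 10 (.reg 8)),
    .set 10 (.rd 11 (.reg 8)),
    .set 11 (.rd 4 (.reg 9)),
    touch,
    .loop (.reg 10) (.lit (-1)) (.block [raise, .set 10 (.add (.reg 10) (.lit 1))]),
    .loop (.lit 1) (.reg 10) (.block [lower, .set 10 (.sub (.reg 10) (.lit 1))]),
    .set 8 (.add (.reg 8) (.lit 1))])]

section Moves
variable {n : ℕ} {f : Finset (Fin n) → ℤ} {EO : ℕ} {P : Equiv.Perm (Fin n)} {xs : List ℕ}
  {N : ℤ} {z : Fin n → ℤ} {s s' : State}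

/-- The mirror image of `raise_runs`: `e` is exchanged with the last element of its level, in the
position one less than the count of that level, and leaves that count. -/
theorem lower_runs {P₀ : Equiv.Perm (Fin n)} {e : Fin n} (h9 : s.reg 9 = (e : ℕ))
    (h : Moving N P₀ P z xs s) (he : (P.symm e : ℕ) ∈ xs) :
    Runs f EO lower s fun s' t => t ≤ 1000 ∧
      Frame [0, 2, 4, 5, 6, 7, 8] [5, 11, 12, 13, 14] s s' ∧
      ∃ P' xs', Moving N P₀ P' (Function.update z e (clip N (z e - 1))) xs' s' ∧
        (P'.symm e : ℕ) ∈ xs' ∧ xs ⊆ xs' ∧ xs'.length ≤ xs.length + 1 := by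
  have h5 := h.levels.level e
  have hz0 := h.levels.nonneg e
  have hzN := h.levels.le e
  simp only [lower, runs_ite, runs_skip, val_rd, val_reg, val_lit, h9, h5]
  split_ifs with hc
  · have hln := h.levels.count_le (z e) (by omega) (by omega)
    have hlc := h.levels.lt_count (z e) (by omega) (by omega)
    set p := P.symm e with hp
    have hPp : P p = e := by simp [hp]
    have hqp : ((p : ℕ) : ℤ) < s.get 6 (z e) := by
      rw [hlc p, hPp]
    obtain ⟨q, hq⟩ : ∃ q : Fin n, s.get 6 (z e) = (q : ℕ) + 1 :=
      ⟨⟨(s.get 6 (z e)).toNat - 1, by have := p.2; omega⟩, by simp only; omega⟩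
    have hcl : clip N (z e - 1) = z e - 1 := by unfold clip; omega
    rw [hcl]
    have hzq : z (P q) = z e := by
      have h1 := (hlc q).1 (by omega)
      rcases eq_or_lt_of_le hzN with h3 | h3
      · have := h.levels.le (P q); omega
      · have h4 := h.levels.lt_count (z e + 1) (by omega) (by omega)
        have h5 := h4 p
        have h6 := h4 q
        rw [hPp] at h5
        omega
    simp only [runs_block_cons, runs_block_nil, runs_set, runs_wr]
    set s1 : State := (((s.setReg 14 (z e)).setReg 11 (q : ℕ)).put 6 (z e) (q : ℕ)).put 5
      (e : ℕ) (z e - 1) with hs1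
    have hF1 : Frame [5, 6] [11, 14] s s1 := (Frame.refl _ _ _).setReg.setReg.put.put
    have := exchange_runs (f := f) (EO := EO) (s := s1) (e := e) (q := q)
      (by rw [hF1.reg 9 (by simp), h9]) (by simp [hs1]) (h.perm.frame hF1)
      (h.marked.frame hF1)
    simp only [val_rd, val_reg, val_sub, val_lit, reg_setReg, h9, get_setReg, reg_put, h5]
    simp only [Nat.reduceEqDiff, if_true, if_false, hq, add_sub_cancel_right]
    refine this.mono ?_
    rintro s2 t2 ⟨ht2, hF2, hP2, xs', hX', hqx, hsub, hlen⟩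
    refine ⟨by simp; omega, hF1.mono.trans hF2, _, xs', ⟨?_, hP2, ?_, hX', ?_⟩, ?_, hsub, hlen⟩
    · rw [hF2.reg 2 (by simp), hF1.reg 2 (by simp), h.max]
    · have h51 : s2.get 5 = Function.update (s.get 5) (e : ℕ) (z e - 1) := by
        rw [hF2.col 5 (by simp)]; simp [hs1]
      have h61 : s2.get 6 = Function.update (s.get 6) (z e) (q : ℕ) := by
        rw [hF2.col 6 (by simp)]; simp [hs1]
      refine ⟨?_, ?_, ?_, ?_, ?_, ?_⟩
      · intro e'
        rw [h51]
        have := h.levels.level e'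
        simp only [Function.update_apply, Nat.cast_inj, Fin.val_inj]
        split_ifs <;> simp [this]
      · intro e'
        have := h.levels.nonneg e'
        simp only [Function.update_apply]
        split_ifs <;> omega
      · intro e'
        have := h.levels.le e'
        simp only [Function.update_apply]
        split_ifs <;> omega
      · intro l hl1 hlN
        have := h.levels.count_nonneg l hl1 hlN
        rw [h61, Function.update_apply]
        split_ifs <;> omega
      · intro l hl1 hlN
        have := h.levels.count_le l hl1 hlN
        have := q.2
        rw [h61, Function.update_apply]
        split_ifs <;> omega
      · intro l hl1 hlN r
        have hr := h.levels.lt_count l hl1 hlN r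
        have hpl := h.levels.lt_count l hl1 hlN p
        have hql := h.levels.lt_count l hl1 hlN q
        rw [hPp] at hpl
        rw [h61]
        simp only [Function.update_apply, Equiv.trans_apply, Equiv.swap_apply_def]
        by_cases hrp : r = p
        · subst hrp
          rw [if_pos rfl]
          by_cases hqr : P q = e
          · have : q = p := P.injective (by rw [hPp, hqr])
            subst this
            rw [if_pos hqr]
            split_ifs <;> omega
          · have hne : (q : ℕ) ≠ p := fun hh => hqr (by rw [← hPp, Fin.ext hh])
            rw [if_neg hqr]
            split_ifs with h1
            · subst h1; omega
            · omega
        · rw [if_neg hrp]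
          by_cases hrq : r = q
          · subst hrq
            rw [if_pos rfl, hPp, if_pos rfl]
            split_ifs <;> omega
          · have hre : P r ≠ e := fun hh => hrp (P.injective (by rw [hPp, hh]))
            have hne : (r : ℕ) ≠ q := fun hh => hrq (Fin.ext hh)
            rw [if_neg hrq, if_neg hre]
            split_ifs with h1
            · subst h1; omega
            · exact hr
    · exact swap_eq h.eq hsub (hsub he) hqx
    · simpa [hp, Equiv.symm_trans_apply] using hqx
  · have hcl : clip N (z e - 1) = z e := by unfold clip; omega
    rw [hcl, Function.update_eq_self]
    exact ⟨by simp, Frame.refl _ _ _, P, xs, h, he, List.Subset.refl _, by omega⟩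

/-- The configurations while the element `e` is being moved by `-g`; `γ` is what remains. -/
def Shifting (N : ℤ) (P₀ : Equiv.Perm (Fin n)) (z : Fin n → ℤ) (xs : List ℕ) (e : Fin n) (g : ℤ)
    (s : State) (γ : ℤ) (s' : State) : Prop :=
  Frame [0, 2, 4, 5, 6, 7, 8] [5, 10, 11, 12, 13, 14] s s' ∧ s'.reg 10 = γ ∧
    ∃ P' v xs', Moving N P₀ P' (Function.update z e v) xs' s' ∧
      clip N (v - γ) = clip N (z e - g) ∧
      (P'.symm e : ℕ) ∈ xs' ∧ xs ⊆ xs' ∧ xs'.length + γ.natAbs ≤ xs.length + g.natAbs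

/-- All unit steps go in the same direction, so clipping after each of them has the same effect as
clipping once at the end; the invariant is that `clip N (v - γ)` does not change. For either sign of
`g` only one of the two loops does anything. -/
theorem shift_runs {P₀ : Equiv.Perm (Fin n)} {e : Fin n} {g : ℤ} (h9 : s.reg 9 = (e : ℕ))
    (h10 : s.reg 10 = g) (h : Moving N P₀ P z xs s) (he : (P.symm e : ℕ) ∈ xs)
    {Q : State → ℕ → Prop}
    (hQ : ∀ s' t, t ≤ g.natAbs * 1010 + 8 → Frame [0, 2, 4, 5, 6, 7, 8] [5, 10, 11, 12, 13, 14] s s' →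
      ∀ P' xs', Moving N P₀ P' (Function.update z e (clip N (z e - g))) xs' s' →
        (P'.symm e : ℕ) ∈ xs' → xs ⊆ xs' → xs'.length ≤ xs.length + g.natAbs → Q s' t) :
    Runs f EO (.seq (.loop (.reg 10) (.lit (-1)) (.block [raise, .set 10 (.add (.reg 10) (.lit 1))]))
      (.loop (.lit 1) (.reg 10) (.block [lower, .set 10 (.sub (.reg 10) (.lit 1))]))) s Q := by
  rw [runs_seq]
  refine (Runs.loop (fun τ s' => ∃ γ, Shifting N P₀ z xs e g s γ s' ∧ τ = γ.natAbs * 1010)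
    (τ := g.natAbs * 1010) ⟨g, ⟨Frame.refl _ _ _, h10, P, z e, xs, ?_, rfl, he,
      List.Subset.refl _, le_rfl⟩, rfl⟩ ?_).mono ?_
  · rwa [Function.update_eq_self]
  · rintro τ s1 ⟨γ, ⟨hF, h10', P1, v, xs1, hm, hcl, he1, hsub, hlen⟩, rfl⟩ hg
    simp only [val_reg, val_lit, h10'] at hg
    simp only [runs_block_cons, runs_block_nil, runs_set]
    refine (raise_runs ((hF.reg 9 (by simp)).trans h9) hm he1).mono ?_
    rintro s2 t2 ⟨ht2, hF2, P2, xs2, hm2, he2, hsub2, hlen2⟩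
    rw [Function.update_idem, Function.update_self] at hm2
    have hv0 := hm.levels.nonneg e
    have hvN := hm.levels.le e
    rw [Function.update_self] at hv0 hvN
    refine ⟨(γ + 1).natAbs * 1010, by simp; omega, γ + 1, ⟨?_, ?_, P2, _, xs2,
      hm2.frame (Frame.refl [] [10] _).setReg, ?_, he2, List.Subset.trans hsub hsub2, by omega⟩, rfl⟩
    · exact (hF.trans (hF2.mono (C' := [0, 2, 4, 5, 6, 7, 8]) (R' := [5, 10, 11, 12, 13, 14]))).setReg
    · have : s2.reg 10 = γ := (hF2.reg 10 (by simp)).trans h10'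
      simp [this]
    · rw [← hcl]
      unfold clip
      omega
  · rintro s1 t1 ⟨τ, ht1, ⟨γ1, hS1, rfl⟩, hg1⟩
    have hγ1 : 0 ≤ γ1 := by
      have := hS1.2.1
      simp only [val_reg, val_lit, this] at hg1
      omega
    refine (Runs.loop (fun τ s' => ∃ γ, 0 ≤ γ ∧ Shifting N P₀ z xs e g s γ s' ∧ τ = γ.natAbs * 1010)
      (τ := γ1.natAbs * 1010) ⟨γ1, hγ1, hS1, rfl⟩ ?_).mono ?_
    · rintro τ s2 ⟨γ, hγ, ⟨hF, h10', P1, v, xs1, hm, hcl, he1, hsub, hlen⟩, rfl⟩ hg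
      simp only [val_reg, val_lit, h10'] at hg
      simp only [runs_block_cons, runs_block_nil, runs_set]
      refine (lower_runs ((hF.reg 9 (by simp)).trans h9) hm he1).mono ?_
      rintro s2 t2 ⟨ht2, hF2, P2, xs2, hm2, he2, hsub2, hlen2⟩
      rw [Function.update_idem, Function.update_self] at hm2
      have hv0 := hm.levels.nonneg e
      have hvN := hm.levels.le e
      rw [Function.update_self] at hv0 hvN
      refine ⟨(γ - 1).natAbs * 1010, by simp; omega, γ - 1, by omega, ⟨?_, ?_, P2, _, xs2,
        hm2.frame (Frame.refl [] [10] _).setReg, ?_, he2, List.Subset.trans hsub hsub2, by omega⟩, rfl⟩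
      · exact (hF.trans (hF2.mono (C' := [0, 2, 4, 5, 6, 7, 8]) (R' := [5, 10, 11, 12, 13, 14]))).setReg
      · have : s2.reg 10 = γ := (hF2.reg 10 (by simp)).trans h10'
        simp [this]
      · rw [← hcl]
        unfold clip
        omega
    · rintro s2 t2 ⟨τ, ht2, ⟨γ, hγ, ⟨hF, h10', P2, v, xs2, hm, hcl, he1, hsub, hlen⟩, rfl⟩, hg⟩
      simp only [val_reg, val_lit, h10'] at hg
      obtain rfl : γ = 0 := by omega
      have hv0 := hm.levels.nonneg e
      have hvN := hm.levels.le e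
      rw [Function.update_self] at hv0 hvN
      have hv : v = clip N (z e - g) := by
        rw [← hcl]; unfold clip; omega
      subst hv
      refine hQ _ _ ?_ hF P2 xs2 hm he1 hsub (by simpa using hlen)
      simp at ht1 ht2
      omega

/-- Each element of `es` causes one mark for its own position and at most one per unit move, which
explains the summand `|g| + 1` in the bounds for the time and for the number of marks. -/
theorem moves_runs {P₀ : Equiv.Perm (Fin n)} {es : List (Fin n)} (hE : Marginals f P₀ n es s)
    (hN : s.reg 2 = N) (hP : PermArrays P₀ s) (hz : Levels N P₀ z s)
    (hmark : ∀ p : ℕ, p < n → s.get 7 p = 0) :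
    Runs f EO moves s fun s' t =>
      t ≤ (es.map fun e => (jump f P₀ (P₀.symm e)).natAbs + 1).sum * 1500 + 20 ∧
      Frame [0, 2, 4, 5, 6, 7, 8] [5, 8, 9, 10, 11, 12, 13, 14] s s' ∧
      ∃ P xs, Moving N P₀ P (fun e => clip N (z e - jump f P₀ (P₀.symm e))) xs s' ∧
        (∀ e ∈ es, (P₀.symm e : ℕ) ∈ xs) ∧
        xs.length ≤ (es.map fun e => (jump f P₀ (P₀.symm e)).natAbs + 1).sum := by
  set w : Fin n → ℕ := fun e => (jump f P₀ (P₀.symm e)).natAbs + 1 with hw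
  simp only [moves, runs_block_cons, runs_block_nil, runs_set]
  refine (Runs.loop (fun τ s' => ∃ j P z' xs, j ≤ es.length ∧
      Frame [0, 2, 4, 5, 6, 7, 8] [5, 8, 9, 10, 11, 12, 13, 14] s s' ∧ s'.reg 8 = (j : ℕ) ∧
      Moving N P₀ P z' xs s' ∧
      (∀ e, z' e = if e ∈ es.take j then clip N (z e - jump f P₀ (P₀.symm e)) else z e) ∧
      (∀ e ∈ es.take j, (P₀.symm e : ℕ) ∈ xs) ∧
      xs.length + ((es.drop j).map w).sum ≤ (es.map w).sum ∧
      τ = ((es.drop j).map w).sum * 1500) (τ := (es.map w).sum * 1500) ?_ ?_).mono ?_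
  · refine ⟨0, P₀, z, [], by omega, (Frame.refl _ _ _).setReg.setReg, by simp, ⟨by simp [hN], ?_, ?_,
      ⟨by simp, fun i hi => absurd hi (by simp), by simp, by simp, ?_⟩, by simp⟩, by simp, by simp,
      by simp, by simp⟩
    · exact hP.frame (C := []) (R := [5, 8]) (Frame.refl _ _ _).setReg.setReg
    · exact hz.frame (C := []) (R := [5, 8]) (Frame.refl _ _ _).setReg.setReg
    · intro p hp; simp [hmark p hp]
  · rintro τ s1 ⟨j, P, z', xs, hj, hF, h8, hm, hz', hx, hlen, rfl⟩ hg
    have h7 : s1.reg 7 = es.length := (hF.reg 7 (by simp)).trans hE.len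
    simp only [val_reg, val_lit, val_sub, h8, h7] at hg
    have hj' : j < es.length := by omega
    set e := es[j] with he
    set g := jump f P₀ (P₀.symm e) with hg'
    have e1 : s1.get 10 j = (e : ℕ) := by rw [hF.col 10 (by simp)]; exact hE.elt j hj'
    have e2 : s1.get 11 j = g := by rw [hF.col 11 (by simp)]; exact hE.val j hj'
    have hdrop : es.drop j = e :: es.drop (j + 1) := List.drop_eq_getElem_cons hj'
    have htake : es.take (j + 1) = es.take j ++ [e] := by simp [he]
    have e3 : s1.get 4 (e : ℕ) = (P.symm e : ℕ) := by
      have := hm.perm.pos (P.symm e)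
      rwa [Equiv.apply_symm_apply] at this
    have hze : z' e = z e := by
      rw [hz', if_neg]
      intro hmem
      obtain ⟨i, hi, hie⟩ := List.mem_take_iff_getElem.1 hmem
      have := (List.Nodup.getElem_inj_iff hE.nodup).1 hie
      omega
    have hwe : w e = g.natAbs + 1 := rfl
    rw [hdrop, List.map_cons, List.sum_cons, hwe] at hlen
    simp only [runs_block_cons, runs_block_nil, runs_set, val_rd, val_reg, h8, e1, reg_setReg,
      get_setReg]
    simp only [Nat.reduceEqDiff, if_true, if_false, e2, e3]
    set s2 : State := ((s1.setReg 9 (e : ℕ)).setReg 10 g).setReg 11 (P.symm e : ℕ) with hs2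
    have hF2 : Frame [] [9, 10, 11] s1 s2 := (Frame.refl _ _ _).setReg.setReg.setReg
    refine (touch_runs (s := s2) (P.symm e).2 (by simp [hs2]) (hm.marked.frame hF2)).mono ?_
    rintro s3 t3 ⟨ht3, hF3, xs3, hX3, hmem3, hsub3, hlen3⟩
    have hm3 : Moving N P₀ P z' xs3 s3 :=
      ⟨by rw [hF3.reg 2 (by simp), hF2.reg 2 (by simp), hm.max], (hm.perm.frame hF2).frame hF3,
        (hm.levels.frame hF2).frame hF3, hX3, fun p hp => hm.eq p fun h => hp (hsub3 h)⟩
    have hshift := shift_runs (f := f) (EO := EO) (e := e) (g := g) (s := s3) (P₀ := P₀)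
      (by rw [hF3.reg 9 (by simp)]; simp [hs2]) (by rw [hF3.reg 10 (by simp)]; simp [hs2]) hm3 hmem3
      (Q := fun s' t => t ≤ g.natAbs * 1010 + 8 ∧
        Frame [0, 2, 4, 5, 6, 7, 8] [5, 10, 11, 12, 13, 14] s3 s' ∧
        ∃ P' xs', Moving N P₀ P' (Function.update z' e (clip N (z' e - g))) xs' s' ∧
        (P'.symm e : ℕ) ∈ xs' ∧ xs3 ⊆ xs' ∧ xs'.length ≤ xs3.length + g.natAbs)
      (fun s' t h1 h2 P' xs' h3 h4 h5 h6 => ⟨h1, h2, P', xs', h3, h4, h5, h6⟩)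
    rw [runs_seq] at hshift
    refine hshift.mono fun s4 t4 h4 => h4.mono fun s5 t5 h5 => ?_
    obtain ⟨ht5, hF5, P5, xs5, hm5, he5, hsub5, hlen5⟩ := h5
    refine ⟨((es.drop (j + 1)).map w).sum * 1500, ?_, j + 1, P5, _, xs5, hj', ?_, ?_,
      hm5.frame (Frame.refl [] [8] _).setReg, ?_, ?_, by omega, rfl⟩
    · rw [hdrop, List.map_cons, List.sum_cons, hwe]
      simp
      omega
    · refine Frame.setReg ?_
      have hF25 : Frame [0, 2, 4, 5, 6, 7, 8] [5, 8, 9, 10, 11, 12, 13, 14] s2 s5 :=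
        (hF3.mono (C' := [0, 2, 4, 5, 6, 7, 8]) (R' := [5, 8, 9, 10, 11, 12, 13, 14])).trans hF5
      exact hF.trans ((hF2.mono (C' := [0, 2, 4, 5, 6, 7, 8])
        (R' := [5, 8, 9, 10, 11, 12, 13, 14])).trans hF25)
    · have : s5.reg 8 = j := by
        rw [hF5.reg 8 (by simp), hF3.reg 8 (by simp), hF2.reg 8 (by simp), h8]
      simp [this]
    · intro e'
      rw [htake]
      simp only [Function.update_apply, List.mem_append, List.mem_singleton, hz' e', hze]
      by_cases hee : e' = e
      · subst hee; simp [hg']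
      · simp [hee]
    · intro e' he'
      rw [htake] at he'
      rcases List.mem_append.1 he' with h | h
      · exact hsub5 (hsub3 (hx e' h))
      · rw [List.mem_singleton] at h
        subst h
        -- The mark was set at the position of `e` when its turn came, which may differ from its
        -- position in `P₀`. But if the latter were unmarked, `e` would never have left it, whereas
        -- the current position of `e` is marked.
        by_contra hc
        have h1 := hm5.eq (P₀.symm e) hc
        rw [Equiv.apply_symm_apply] at h1
        have h2 : P₀.symm e = P5.symm e := by rw [Equiv.eq_symm_apply, h1]
        rw [h2] at hc
        exact hc he5
  · rintro s' t ⟨τ, ht, ⟨j, P, z', xs, hj, hF, h8, hm, hz', hx, hlen, rfl⟩, hg⟩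
    have h7 : s'.reg 7 = es.length := (hF.reg 7 (by simp)).trans hE.len
    simp only [val_reg, val_lit, val_sub, h8, h7] at hg
    obtain rfl : j = es.length := by omega
    rw [List.take_length] at hz' hx
    refine ⟨?_, hF, P, xs, ?_, hx, by omega⟩
    · simp at ht ⊢; omega
    · have : z' = fun e => clip N (z e - jump f P₀ (P₀.symm e)) := by
        funext e
        rw [hz']
        split_ifs with h
        · rfl
        · have h0 : jump f P₀ (P₀.symm e) = 0 := by
            by_contra hne
            have := hE.all (P₀.symm e) (P₀.symm e).2 hne
            rw [Equiv.apply_symm_apply] at this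
            exact h this
          have h1 := hz.nonneg e
          have h2 := hz.le e
          rw [h0]
          unfold clip
          omega
      rwa [this] at hm

end Moves
end SFM

namespace SFM

/-! ### Sorting the marked positions -/

/-- Append the listed positions (in register `9`) with `a ≤ b` to the buffer. -/
def collect (a b : Exp) : Prog := .block [
  .set 8 (.lit 0),
  .loop (.reg 8) (.sub (.reg 5) (.lit 1)) (.block [
    .set 9 (.rd 8 (.reg 8)),
    .ite a b (.block [.wr 9 (.reg 20) (.reg 9), .set 20 (.add (.reg 20) (.lit 1))]) .skip,
    .set 8 (.add (.reg 8) (.lit 1))])]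

/-- Copy the buffer back, and halve the keys. -/
def copyBack : Prog := .block [
  .set 8 (.lit 0),
  .loop (.reg 8) (.sub (.reg 5) (.lit 1)) (.block [
    .set 9 (.rd 9 (.reg 8)),
    .wr 8 (.reg 8) (.reg 9),
    .wr 14 (.reg 9) (.rd 12 (.rd 14 (.reg 9))),
    .set 8 (.add (.reg 8) (.lit 1))])]

/-- Initialize the keys. -/
def initKeys : Prog := .block [
  .set 8 (.lit 0),
  .loop (.reg 8) (.sub (.reg 5) (.lit 1)) (.block [
    .set 9 (.rd 8 (.reg 8)),
    .wr 14 (.reg 9) (.reg 9),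
    .set 8 (.add (.reg 8) (.lit 1))])]

/-- Radix sort of the list of marked positions; `n` is appended. -/
def sort : Prog := .block [
  initKeys,
  .set 13 (.reg 4),
  .loop (.lit 1) (.reg 13) (.block [
    .set 20 (.lit 0),
    collect (.rd 13 (.rd 14 (.reg 9))) (.lit 0),
    collect (.lit 1) (.rd 13 (.rd 14 (.reg 9))),
    copyBack,
    .set 13 (.rd 12 (.reg 13))]),
  .wr 8 (.reg 5) (.reg 0)]

section Sorting
variable {n : ℕ} {f : Finset (Fin n) → ℤ} {EO : ℕ} {xs ys : List ℕ} {s s' : State}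

theorem initKeys_runs (hk : s.reg 5 = xs.length) (hX : Holds Nat.cast (s.get 8) xs) :
    Runs f EO initKeys s fun s' t => t ≤ (xs.length + 1) * 100 ∧ Frame [14] [8, 9] s s' ∧
      ∀ x ∈ xs, s'.get 14 x = (x : ℤ) := by
  simp only [initKeys, runs_block_cons, runs_block_nil, runs_set]
  refine (Runs.for (fun j s' => s'.reg 8 = j ∧ Frame [14] [8, 9] s s' ∧
    ∀ x ∈ xs.take j, s'.get 14 x = (x : ℤ)) xs.length 90 ?_ ?_ ?_).mono ?_
  · exact ⟨by simp, (Frame.refl _ _ _).setReg, by simp⟩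
  · rintro j s1 hj ⟨h8, hF, h14⟩
    have h5 : s1.reg 5 = xs.length := (hF.reg 5 (by simp)).trans hk
    have hx : s1.get 8 j = (xs[j] : ℕ) := by rw [hF.col 8 (by simp)]; exact hX j hj
    refine ⟨by simp [h8, h5]; omega, ?_⟩
    simp only [runs_block_cons, runs_block_nil, runs_set, runs_wr]
    refine ⟨by simp, by simp [h8], hF.setReg.put.setReg, ?_⟩
    intro x hxm
    have ht : xs.take (j + 1) = xs.take j ++ [xs[j]] := by simp
    rw [ht, List.mem_append, List.mem_singleton] at hxm
    by_cases hxx : x = xs[j]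
    · simp [h8, hx, hxx]
    · have := h14 x (hxm.resolve_right hxx)
      simp [h8, hx, hxx, this]
  · rintro s1 ⟨h8, hF, -⟩
    have h5 : s1.reg 5 = xs.length := (hF.reg 5 (by simp)).trans hk
    simp [h8, h5]
  · rintro s1 t ⟨ht, h8, hF, h14⟩
    rw [List.take_length] at h14
    exact ⟨by simp at ht ⊢; omega, hF, h14⟩

theorem collect_runs {a b : Exp} {pr : ℕ → Bool} (hk : s.reg 5 = xs.length)
    (hX : Holds Nat.cast (s.get 8) xs) (h20 : s.reg 20 = ys.length)
    (hY : Holds Nat.cast (s.get 9) ys)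
    (hab : ∀ s', Frame [9] [8, 9, 20] s s' → ∀ x ∈ xs, s'.reg 9 = (x : ℕ) →
      (a.val s' ≤ b.val s' ↔ pr x = true)) (hcost : a.cost + b.cost ≤ 600) :
    Runs f EO (collect a b) s fun s' t => t ≤ (xs.length + 1) * 800 ∧
      Frame [9] [8, 9, 20] s s' ∧ s'.reg 20 = (ys ++ xs.filter pr).length ∧
      Holds Nat.cast (s'.get 9) (ys ++ xs.filter pr) := by
  simp only [collect, runs_block_cons, runs_block_nil, runs_set]
  refine (Runs.for (fun j s' => s'.reg 8 = j ∧ Frame [9] [8, 9, 20] s s' ∧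
    s'.reg 20 = (ys ++ (xs.take j).filter pr).length ∧
    Holds Nat.cast (s'.get 9) (ys ++ (xs.take j).filter pr)) xs.length 790 ?_ ?_ ?_).mono ?_
  · exact ⟨by simp, (Frame.refl _ _ _).setReg, by simpa using h20, by simpa using hY⟩
  · rintro j s1 hj ⟨h8, hF, h20, hY⟩
    have h5 : s1.reg 5 = xs.length := (hF.reg 5 (by simp)).trans hk
    have hx : s1.get 8 j = (xs[j] : ℕ) := by rw [hF.col 8 (by simp)]; exact hX j hj
    have hc := hab (s1.setReg 9 (xs[j] : ℕ)) hF.setReg xs[j] (List.getElem_mem hj) (by simp)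
    have ht : (xs.take (j + 1)).filter pr = (xs.take j).filter pr ++ [xs[j]].filter pr := by
      rw [← List.filter_append]; simp
    refine ⟨by simp [h8, h5]; omega, ?_⟩
    simp only [runs_block_cons, runs_block_nil, runs_set, runs_wr, runs_ite, runs_skip, val_rd,
      val_reg, h8, hx, hc]
    cases hpr : pr xs[j] with
    | true =>
      have ht' : ys ++ (xs.take (j + 1)).filter pr = (ys ++ (xs.take j).filter pr) ++ [xs[j]] := by
        rw [ht, List.append_assoc]; simp [hpr]
      rw [if_pos rfl, ht']
      refine ⟨by simp; omega, by simp [h8], hF.setReg.put.setReg.setReg, ?_, ?_⟩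
      · simp [h20]; ring
      · simpa using hY.append xs[j] h20 rfl
    | false =>
      have ht' : ys ++ (xs.take (j + 1)).filter pr = (ys ++ (xs.take j).filter pr) := by
        rw [ht]; simp [hpr]
      rw [if_neg (by simp), ht']
      exact ⟨by simp; omega, by simp [h8], hF.setReg.setReg, by simpa using h20, by simpa using hY⟩
  · rintro s1 ⟨h8, hF, -⟩
    have h5 : s1.reg 5 = xs.length := (hF.reg 5 (by simp)).trans hk
    simp [h8, h5]
  · rintro s1 t ⟨ht, h8, hF, h20, hY⟩
    rw [List.take_length] at h20 hY
    exact ⟨by simp at ht ⊢; omega, hF, h20, hY⟩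

/-- The keys are indexed by the listed positions themselves; as these are distinct, each key is
halved exactly once. -/
theorem copyBack_runs {κ : ℕ → ℕ} (hk : s.reg 5 = xs.length)
    (hX : Holds Nat.cast (s.get 9) xs) (hnd : xs.Nodup)
    (hkey : ∀ x ∈ xs, s.get 14 x = (κ x : ℕ)) (hκ : ∀ x ∈ xs, κ x ≤ n)
    (hhalf : ∀ q : ℕ, q ≤ n → s.get 12 q = (q / 2 : ℕ)) :
    Runs f EO copyBack s fun s' t => t ≤ (xs.length + 1) * 900 ∧
      Frame [8, 14] [8, 9] s s' ∧ Holds Nat.cast (s'.get 8) xs ∧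
      ∀ x ∈ xs, s'.get 14 x = (κ x / 2 : ℕ) := by
  simp only [copyBack, runs_block_cons, runs_block_nil, runs_set]
  refine (Runs.for (fun j s' => s'.reg 8 = j ∧ Frame [8, 14] [8, 9] s s' ∧
    Holds Nat.cast (s'.get 8) (xs.take j) ∧
    ∀ x ∈ xs, s'.get 14 x = if x ∈ xs.take j then ((κ x / 2 : ℕ) : ℤ) else (κ x : ℤ))
      xs.length 890 ?_ ?_ ?_).mono ?_
  · exact ⟨by simp, (Frame.refl _ _ _).setReg, fun i hi => absurd hi (by simp), by simpa using hkey⟩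
  · rintro j s1 hj ⟨h8, hF, hX', h14⟩
    have h5 : s1.reg 5 = xs.length := (hF.reg 5 (by simp)).trans hk
    have hx : s1.get 9 j = (xs[j] : ℕ) := by rw [hF.col 9 (by simp)]; exact hX j hj
    have ht : xs.take (j + 1) = xs.take j ++ [xs[j]] := by simp
    have hnot : xs[j] ∉ xs.take j := by
      intro hmem
      obtain ⟨i, hi, hie⟩ := List.mem_take_iff_getElem.1 hmem
      have := (List.Nodup.getElem_inj_iff hnd).1 hie
      omega
    have hkx := h14 xs[j] (List.getElem_mem hj)
    rw [if_neg hnot] at hkx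
    have hhx : s1.get 12 (κ xs[j] : ℕ) = (κ xs[j] / 2 : ℕ) := by
      rw [hF.col 12 (by simp)]; exact hhalf _ (hκ _ (List.getElem_mem hj))
    refine ⟨by simp [h8, h5]; omega, ?_⟩
    simp only [runs_block_cons, runs_block_nil, runs_set, runs_wr]
    refine ⟨by simp, by simp [h8], hF.setReg.put.put.setReg, ?_, ?_⟩
    · have := hX'.append xs[j] (i := j) (w := xs[j]) (by simp; omega) rfl
      rw [← ht] at this
      simpa [h8, hx] using this
    · intro x hxm
      by_cases hxx : x = xs[j]
      · subst hxx
        rw [if_pos (by rw [ht]; exact List.mem_append_right _ (List.mem_singleton_self _)), ← hhx]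
        simp [h8, hx, hkx]
      · have h1 := h14 x hxm
        have h2 : x ∈ xs.take (j + 1) ↔ x ∈ xs.take j := by
          rw [ht, List.mem_append, List.mem_singleton, or_iff_left hxx]
        simp only [h2, ← h1]
        simp [h8, hx, hxx]
  · rintro s1 ⟨h8, hF, -⟩
    have h5 : s1.reg 5 = xs.length := (hF.reg 5 (by simp)).trans hk
    simp [h8, h5]
  · rintro s1 t ⟨ht, h8, hF, hX', h14⟩
    rw [List.take_length] at hX' h14
    refine ⟨by simp at ht ⊢; omega, hF, hX', fun x hx => ?_⟩
    rw [h14 x hx, if_pos hx]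

/-- Distribution by one more bit keeps a list sorted. -/
theorem pairwise_filter_bit {j : ℕ} (h : xs.Pairwise fun a b => a % 2 ^ j ≤ b % 2 ^ j) :
    (xs.filter (fun x => x / 2 ^ j % 2 = 0) ++ xs.filter (fun x => x / 2 ^ j % 2 = 1)).Pairwise
      fun a b => a % 2 ^ (j + 1) ≤ b % 2 ^ (j + 1) := by
  rw [List.pairwise_append]
  refine ⟨?_, ?_, ?_⟩
  · rw [List.pairwise_filter]
    refine h.imp fun {a b} hab ha hb => ?_
    rw [decide_eq_true_eq] at ha hb
    rw [Nat.mod_pow_succ, Nat.mod_pow_succ, ha, hb]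
    omega
  · rw [List.pairwise_filter]
    refine h.imp fun {a b} hab ha hb => ?_
    rw [decide_eq_true_eq] at ha hb
    rw [Nat.mod_pow_succ, Nat.mod_pow_succ, ha, hb]
    omega
  · intro a ha b hb
    rw [List.mem_filter, decide_eq_true_eq] at ha hb
    rw [Nat.mod_pow_succ, Nat.mod_pow_succ, ha.2, hb.2]
    have := Nat.mod_lt a (show 0 < 2 ^ j by positivity)
    omega

theorem perm_filter_bit (xs : List ℕ) (j : ℕ) :
    (xs.filter (fun x => x / 2 ^ j % 2 = 0) ++ xs.filter (fun x => x / 2 ^ j % 2 = 1)).Perm xs := by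
  have h := List.filter_append_perm (fun x => decide (x / 2 ^ j % 2 = 0)) xs
  have h2 : xs.filter (fun x => decide (x / 2 ^ j % 2 = 1)) =
      xs.filter (fun x => !decide (x / 2 ^ j % 2 = 0)) := by
    refine List.filter_congr fun x _ => ?_
    rcases Nat.mod_two_eq_zero_or_one (x / 2 ^ j) with h | h <;> simp [h]
  rw [h2]
  exact h

/-- Radix sort from the lowest bit on: after `j` passes the list is sorted modulo `2 ^ j` and the
key of `x` is `x / 2 ^ j`. Bits and halves come from tables, since the machine has no division. As
`n < 2 ^ (L + 1)`, `L + 1` passes suffice. -/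
theorem sort_runs (hn : 1 ≤ n) (h0 : s.reg 0 = n) (h4 : s.reg 4 = (2 ^ Nat.log 2 n : ℕ))
    (hhalf : ∀ q : ℕ, q ≤ n → s.get 12 q = (q / 2 : ℕ))
    (hpar : ∀ q : ℕ, q ≤ n → s.get 13 q = (q % 2 : ℕ)) (hX : Marked n xs s) :
    Runs f EO sort s fun s' t => t ≤ (Nat.log 2 n + 2) * ((xs.length + 1) * 2600) ∧
      Frame [8, 9, 14] [8, 9, 13, 20] s s' ∧
      ∃ ys, ys.Perm xs ∧ ys.Pairwise (· < ·) ∧ Holds Nat.cast (s'.get 8) (ys ++ [n]) := by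
  set L := Nat.log 2 n with hLdef
  have hLn : 2 ^ L ≤ n := Nat.pow_log_le_self 2 (by omega)
  have hnL : n < 2 ^ (L + 1) := Nat.lt_pow_succ_log_self (by norm_num) n
  simp only [sort, runs_block_cons, runs_block_nil]
  refine (initKeys_runs hX.len hX.list).mono ?_
  rintro s1 t1 ⟨ht1, hF1, hkey1⟩
  simp only [runs_set]
  refine (Runs.for (fun j s' => Frame [8, 9, 14] [8, 9, 13, 20] s s' ∧
      s'.reg 13 = (2 ^ (L + 1 - j) / 2 : ℕ) ∧ ∃ ys, ys.Perm xs ∧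
      (ys.Pairwise fun a b => a % 2 ^ j ≤ b % 2 ^ j) ∧ Holds Nat.cast (s'.get 8) ys ∧
      ∀ x ∈ xs, s'.get 14 x = (x / 2 ^ j : ℕ)) (L + 1) ((xs.length + 1) * 2550) ?_ ?_ ?_).mono ?_
  · refine ⟨(hF1.mono (C' := [8, 9, 14]) (R' := [8, 9, 13, 20])).setReg, ?_, xs, List.Perm.refl _, ?_,
      ?_, ?_⟩
    · have : 2 ^ (L + 1) / 2 = 2 ^ L := by rw [pow_succ]; omega
      simp [hF1.reg 4 (by simp), h4, this]
    · exact List.pairwise_of_forall (by simp [Nat.mod_one])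
    · simpa [hF1.col 8 (by simp)] using hX.list
    · simpa using hkey1
  · rintro j s2 hj ⟨hF, h13, ys, hperm, hsort, hY, hkey⟩
    obtain ⟨m, hm⟩ : ∃ m, L = m + j := ⟨L - j, by omega⟩
    have e1 : L + 1 - j = m + 1 := by omega
    have e2 : L + 1 - (j + 1) = m := by omega
    have e3 : 2 ^ (m + 1) / 2 = 2 ^ m := by rw [pow_succ]; omega
    rw [e1, e3] at h13
    rw [e2]
    have hmn : 2 ^ m ≤ n := (Nat.pow_le_pow_right (by norm_num) (by omega)).trans hLn
    have hpos : 1 ≤ 2 ^ m := Nat.one_le_two_pow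
    refine ⟨by simp only [val_lit, val_reg, h13]; exact_mod_cast hpos, ?_⟩
    have hlen : ys.length = xs.length := hperm.length_eq
    have hkeyle : ∀ x ∈ xs, x / 2 ^ j ≤ n := fun x hx =>
      (Nat.div_le_self _ _).trans (hX.lt x hx).le
    have hpar' : ∀ s', Frame [9] [8, 9, 20] s2 s' → ∀ x ∈ ys, s'.reg 9 = (x : ℕ) →
        s'.get 13 (s'.get 14 (s'.reg 9)) = (x / 2 ^ j % 2 : ℕ) := by
      intro s' hF' x hx h9
      have hx' := hperm.mem_iff.1 hx
      rw [h9, hF'.col 14 (by simp), hkey x hx', hF'.col 13 (by simp), hF.col 13 (by simp),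
        hpar _ (hkeyle x hx')]
    simp only [runs_block_cons, runs_block_nil, runs_set]
    have hF2 : Frame [] [20] s2 (s2.setReg 20 ((Exp.lit 0).val s2)) := (Frame.refl _ _ _).setReg
    refine (collect_runs (xs := ys) (ys := []) (pr := fun x => x / 2 ^ j % 2 = 0) ?_ ?_ ?_ ?_ ?_ ?_).mono ?_
    · rw [hF2.reg 5 (by simp), hF.reg 5 (by simp), hX.len, hlen]
    · simpa using hY
    · simp
    · intro i hi; simp at hi
    · intro s' hF' x hx h9
      simp only [val_rd, val_reg, val_lit, decide_eq_true_eq,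
        hpar' s' (hF2.mono.trans hF') x hx h9]
      omega
    · simp
    rintro s3 t3 ⟨ht3, hF3, h203, hY3⟩
    have hF23 : Frame [9] [8, 9, 20] s2 s3 := hF2.mono.trans hF3
    refine (collect_runs (xs := ys) (ys := _) (pr := fun x => x / 2 ^ j % 2 = 1) ?_ ?_ h203 hY3 ?_ ?_).mono ?_
    · rw [hF23.reg 5 (by simp), hF.reg 5 (by simp), hX.len, hlen]
    · rw [hF23.col 8 (by simp)]; exact hY
    · intro s' hF' x hx h9
      simp only [val_rd, val_reg, val_lit, decide_eq_true_eq,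
        hpar' s' (hF23.trans hF') x hx h9]
      omega
    · simp
    rintro s4 t4 ⟨ht4, hF4, -, hY4⟩
    rw [List.nil_append] at hY4
    have hF24 : Frame [9] [8, 9, 20] s2 s4 := hF23.trans hF4
    set ys' := ys.filter (fun x => x / 2 ^ j % 2 = 0) ++ ys.filter (fun x => x / 2 ^ j % 2 = 1)
      with hys'
    have hperm' : ys'.Perm ys := perm_filter_bit ys j
    have hlen' : ys'.length = xs.length := hperm'.length_eq.trans hlen
    have hperm2 : ys'.Perm xs := hperm'.trans hperm
    refine (copyBack_runs (n := n) (xs := ys') (κ := fun x => x / 2 ^ j) ?_ hY4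
      (hperm2.nodup_iff.2 hX.nodup) ?_ ?_ ?_).mono ?_
    · rw [hF24.reg 5 (by simp), hF.reg 5 (by simp), hX.len, hlen']
    · intro x hx
      rw [hF24.col 14 (by simp)]
      exact hkey x (hperm2.mem_iff.1 hx)
    · exact fun x hx => hkeyle x (hperm2.mem_iff.1 hx)
    · rw [hF24.col 12 (by simp), hF.col 12 (by simp)]; exact hhalf
    rintro s5 t5 ⟨ht5, hF5, hY5, hkey5⟩
    have hF25 : Frame [8, 9, 14] [8, 9, 13, 20] s2 s5 :=
      (hF24.mono (C' := [8, 9, 14]) (R' := [8, 9, 13, 20])).trans hF5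
    refine ⟨?_, (hF.trans hF25).setReg, ?_, ys', hperm2, pairwise_filter_bit hsort,
      by simpa using hY5, ?_⟩
    · rw [hlen] at ht3 ht4
      rw [hlen'] at ht5
      simp
      omega
    · have h1 : s5.reg 13 = (2 ^ m : ℕ) := by
        rw [hF5.reg 13 (by simp), hF24.reg 13 (by simp), h13]
      have h2 : s5.get 12 (2 ^ m : ℕ) = (2 ^ m / 2 : ℕ) := by
        rw [hF25.col 12 (by simp), hF.col 12 (by simp)]; exact hhalf _ hmn
      simp only [val_rd, val_reg, reg_setReg, if_true]
      rw [h1, h2]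
    · intro x hx
      rw [get_setReg, hkey5 x (hperm2.mem_iff.2 hx), Nat.div_div_eq_div_mul, pow_succ]
  · rintro s2 ⟨-, h13, -⟩
    simp [h13]
  · rintro s2 t2 ⟨ht2, hF, -, ys, hperm, hsort, hY, -⟩
    simp only [runs_wr]
    have h5 : s2.reg 5 = ys.length := by
      rw [hF.reg 5 (by simp), hX.len, hperm.length_eq]
    have h0' : s2.reg 0 = n := (hF.reg 0 (by simp)).trans h0
    refine ⟨?_, hF.put, ys, hperm, ?_, ?_⟩
    · simp at ht2 ⊢
      nlinarith
    · have hnd := hperm.nodup_iff.2 hX.nodup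
      have h1 := hsort.and hnd
      refine List.Pairwise.imp_of_mem ?_ h1
      intro a b ha hb hab
      have ha' := hX.lt a (hperm.mem_iff.1 ha)
      have hb' := hX.lt b (hperm.mem_iff.1 hb)
      rw [Nat.mod_eq_of_lt (by omega), Nat.mod_eq_of_lt (by omega)] at hab
      omega
    · simpa using hY.append n (i := s2.reg 5) (w := s2.reg 0) h5 h0'

end Sorting
end SFM

namespace SFM

/-! ### Initialization, clean-up and output -/

/-- Remove the bridges from the second list, and all marks. -/
def restore : Prog := .block [
  .set 8 (.lit 0),
  .loop (.reg 8) (.sub (.reg 5) (.lit 1)) (.block [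
    .set 9 (.rd 8 (.reg 8)),
    .wr 3 (.sub (.reg 9) (.lit 1)) (.cell 2 (.reg 9)),
    .wr 7 (.reg 9) (.lit 0),
    .set 8 (.add (.reg 8) (.lit 1))])]

/-- Compute the number of levels, the number of iterations and the initial step width. -/
def initRegs : Prog := .block [
  .set 2 (.lit 0),
  .set 10 (.reg 1),
  .loop (.lit 1) (.reg 10) (.block [
    .set 2 (.add (.reg 2) (Exp.dbl (Exp.dbl (Exp.dbl (.reg 1))))),
    .set 10 (.sub (.reg 10) (.lit 1))]),
  .set 3 (.lit 1),
  .set 10 (.reg 0),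
  .loop (.lit 1) (.reg 10) (.block [
    .set 3 (.add (.reg 3) (.reg 2)),
    .set 10 (.sub (.reg 10) (.lit 1))]),
  .set 4 (.lit 1),
  .loop (.add (.reg 4) (.reg 4)) (.reg 0) (.block [.set 4 (.add (.reg 4) (.reg 4))]),
  .set 5 (.reg 0),
  .set 6 (.add (.reg 1) (.lit 1))]

/-- Set up the arrays. -/
def initArrays : Prog := .block [
  .wr 13 (.lit 1) (.lit 1),
  .wr 3 (.lit (-1)) (.cell 2 (.lit 0)),
  .set 8 (.lit 0),
  .loop (.reg 8) (.add (.reg 0) (.reg 0)) (.block [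
    .wr 0 (.reg 8) (.reg 8),
    .wr 1 (.reg 8) (.cell 0 (.add (.reg 8) (.lit 1))),
    .wr 2 (.reg 8) (.reg 8),
    .wr 3 (.reg 8) (.cell 2 (.add (.reg 8) (.lit 1))),
    .wr 4 (.reg 8) (.reg 8),
    .wr 8 (.reg 8) (.reg 8),
    .wr 12 (.add (.reg 8) (.lit 2)) (.add (.rd 12 (.reg 8)) (.lit 1)),
    .wr 13 (.add (.reg 8) (.lit 2)) (.rd 13 (.reg 8)),
    .set 8 (.add (.reg 8) (.lit 1))])]

/-- Copy the characteristic vector of the saved set to the output cells. -/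
def output : Prog := .block [
  .set 8 (.lit 0),
  .loop (.reg 8) (.sub (.reg 0) (.lit 1)) (.block [
    .store (.reg 8) (.rd 15 (.reg 8)),
    .set 8 (.add (.reg 8) (.lit 1))])]

section Init
variable {n : ℕ} {f : Finset (Fin n) → ℤ} {EO : ℕ} {xs : List ℕ} {s : State}

theorem restore_runs (hk : s.reg 5 = xs.length) (hX : Holds Nat.cast (s.get 8) xs)
    (hB : ∀ q : ℕ, q ≤ 2 * n → q ∉ xs → s.get 3 ((q : ℤ) - 1) = addr 2 q)
    (hM : ∀ p : ℕ, p < n → p ∉ xs → s.get 7 p = 0) :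
    Runs f EO restore s fun s' t => t ≤ (xs.length + 1) * 200 ∧ Frame [3, 7] [8, 9] s s' ∧
      (∀ q : ℕ, q ≤ 2 * n → s'.get 3 ((q : ℤ) - 1) = addr 2 q) ∧
      ∀ p : ℕ, p < n → s'.get 7 p = 0 := by
  simp only [restore, runs_block_cons, runs_block_nil, runs_set]
  refine (Runs.for (fun j s' => s'.reg 8 = j ∧ Frame [3, 7] [8, 9] s s' ∧
    (∀ q : ℕ, q ≤ 2 * n → q ∉ xs.drop j → s'.get 3 ((q : ℤ) - 1) = addr 2 q) ∧
    ∀ p : ℕ, p < n → p ∉ xs.drop j → s'.get 7 p = 0) xs.length 190 ?_ ?_ ?_).mono ?_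
  · exact ⟨by simp, (Frame.refl _ _ _).setReg, by simpa using hB, by simpa using hM⟩
  · rintro j s1 hj ⟨h8, hF, h3, h7⟩
    have h5 : s1.reg 5 = xs.length := (hF.reg 5 (by simp)).trans hk
    have hx : s1.get 8 j = (xs[j] : ℕ) := by rw [hF.col 8 (by simp)]; exact hX j hj
    have hd : xs.drop j = xs[j] :: xs.drop (j + 1) := List.drop_eq_getElem_cons hj
    refine ⟨by simp [h8, h5]; omega, ?_⟩
    simp only [runs_block_cons, runs_block_nil, runs_set, runs_wr]
    refine ⟨by simp, by simp [h8], hF.setReg.put.put.setReg, ?_, ?_⟩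
    · intro q hq hqd
      by_cases hqx : q = xs[j]
      · simp [h8, hx, hqx]
      · have := h3 q hq (by rw [hd, List.mem_cons, not_or]; exact ⟨hqx, hqd⟩)
        simp [h8, hx, hqx, this]
    · intro q hq hqd
      by_cases hqx : q = xs[j]
      · simp [h8, hx, hqx]
      · have := h7 q hq (by rw [hd, List.mem_cons, not_or]; exact ⟨hqx, hqd⟩)
        simp [h8, hx, hqx, this]
  · rintro s1 ⟨h8, hF, -⟩
    have h5 : s1.reg 5 = xs.length := (hF.reg 5 (by simp)).trans hk
    simp [h8, h5]
  · rintro s1 t ⟨ht, h8, hF, h3, h7⟩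
    rw [List.drop_length] at h3 h7
    exact ⟨by simp at ht ⊢; omega, hF, fun q hq => h3 q hq (by simp), fun p hp => h7 p hp (by simp)⟩

/-- The products are formed by repeated addition: `M` times `8 * M`, then `n` times the result. The
best value starts at `M + 1`, which no set attains. -/
theorem initRegs_runs {M : ℕ} (hn : 1 ≤ n) (h0 : s.reg 0 = n) (h1 : s.reg 1 = M) :
    Runs f EO initRegs s fun s' t => t ≤ 100 * (n + M) + 100 ∧ Frame [] [2, 3, 4, 5, 6, 10] s s' ∧
      s'.reg 2 = 8 * M ^ 2 ∧ s'.reg 3 = n * (8 * M ^ 2) + 1 ∧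
      s'.reg 4 = (2 ^ Nat.log 2 n : ℕ) ∧ s'.reg 5 = n ∧ s'.reg 6 = M + 1 := by
  simp only [initRegs, runs_block_cons, runs_block_nil, runs_set]
  refine (Runs.for (fun j s' => Frame [] [2, 10] s s' ∧ s'.reg 2 = j * (8 * M) ∧
    s'.reg 10 = (M : ℤ) - j) M 50 ?_ ?_ ?_).mono ?_
  · exact ⟨(Frame.refl _ _ _).setReg.setReg, by simp, by simp [h1]⟩
  · rintro j s1 hj ⟨hF, h2, h10⟩
    have h1' : s1.reg 1 = M := (hF.reg 1 (by simp)).trans h1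
    refine ⟨by simp [h10]; omega, ?_⟩
    simp only [runs_block_cons, runs_block_nil, runs_set]
    refine ⟨by simp [Exp.dbl], hF.setReg.setReg, ?_, ?_⟩
    · simp [Exp.dbl, h2, h1']; ring
    · simp [h10]; ring
  · rintro s1 ⟨-, -, h10⟩
    simp [h10]
  rintro s1 t1 ⟨ht1, hF1, h2, -⟩
  refine (Runs.for (fun j s' => Frame [] [3, 10] s1 s' ∧ s'.reg 3 = j * (8 * M ^ 2) + 1 ∧
    s'.reg 10 = (n : ℤ) - j) n 50 ?_ ?_ ?_).mono ?_
  · exact ⟨(Frame.refl _ _ _).setReg.setReg, by simp, by simp [h0, hF1.reg 0]⟩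
  · rintro j s2 hj ⟨hF, h3, h10⟩
    have h2' : s2.reg 2 = M * (8 * M) := (hF.reg 2 (by simp)).trans h2
    refine ⟨by simp [h10]; omega, ?_⟩
    simp only [runs_block_cons, runs_block_nil, runs_set]
    refine ⟨by simp, hF.setReg.setReg, ?_, ?_⟩
    · simp [h3, h2']; ring
    · simp [h10]; ring
  · rintro s2 ⟨-, -, h10⟩
    simp [h10]
  rintro s2 t2 ⟨ht2, hF2, h3, -⟩
  have h0' : s2.reg 0 = n := by rw [hF2.reg 0 (by simp), hF1.reg 0 (by simp), h0]
  have h1' : s2.reg 1 = M := by rw [hF2.reg 1 (by simp), hF1.reg 1 (by simp), h1]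
  refine (Runs.for (fun j s' => Frame [] [4] s2 s' ∧ s'.reg 4 = (2 ^ j : ℕ))
    (Nat.log 2 n) 20 ?_ ?_ ?_).mono ?_
  · exact ⟨(Frame.refl _ _ _).setReg, by simp⟩
  · rintro j s3 hj ⟨hF, h4⟩
    have h0'' : s3.reg 0 = n := (hF.reg 0 (by simp)).trans h0'
    have hp : 2 ^ (j + 1) ≤ n :=
      (Nat.pow_le_pow_right (by norm_num) hj).trans (Nat.pow_log_le_self 2 (by omega))
    rw [pow_succ] at hp
    refine ⟨by simp only [val_add, val_reg, h4, h0'']; omega, ?_⟩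
    simp only [runs_block_cons, runs_block_nil, runs_set]
    refine ⟨by simp, hF.setReg, ?_⟩
    simp [h4, pow_succ]; ring
  · rintro s3 ⟨hF, h4⟩
    have h0'' : s3.reg 0 = n := (hF.reg 0 (by simp)).trans h0'
    have hp := Nat.lt_pow_succ_log_self (b := 2) (by norm_num) n
    rw [Nat.succ_eq_add_one, pow_succ] at hp
    simp only [val_add, val_reg, h4, h0'']
    omega
  rintro s3 t3 ⟨ht3, hF3, h4⟩
  have hlog : Nat.log 2 n ≤ n := Nat.log_le_self 2 n
  refine ⟨?_, ?_, ?_, ?_, ?_, ?_, ?_⟩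
  · simp at ht1 ht2 ht3 ⊢; omega
  · exact (((hF1.mono (C' := []) (R' := [2, 3, 4, 5, 6, 10])).trans hF2).trans hF3).setReg.setReg
  · simp [hF3.reg 2, hF2.reg 2, h2]; ring
  · simp [hF3.reg 3, h3]
  · simp [h4]
  · simp [hF3.reg 0, h0']
  · simp [hF3.reg 1, h1']

/-- The tables of halves and parities are filled by recursion from `q` to `q + 2`. The identity in
column 8 serves as the list of all positions, marked for the first iteration, with the sentinel `n`.
-/
theorem initArrays_runs (h0 : s.reg 0 = n) (hz : s.get 12 0 = 0) (hz' : s.get 12 1 = 0)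
    (hz13 : s.get 13 0 = 0) :
    Runs f EO initArrays s fun s' t => t ≤ 5000 * (n + 1) ∧
      Frame [0, 1, 2, 3, 4, 8, 12, 13] [8] s s' ∧
      (∀ p : ℕ, p ≤ 2 * n → s'.get 0 p = p ∧ s'.get 1 p = addr 0 (p + 1) ∧ s'.get 2 p = p ∧
        s'.get 4 p = p ∧ s'.get 8 p = p) ∧
      (∀ q : ℕ, q ≤ 2 * n → s'.get 3 ((q : ℤ) - 1) = addr 2 q) ∧
      (∀ q : ℕ, q ≤ n → s'.get 12 q = (q / 2 : ℕ)) ∧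
      (∀ q : ℕ, q ≤ n → s'.get 13 q = (q % 2 : ℕ)) := by
  simp only [initArrays, runs_block_cons, runs_block_nil, runs_set, runs_wr]
  refine (Runs.for (fun j s' => s'.reg 8 = (j : ℕ) ∧
      Frame [0, 1, 2, 3, 4, 8, 12, 13] [8] s s' ∧
      (∀ p : ℕ, p < j → s'.get 0 p = p ∧ s'.get 1 p = addr 0 (p + 1) ∧ s'.get 2 p = p ∧
        s'.get 4 p = p ∧ s'.get 8 p = p) ∧
      (∀ q : ℕ, q < j + 1 → s'.get 3 ((q : ℤ) - 1) = addr 2 q) ∧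
      (∀ q : ℕ, q < j + 2 → s'.get 12 q = (q / 2 : ℕ) ∧ s'.get 13 q = (q % 2 : ℕ)))
      (2 * n + 1) 1200 ?_ ?_ ?_).mono ?_
  · refine ⟨by simp, (Frame.refl _ _ _).put.put.setReg, by simp, ?_, ?_⟩
    · intro q hq
      obtain rfl : q = 0 := by omega
      simp
    · intro q hq
      rcases (show q = 0 ∨ q = 1 by omega) with rfl | rfl
      · simp [hz, hz13]
      · simp [hz']
  · rintro j s1 hj ⟨h8, hF, hA, h3, h12⟩
    have h0' : s1.reg 0 = n := (hF.reg 0 (by simp)).trans h0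
    refine ⟨by simp only [val_reg, val_add, h8, h0']; omega, ?_⟩
    simp only [runs_block_cons, runs_block_nil, runs_set, runs_wr]
    refine ⟨by simp, by simp [h8], hF.put.put.put.put.put.put.put.put.setReg, ?_, ?_, ?_⟩
    · intro p hp
      by_cases hpj : p = j
      · subst hpj; simp [h8]
      · have := hA p (by omega)
        simp [h8, hpj, this]
    · intro q hq
      by_cases hqj : q = j + 1
      · subst hqj; simp [h8]
      · have := h3 q (by omega)
        have hne : (q : ℤ) - 1 ≠ j := by omega
        simp [h8, hne, this]
    · intro q hq
      have hj2 := h12 j (by omega)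
      by_cases hqj : q = j + 2
      · subst hqj
        simp [h8, hj2]
      · have := h12 q (by omega)
        have hne : (q : ℤ) ≠ j + 2 := by omega
        simp [h8, hne, this]
  · rintro s1 ⟨h8, hF, -⟩
    have h0' : s1.reg 0 = n := (hF.reg 0 (by simp)).trans h0
    simp only [val_reg, val_add, h8, h0']
    omega
  · rintro s1 t ⟨ht, h8, hF, hA, h3, h12⟩
    exact ⟨by simp at ht ⊢; omega, hF, fun p hp => hA p (by omega), fun q hq => h3 q (by omega),
      fun q hq => (h12 q (by omega)).1, fun q hq => (h12 q (by omega)).2⟩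

theorem output_runs {S : Finset (Fin n)} (h0 : s.reg 0 = n)
    (hS : ∀ e : Fin n, s.get 15 (e : ℕ) = if e ∈ S then 1 else 0) :
    Runs f EO output s fun s' t => t ≤ 100 * (n + 1) ∧ s'.Outputs S := by
  simp only [output, runs_block_cons, runs_block_nil, runs_set]
  refine (Runs.for (fun j s' => s'.reg 8 = (j : ℕ) ∧ s'.reg 0 = n ∧
      (∀ e : Fin n, s'.get 15 (e : ℕ) = if e ∈ S then 1 else 0) ∧
      ∀ e : Fin n, (e : ℕ) < j → s'.mem (e : ℕ) = if e ∈ S then 1 else 0) n 90 ?_ ?_ ?_).mono ?_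
  · exact ⟨by simp, by simp [h0], by simpa using hS, by simp⟩
  · rintro j s1 hj ⟨h8, h0', h15, hm⟩
    refine ⟨by simp [h8, h0']; omega, ?_⟩
    simp only [runs_block_cons, runs_block_nil, runs_set, runs_store, val_reg, h8]
    refine ⟨by simp, ?_, ?_, ?_, ?_⟩
    · simp [State.setMem, h8]
    · simp [State.setMem, h0']
    · intro e
      rw [← h15 e]
      -- Writing the output, at nonnegative addresses, does not destroy the saved set.
      have : addr 15 (e : ℕ) ≠ j := by
        simp only [addr, Fin.isValue, Fin.coe_ofNat_eq_mod]
        omega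
      simp [State.get, State.setMem, State.setReg, this]
    · intro e he
      by_cases hej : (e : ℕ) = j
      · have := h15 e
        rw [hej] at this
        simp [State.setMem, State.setReg, hej, h8, this]
      · have := hm e (by omega)
        simp [State.setMem, State.setReg, hej, this]
  · rintro s1 ⟨h8, h0', -⟩
    simp [h8, h0']
  · rintro s1 t ⟨ht, -, -, -, hm⟩
    exact ⟨by simp at ht ⊢; omega, fun e => hm e e.2⟩

end Init
end SFM

namespace SFM

/-! ### The subgradient method -/

/-- One iteration of the subgradient method. -/
def iterate : Prog := .block [linkRest, sweep, restore, moves, sort, .set 3 (.sub (.reg 3) (.lit 1))]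

/-- Submodular function minimization by the projected subgradient method. -/
def minimize : Prog := .block [initRegs, initArrays, .loop (.lit 1) (.reg 3) iterate, output]

/-- The configurations at the start of an iteration. -/
structure Ready {n : ℕ} (f : Finset (Fin n) → ℤ) (M : ℕ) (P : Equiv.Perm (Fin n))
    (z : Fin n → ℤ) (xs : List ℕ) (s : State) : Prop where
  size : s.reg 0 = n
  max : s.reg 2 = 8 * (M : ℤ) ^ 2
  step : s.reg 4 = (2 ^ Nat.log 2 n : ℕ)
  next : ∀ p : ℕ, p < n → s.get 1 p = addr 0 (p + 1)
  next' : ∀ q : ℕ, q ≤ 2 * n → s.get 3 ((q : ℤ) - 1) = addr 2 q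
  half : ∀ q : ℕ, q ≤ n → s.get 12 q = (q / 2 : ℕ)
  parity : ∀ q : ℕ, q ≤ n → s.get 13 q = (q % 2 : ℕ)
  perm : PermArrays P s
  levels : Levels (8 * (M : ℤ) ^ 2) P z s
  sorted : xs.Pairwise (· < ·)
  len : s.reg 5 = xs.length
  list : Holds Nat.cast (s.get 8) (xs ++ [n])
  lt : ∀ x ∈ xs, x < n
  mark : ∀ p : ℕ, p < n → p ∉ xs → s.get 7 p = 0
  mono : RestMono f P xs
  best : Best f M s

section Main
variable {n : ℕ} {f : Finset (Fin n) → ℤ} {EO : ℕ} {P : Equiv.Perm (Fin n)} {xs : List ℕ}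
  {N : ℤ} {z : Fin n → ℤ} {s s' : State}

theorem Holds.left {α : Type*} {v : α → ℤ} {g : ℤ → ℤ} {l l' : List α} (h : Holds v g (l ++ l')) :
    Holds v g l := fun i hi => by
  rw [h i (by simp; omega), List.getElem_append_left hi]

theorem Levels.antitone (h : Levels N P z s) (p q : Fin n) (hpq : p ≤ q) : z (P q) ≤ z (P p) := by
  by_cases h0 : 1 ≤ z (P q)
  · have hN := h.le (P q)
    have h1 := (h.lt_count _ h0 hN q).2 le_rfl
    have hpq' : (p : ℕ) ≤ q := hpq
    exact (h.lt_count _ h0 hN p).1 (by omega)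
  · have := h.nonneg (P p)
    omega

/-- For a nonzero integer `|g| + 1 ≤ 2 * |g|`, and the absolute marginals sum to at most `4 * M`. -/
theorem sum_natAbs_le (hf : IsSubmodular f) {M : ℕ} (hM : ∀ S, |f S| ≤ (M : ℤ))
    {es : List (Fin n)} (hnd : es.Nodup) (hne : ∀ e ∈ es, jump f P (P.symm e) ≠ 0) :
    (es.map fun e => (jump f P (P.symm e)).natAbs + 1).sum ≤ 8 * M := by
  rw [← List.sum_toFinset _ hnd]
  have h1 : ∑ e ∈ es.toFinset, ((jump f P (P.symm e)).natAbs + 1) ≤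
      ∑ e ∈ es.toFinset, 2 * (jump f P (P.symm e)).natAbs := by
    refine Finset.sum_le_sum fun e he => ?_
    have := hne e (List.mem_toFinset.1 he)
    omega
  have h2 : ∑ e ∈ es.toFinset, 2 * (jump f P (P.symm e)).natAbs ≤
      ∑ e : Fin n, 2 * (jump f P (P.symm e)).natAbs :=
    Finset.sum_le_sum_of_subset (Finset.subset_univ _)
  have h3 : ∑ e : Fin n, 2 * (jump f P (P.symm e)).natAbs = 2 * ∑ q : Fin n, (jump f P q).natAbs := by
    rw [← Finset.mul_sum, Equiv.sum_comp P.symm fun q : Fin n => (jump f P q).natAbs]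
  have h4 := sum_abs_jump_le hf hM P
  have h5 : ((∑ q : Fin n, (jump f P q).natAbs : ℕ) : ℤ) = ∑ q : Fin n, |jump f P q| := by
    push_cast
    rfl
  omega

/-- The time is split into a share of the marks inherited from before and a share of order `M`,
since the former are `n` in the first iteration and at most `8 * M` later on. -/
theorem iterate_runs (hf : IsSubmodular f) {M : ℕ} (hM : ∀ S, |f S| ≤ (M : ℤ)) (hn : 1 ≤ n)
    (hM1 : 1 ≤ M) (hEO : 1 ≤ EO) (h : Ready f M P z xs s) :
    Runs f EO iterate s fun s' t => ∃ P' ys,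
      Ready f M P' (fun e => clip (8 * (M : ℤ) ^ 2) (z e - jump f P (P.symm e))) ys s' ∧
      s'.reg 3 = s.reg 3 - 1 ∧ s'.reg 6 ≤ s.reg 6 ∧ (∀ k ≤ n, s'.reg 6 ≤ f (permPrefix P k)) ∧
      ys.length ≤ 8 * M ∧
      t + (s'.reg 6 + M).toNat * (800 * (n + 1)) ≤ (s.reg 6 + M).toNat * (800 * (n + 1)) +
        xs.length * (2000 * ((Nat.log 2 n + 1) * EO)) + 70000 * (M * ((Nat.log 2 n + 1) * EO)) := by
  have hnd : xs.Nodup := h.sorted.imp fun h => h.ne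
  simp only [iterate, runs_block_cons, runs_block_nil]
  refine (linkRest_runs h.size h.len h.list.left h.sorted h.lt h.next').mono ?_
  rintro s1 t1 ⟨ht1, hF1, hn1, he1, ha1⟩
  have hL1 : Lists P xs s1 := by
    refine ⟨hnd, h.lt, ?_, ?_, fun p => ?_, fun i hi => ?_, hn1⟩
    · rw [hF1.col 0 (by simp)]; exact h.perm.entry
    · rw [hF1.col 1 (by simp)]; exact h.next
    · rw [he1 p p.2]; exact h.perm.entry' p
    · rw [ha1 i hi]; exact h.perm.entry ⟨xs[i], h.lt _ (List.getElem_mem hi)⟩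
  refine (sweep_runs hf hM hn hL1 h.mono h.sorted ((hF1.reg 0 (by simp)).trans h.size)
    ((hF1.reg 4 (by simp)).trans h.step) (by rw [hF1.col 12 (by simp)]; exact h.half)
    (by rw [hF1.col 8 (by simp)]; exact h.list) (h.best.frame hF1)).mono ?_
  rintro s2 t2 ⟨hF2, hB2, hmin, hle, ⟨es, hE⟩, ht2⟩
  have hF12 : Frame [2, 3, 10, 11, 15] [6, 7, 8, 9, 11, 13, 14, 15, 16, 17, 18, 19, 20] s s2 :=
    (hF1.mono (C' := [2, 3, 10, 11, 15])
      (R' := [6, 7, 8, 9, 11, 13, 14, 15, 16, 17, 18, 19, 20])).trans hF2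
  refine (restore_runs (n := n) (xs := xs) ((hF12.reg 5 (by simp)).trans h.len)
    (by rw [hF12.col 8 (by simp)]; exact h.list.left) ?_
    (by rw [hF12.col 7 (by simp)]; exact h.mark)).mono ?_
  · intro q hq hqx
    rw [hF2.col 3 (by simp), hn1 q hq, nextFree_of_notMem hqx]
  rintro s3 t3 ⟨ht3, hF3, hn3, hm3⟩
  have hF13 : Frame [2, 3, 7, 10, 11, 15] [6, 7, 8, 9, 11, 13, 14, 15, 16, 17, 18, 19, 20] s s3 :=
    (hF12.mono (C' := [2, 3, 7, 10, 11, 15])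
      (R' := [6, 7, 8, 9, 11, 13, 14, 15, 16, 17, 18, 19, 20])).trans hF3
  have hP3 : PermArrays P s3 := by
    refine ⟨?_, ?_, ?_⟩
    · rw [hF13.col 0 (by simp)]; exact h.perm.entry
    · rw [hF3.col 2 (by simp), hF2.col 2 (by simp)]; exact hL1.entry'
    · rw [hF13.col 4 (by simp)]; exact h.perm.pos
  have hE3 := hE.frame hF3
  refine (moves_runs hE3 ((hF13.reg 2 (by simp)).trans h.max) hP3 (h.levels.frame hF13) hm3).mono ?_
  rintro s4 t4 ⟨ht4, hF4, P', xs', hmv, hmem, hlen⟩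
  have hsum := sum_natAbs_le hf hM hE3.nodup hE3.ne
  have hF14 : Frame [0, 2, 3, 4, 5, 6, 7, 8, 10, 11, 15]
      [5, 6, 7, 8, 9, 10, 11, 12, 13, 14, 15, 16, 17, 18, 19, 20] s s4 :=
    (hF13.mono (C' := [0, 2, 3, 4, 5, 6, 7, 8, 10, 11, 15])
      (R' := [5, 6, 7, 8, 9, 10, 11, 12, 13, 14, 15, 16, 17, 18, 19, 20])).trans hF4
  refine (sort_runs hn ((hF14.reg 0 (by simp)).trans h.size) ((hF14.reg 4 (by simp)).trans h.step)
    (by rw [hF14.col 12 (by simp)]; exact h.half) (by rw [hF14.col 13 (by simp)]; exact h.parity)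
    hmv.marked).mono ?_
  rintro s5 t5 ⟨ht5, hF5, ys, hperm, hsorted, hY⟩
  have hF15 : Frame [0, 2, 3, 4, 5, 6, 7, 8, 9, 10, 11, 14, 15]
      [5, 6, 7, 8, 9, 10, 11, 12, 13, 14, 15, 16, 17, 18, 19, 20] s s5 :=
    (hF14.mono (C' := [0, 2, 3, 4, 5, 6, 7, 8, 9, 10, 11, 14, 15])
      (R' := [5, 6, 7, 8, 9, 10, 11, 12, 13, 14, 15, 16, 17, 18, 19, 20])).trans hF5
  simp only [runs_set]
  have hF6 : Frame [] [3] s5 (s5.setReg 3 ((Exp.sub (.reg 3) (.lit 1)).val s5)) :=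
    (Frame.refl _ _ _).setReg
  set s6 := s5.setReg 3 ((Exp.sub (.reg 3) (.lit 1)).val s5) with hs6
  have hF16 : Frame [0, 2, 3, 4, 5, 6, 7, 8, 9, 10, 11, 14, 15]
      [3, 5, 6, 7, 8, 9, 10, 11, 12, 13, 14, 15, 16, 17, 18, 19, 20] s s6 := hF15.mono.trans hF6
  have hF46 : Frame [8, 9, 14] [3, 8, 9, 13, 20] s4 s6 := hF5.mono.trans hF6
  have h62 : s6.reg 6 = s2.reg 6 := by
    rw [hF46.reg 6 (by simp), hF4.reg 6 (by simp), hF3.reg 6 (by simp)]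
  have hylen : ys.length = xs'.length := hperm.length_eq
  refine ⟨P', ys, ⟨(hF16.reg 0 (by simp)).trans h.size, (hF16.reg 2 (by simp)).trans h.max,
    (hF16.reg 4 (by simp)).trans h.step, ?_, ?_, ?_, ?_, hmv.perm.frame hF46, hmv.levels.frame hF46,
    hsorted, ?_, ?_, ?_, ?_, ?_, ?_⟩, ?_, ?_, ?_, by omega, ?_⟩
  · rw [hF16.col 1 (by simp)]; exact h.next
  · rw [hF46.col 3 (by simp), hF4.col 3 (by simp)]; exact hn3
  · rw [hF16.col 12 (by simp)]; exact h.half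
  · rw [hF16.col 13 (by simp)]; exact h.parity
  · rw [hF46.reg 5 (by simp), hmv.marked.len, hylen]
  · rw [hF6.col 8 (by simp)]; exact hY
  · exact fun x hx => hmv.marked.lt x (hperm.mem_iff.1 hx)
  · intro p hp hpy
    rw [hF46.col 7 (by simp), hmv.marked.mark p hp, if_neg fun hh => hpy (hperm.mem_iff.2 hh)]
  -- An unmarked position kept its element, and its marginal along the old permutation was zero, as
  -- all elements with nonzero marginals had their old positions marked.
  · refine RestMono.of_eq hf (P := P) fun p hp => ⟨hmv.eq p fun hh => hp (hperm.mem_iff.2 hh), ?_⟩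
    by_contra hne
    have := hmem _ (hE3.all p p.2 hne)
    rw [Equiv.symm_apply_apply] at this
    exact hp (hperm.mem_iff.2 this)
  · have hB6 := ((hB2.frame hF3).frame hF4).frame hF46
    exact hB6
  · simp [hs6, hF15.reg 3]
  · rw [h62, ← hF1.reg 6 (by simp)]; exact hle
  · rw [h62]; exact hmin
  · rw [h62]
    rw [hF1.reg 6 (by simp)] at ht2
    simp only [cost_sub, cost_reg, cost_lit]
    set L := Nat.log 2 n
    set E := (L + 1) * EO with hE'
    have hLE : L + 1 ≤ E := Nat.le_mul_of_pos_right _ hEO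
    have hEE : EO ≤ E := Nat.le_mul_of_pos_left _ (by omega)
    have hK : (L + 1) * (300 + 4 * EO) + EO + 900 ≤ 1205 * E := by
      have : (L + 1) * (300 + 4 * EO) = 300 * (L + 1) + 4 * E := by rw [hE']; ring
      omega
    have hME : E ≤ M * E := Nat.le_mul_of_pos_left _ hM1
    have hMM : M ≤ M * E := Nat.le_mul_of_pos_right _ (by omega)
    have hxE : xs.length ≤ xs.length * E := Nat.le_mul_of_pos_right _ (by omega)
    have h1 : (xs.length + 6 * M + 2) * ((L + 1) * (300 + 4 * EO) + EO + 900) ≤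
        (xs.length + 8 * M) * (1205 * E) := Nat.mul_le_mul (by omega) hK
    have h2 : (xs.length + 8 * M) * (1205 * E) = 1205 * (xs.length * E) + 9640 * (M * E) := by ring
    have h3 : (L + 2) * ((xs'.length + 1) * 2600) ≤ (2 * E) * ((9 * M) * 2600) :=
      Nat.mul_le_mul (by omega) (Nat.mul_le_mul_right _ (by omega))
    have h4 : (2 * E) * ((9 * M) * 2600) = 46800 * (M * E) := by ring
    have h5 : xs.length * (2000 * E) = 2000 * (xs.length * E) := by ring
    omega

end Main
end SFM

/-! ### Correctness and total running time -/

namespace SFM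

section Minimize
variable {n : ℕ} {f : Finset (Fin n) → ℤ} {EO M : ℕ} {s : State}

/-- The configuration in which the loop of `minimize` starts. -/
theorem Ready.init (hn : 1 ≤ n) (h0 : s.reg 0 = n) (h2 : s.reg 2 = 8 * (M : ℤ) ^ 2)
    (h4 : s.reg 4 = (2 ^ Nat.log 2 n : ℕ)) (h5 : s.reg 5 = n) (h6 : s.reg 6 = M + 1)
    (hz : ∀ c ∈ [5, 6, 7], s.get c = 0)
    (hA : ∀ p : ℕ, p ≤ 2 * n → s.get 0 p = p ∧ s.get 1 p = addr 0 (p + 1) ∧ s.get 2 p = p ∧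
      s.get 4 p = p ∧ s.get 8 p = p)
    (h3 : ∀ q : ℕ, q ≤ 2 * n → s.get 3 ((q : ℤ) - 1) = addr 2 q)
    (h12 : ∀ q : ℕ, q ≤ n → s.get 12 q = (q / 2 : ℕ))
    (h13 : ∀ q : ℕ, q ≤ n → s.get 13 q = (q % 2 : ℕ)) :
    Ready f M (Equiv.refl _) (fun _ => 0) (List.range n) s where
  size := h0
  max := h2
  step := h4
  next p hp := (hA p (by omega)).2.1
  next' := h3
  half := h12
  parity := h13
  perm := ⟨fun p => (hA p (by omega)).1, fun p => (hA p (by omega)).2.2.1,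
    fun p => (hA p (by omega)).2.2.2.1⟩
  levels := by
    have h5 := hz 5 (by simp)
    have h6 := hz 6 (by simp)
    refine ⟨fun e => by simp [h5], fun _ => le_rfl, fun _ => by positivity, fun l _ _ => by simp [h6],
      fun l _ _ => by simp [h6], fun l hl _ p => ?_⟩
    simp only [h6, Pi.zero_apply]
    omega
  sorted := List.pairwise_lt_range
  len := by simp [h5]
  list i hi := by
    simp only [List.length_append, List.length_range, List.length_singleton] at hi
    simp only [(hA i (by omega)).2.2.2.2, ← List.range_succ, List.getElem_range]
  lt x hx := List.mem_range.1 hx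
  mark p _ _ := by simp [hz 7 (by simp)]
  -- With all positions marked, every reduced prefix is empty and nothing has to be known about `f`.
  mono p hp := by rw [restPrefix_succ_of_mem _ (List.mem_range.2 hp)]
  best := Or.inl h6

/-- The loop of `minimize` reaches the minimal value. -/
theorem loop_runs (hf : IsSubmodular f) (hM : ∀ S, |f S| ≤ (M : ℤ)) (hn : 1 ≤ n) (hM1 : 1 ≤ M)
    (hEO : 1 ≤ EO) {P : Equiv.Perm (Fin n)} {xs : List ℕ}
    (h : Ready f M P (fun _ => 0) xs s) (h3 : s.reg 3 = n * (8 * (M : ℤ) ^ 2) + 1)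
    (S : Finset (Fin n)) :
    Runs f EO (.loop (.lit 1) (.reg 3) iterate) s fun s' t =>
      s'.reg 0 = n ∧ Best f M s' ∧ s'.reg 6 ≤ f S ∧
      t ≤ (s.reg 6 + M).toNat * (800 * (n + 1)) +
        xs.length * (2000 * ((Nat.log 2 n + 1) * EO)) +
        (n * (8 * M ^ 2) + 1) * (90000 * (M * ((Nat.log 2 n + 1) * EO))) + 3 := by
  set E := (Nat.log 2 n + 1) * EO with hE
  have hE1 : 1 ≤ E := Nat.mul_pos (by omega) hEO
  have hME : 1 ≤ M * E := Nat.mul_pos hM1 hE1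
  set N : ℤ := 8 * (M : ℤ) ^ 2 with hN
  have hM0 : (0 : ℤ) < M := by exact_mod_cast hM1
  have hN0 : 0 < N := by positivity
  -- With `r` iterations to go, `n * N + 1 - r` are done; unless the value `f S` has been reached,
  -- each of them has reduced the squared distance by `N`. At `r = 0` the distance would be
  -- negative.
  refine (Runs.loop (fun τ s => ∃ P z xs, ∃ r : ℕ, Ready f M P z xs s ∧ s.reg 3 = r ∧
    (s.reg 6 ≤ f S ∨ sqDist N S z + (n * N + 1 - r) * N ≤ n * N ^ 2) ∧
    τ = (s.reg 6 + M).toNat * (800 * (n + 1)) + xs.length * (2000 * E) + r * (90000 * (M * E)))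
    ⟨P, _, xs, n * (8 * M ^ 2) + 1, h, by rw [h3]; push_cast; ring, Or.inr ?_, rfl⟩ ?_).mono ?_
  · have := sqDist_zero_le (N := N) S
    push_cast
    rw [← hN, sub_self, zero_mul, add_zero]
    exact this
  · rintro τ s ⟨P, z, xs, r, hR, hr, hS, rfl⟩ hg
    simp only [val_lit, val_reg, hr] at hg
    obtain ⟨r, rfl⟩ : ∃ k, r = k + 1 := ⟨r - 1, by omega⟩
    refine (iterate_runs hf hM hn hM1 hEO hR).mono ?_
    rintro s' t ⟨P', ys, hR', hr', hle, hmin, hys, ht⟩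
    refine ⟨_, ?_, P', _, ys, r, hR', by rw [hr', hr]; push_cast; ring, ?_, rfl⟩
    -- The at most `8 * M` new marks need `16000 * (M * E)` in the next iteration; with the `70000 *
    -- (M * E)` of this one and the guard of the loop, `90000 * (M * E)` per iteration is enough.
    · rw [← hE] at ht
      have h1 : ys.length * (2000 * E) ≤ 8 * M * (2000 * E) := Nat.mul_le_mul_right _ hys
      have h2 : 8 * M * (2000 * E) = 16000 * (M * E) := by ring
      have h3 : (r + 1) * (90000 * (M * E)) = r * (90000 * (M * E)) + 90000 * (M * E) := by ring
      simp only [cost_lit, cost_reg]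
      omega
    · by_cases hS' : s'.reg 6 ≤ f S
      · exact Or.inl hS'
      · right
        have hd := hS.resolve_left fun h => hS' (hle.trans h)
        have := sqDist_step hf hM hN hR.levels.antitone hR.levels.nonneg hR.levels.le S
          fun k hk => by have := hmin k hk; omega
        push_cast at hd
        linarith
  · rintro s' t ⟨τ', ht, ⟨P', z, ys, r, hR, hr, hS, -⟩, hg⟩
    simp only [val_lit, val_reg, hr] at hg
    obtain rfl : r = 0 := by omega
    refine ⟨hR.size, hR.best, hS.resolve_right fun hd => ?_, ?_⟩
    · have := sqDist_nonneg N S z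
      push_cast at hd
      linarith
    · simp only [cost_lit, cost_reg] at ht
      omega

/-- `minimize` finds a minimizer, in time linear in `n` up to a logarithm. -/
theorem minimize_runs (hf : IsSubmodular f) (hM : ∀ S, |f S| ≤ (M : ℤ)) (hn : 1 ≤ n)
    (hM1 : 1 ≤ M) (hEO : 1 ≤ EO) :
    Runs f EO minimize (inputState n M) fun s t => ∃ S : Finset (Fin n), s.Outputs S ∧
      (∀ T, f S ≤ f T) ∧ t ≤ 900000 * (n * M ^ 3 * ((Nat.log 2 n + 1) * EO)) := by
  obtain ⟨S, -, hS⟩ := Finset.exists_min_image Finset.univ f Finset.univ_nonempty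
  have hget : ∀ c, (inputState n M).get c = 0 := fun _ => rfl
  have hreg0 : (inputState n M).reg 0 = n := rfl
  simp only [minimize, runs_block_cons, runs_block_nil]
  refine (initRegs_runs hn hreg0 rfl).mono ?_
  rintro s1 t1 ⟨ht1, hF1, h2, h3, h4, h5, h6⟩
  have hget1 : ∀ c, s1.get c = 0 := fun c => (hF1.col c (by simp)).trans (hget c)
  refine (initArrays_runs ((hF1.reg 0 (by simp)).trans hreg0) (by simp [hget1]) (by simp [hget1])
    (by simp [hget1])).mono ?_
  rintro s2 t2 ⟨ht2, hF2, hA, hn', h12, h13⟩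
  have h62 : s2.reg 6 = M + 1 := (hF2.reg 6 (by simp)).trans h6
  have hR : Ready f M (Equiv.refl _) (fun _ => 0) (List.range n) s2 := by
    refine Ready.init hn ?_ ((hF2.reg 2 (by simp)).trans h2) ((hF2.reg 4 (by simp)).trans h4)
      ((hF2.reg 5 (by simp)).trans h5) h62 ?_ hA hn' h12 h13
    · rw [hF2.reg 0 (by simp), hF1.reg 0 (by simp), hreg0]
    · intro c hc
      rw [hF2.col c (by simp at hc; obtain rfl | rfl | rfl := hc <;> simp), hget1]
  refine (loop_runs hf hM hn hM1 hEO hR ((hF2.reg 3 (by simp)).trans h3) S).mono ?_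
  rintro s3 t3 ⟨h0, hB, hle, ht3⟩
  have hSM := (abs_le.1 (hM S)).2
  -- The best value is at most `f S ≤ M`, so it is not the initial `M + 1` and belongs to a saved
  -- set.
  obtain ⟨S', hS', hcol⟩ := hB.resolve_left (by omega)
  refine (output_runs h0 hcol).mono ?_
  rintro s4 t4 ⟨ht4, hout⟩
  refine ⟨S', hout, fun T => ?_, ?_⟩
  · have := hS T (Finset.mem_univ _)
    omega
  · rw [h62, List.length_range, show ((M : ℤ) + 1 + M).toNat = 2 * M + 1 by omega] at ht3
    set E := (Nat.log 2 n + 1) * EO with hE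
    have hE1 : 1 ≤ E := Nat.mul_pos (by omega) hEO
    have hM2 : M ≤ M ^ 3 := Nat.le_self_pow (by omega) M
    set W := n * M ^ 3 * E with hW
    have h1 : n * M ≤ W := (Nat.mul_le_mul_left n hM2).trans (Nat.le_mul_of_pos_right _ hE1)
    have h2 : n * E ≤ W :=
      Nat.mul_le_mul_right _ (Nat.le_mul_of_pos_right _ (by omega))
    have h3 : M * E ≤ W :=
      Nat.mul_le_mul_right _ (hM2.trans (Nat.le_mul_of_pos_left _ hn))
    have h4 : n ≤ n * M := Nat.le_mul_of_pos_right _ hM1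
    have h5 : M ≤ n * M := Nat.le_mul_of_pos_left _ hn
    have h6 : (2 * M + 1) * (800 * (n + 1)) =
      1600 * (n * M) + 1600 * M + 800 * n + 800 := by ring
    have h7 : n * (2000 * E) = 2000 * (n * E) := by ring
    have h8 : (n * (8 * M ^ 2) + 1) * (90000 * (M * E)) = 720000 * W + 90000 * (M * E) := by
      rw [hW]; ring
    omega

/-- `2 ^ (log n + 1) ≤ 2 * n ≤ (n + 1) ^ 2`, and `2 / Real.log 2 < 3`. -/
theorem log_add_one_le (hn : 1 ≤ n) : (Nat.log 2 n : ℝ) + 1 ≤ 3 * Real.log (n + 1) := by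
  have h1 : 2 ^ (Nat.log 2 n + 1) ≤ (n + 1) ^ 2 := by
    have := Nat.pow_log_le_self 2 (x := n) (by omega)
    rw [pow_succ]
    nlinarith
  have h2 : ((2 : ℝ) ^ (Nat.log 2 n + 1)) ≤ ((n : ℝ) + 1) ^ 2 := by exact_mod_cast h1
  have h3 := Real.log_le_log (by positivity) h2
  rw [Real.log_pow, Real.log_pow] at h3
  push_cast at h3
  have h4 := Real.log_two_gt_d9
  have h5 : (0 : ℝ) ≤ Nat.log 2 n := Nat.cast_nonneg _
  nlinarith

end Minimize
end SFM

theorem mainTheorem1 :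
    ∃ (A : SFM.Prog) (C : ℝ), ∀ (n M EO : ℕ), 1 ≤ n → 1 ≤ M → 1 ≤ EO →
      ∀ f : Finset (Fin n) → ℤ, SFM.IsSubmodular f → (∀ S, |f S| ≤ (M : ℤ)) →
        ∃ (s : SFM.State) (t : ℕ) (S : Finset (Fin n)),
          SFM.Exec f EO A (SFM.inputState n M) s t ∧
          s.Outputs S ∧
          (∀ T : Finset (Fin n), f S ≤ f T) ∧
          (t : ℝ) ≤ C * ((n : ℝ) * (M : ℝ) ^ 3 * (EO : ℝ) * Real.log ((n : ℝ) + 1)) := by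
  -- The constant is `900000` from `minimize_runs` times the factor 3 of `log_add_one_le`.
  refine ⟨SFM.minimize, 2700000, fun n M EO hn hM1 hEO f hf hM => ?_⟩
  obtain ⟨s, t, hs, S, hout, hmin, ht⟩ := SFM.minimize_runs hf hM hn hM1 hEO
  refine ⟨s, t, S, hs, hout, hmin, ?_⟩
  have h1 : (t : ℝ) ≤ 900000 * (n * M ^ 3 * ((Nat.log 2 n + 1) * EO)) := by exact_mod_cast ht
  have h2 := mul_le_mul_of_nonneg_left (SFM.log_add_one_le hn)
    (show (0 : ℝ) ≤ 900000 * (n * M ^ 3 * EO) by positivity)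
  linarith
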